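/- **Theorem 1.3 ($\ell_p$-metric compression).** In the $\ell_p$-metric sketching problem ($1\le p\le\infty$, $0<\epsilon\le\frac12$, $\Phi\ge 2$) we are given points $x_1,\dots,x_n\in\mathbb R^d$ ($n,d\ge 1$) with $1\le\|x_i-x_j\|_p\le\Phi$ for all $i\ne j$. A sketching algorithm turns them into a bit string, the sketch; an estimation algorithm, given only the sketch and a pair $i,j$, returns a number $\widetilde E_{ij}$ with $$(1-\epsilon)\|x_i-x_j\|_p\le\widetilde E_{ij}\le(1+\epsilon)\|x_i-x_j\|_p .$$ There are absolute constants $C,\kappa>0$ such that for every $p\in[1,\infty]$ there are a deterministic sketching algorithm and a deterministic estimation algorithm that solve this problem for all $n,d,\epsilon,\Phi$ and all such inputs, with * sketch size at most $C\big(n(d+\log n)\log(1/\epsilon)+n\log\log\Phi\big)$ bits; * sketching time at most $C\big(n^2\log\Phi+nd\log(1/\epsilon)\big)$, where the points are given together with the matrix of their distances $\|x_i-x_j\|_p$; if only the coordinates are given, the same sketch is computed in time at most $C\big(n^2(d+\log\Phi)+nd\log(1/\epsilon)\big)$; * estimation time, for each pair $i,j$, at most $C\,d\log(d\Phi)$ if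 $p<\infty$, and at most $C\,d\log\Phi$ if $p=\infty$. Logarithms are to base $2$. The algorithms are programs for a real RAM with word size $w$, for every $w\ge\kappa\log(nd\Phi/\epsilon)$: it has arrays of $w$-bit words and of real numbers, indexed by words. One step is an arithmetic or bit operation, or a binary logarithm, on words; an arithmetic operation on reals; a power $|t|^p$ or $|t|^{1/p}$ (for $p<\infty$); a comparison; the rounding down of a real to a word; a memory access; or reading up to $w$ consecutive bits of the sketch or appending up to $w$ bits to it. The programs depend neither on the input nor on $w$, which they receive together with the input. -/

import Mathlib

open scoped ENNReal

/-!  A real RAM with word size `w`: finitely many arrays of `w`-bit words and of real numbers, both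
indexed by words, unit-cost word and real arithmetic, a read-only bit string as input and an
append-only bit string as output.  Programs are structured (assignments, branching, loops), fixed
in advance for all inputs and all word sizes, and contain no source of randomness. -/

namespace RealRAM

/-- Binary operations on `w`-bit words. -/
inductive WOp where
  | add | sub | mul | div | mod | land | lor | xor | shl | shr

/-- All operations are those of `w`-bit unsigned words, with wrap-around. -/
def WOp.eval (w : ℕ) : WOp → ℕ → ℕ → ℕ
  | .add, a, b => (a + b) % 2 ^ w
  | .sub, a, b => (a + (2 ^ w - b)) % 2 ^ w
  | .mul, a, b => (a * b) % 2 ^ w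
  | .div, a, b => a / b
  | .mod, a, b => a % b
  | .land, a, b => a &&& b
  | .lor, a, b => a ||| b
  | .xor, a, b => a ^^^ b
  | .shl, a, b => (a * 2 ^ b) % 2 ^ w
  | .shr, a, b => a / 2 ^ b

/-- Binary operations on real numbers. -/
inductive ROp where
  | add | sub | mul | div

noncomputable def ROp.eval : ROp → ℝ → ℝ → ℝ
  | .add, x, y => x + y
  | .sub, x, y => x - y
  | .mul, x, y => x * y
  | .div, x, y => x / y

/-- The memory: `word a i` and `real a i` are the cells with index `i` of the word array and of the
real array with name `a` (a program mentions only finitely many names). -/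
structure State where
  word : ℕ → ℕ → ℕ
  real : ℕ → ℕ → ℝ
  input : List Bool
  output : List Bool

/-- The number whose binary digits, least significant first, are the `len` bits of `l` from
position `pos` on (bits beyond the end of `l` count as `0`). -/
def readBits (l : List Bool) (pos len : ℕ) : ℕ :=
  ∑ t ∈ Finset.range len, if l.getD (pos + t) false then 2 ^ t else 0

/-- The `len` lowest binary digits of `v`, least significant first. -/
def writeBits (v len : ℕ) : List Bool := (List.range len).map fun t => v.testBit t

/-- Expressions with values in the words. -/
inductive WExp where
  | lit (k : ℕ)
  | cell (a : ℕ) (i : WExp)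
  | op (o : WOp) (e f : WExp)
  | log2 (e : WExp)
  | bits (pos len : WExp)

/-- The value of a word expression; at most `w` bits of the input are read at once. -/
def WExp.eval (w : ℕ) (s : State) : WExp → ℕ
  | .lit k => k % 2 ^ w
  | .cell a i => s.word a (i.eval w s)
  | .op o e f => o.eval w (e.eval w s) (f.eval w s)
  | .log2 e => Nat.log 2 (e.eval w s)
  | .bits pos len => readBits s.input (pos.eval w s) (min (len.eval w s) w)

/-- Number of operations in a word expression. -/
def WExp.size : WExp → ℕ
  | .lit _ => 1
  | .cell _ i => i.size + 1
  | .op _ e f => e.size + f.size + 1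
  | .log2 e => e.size + 1
  | .bits pos len => pos.size + len.size + 1

/-- Expressions with real values. -/
inductive RExp where
  | ofWord (e : WExp)
  | cell (a : ℕ) (i : WExp)
  | op (o : ROp) (x y : RExp)
  | pow (x : RExp)
  | root (x : RExp)

/-- The value of a real expression. `pow` is `|x| ^ p` and `root` is `|x| ^ (1 / p)`; for `p = ∞`
`root` is `1`, which is the convention `d ^ (1 / ∞) = 1`. -/
noncomputable def RExp.eval (p : ℝ≥0∞) (w : ℕ) (s : State) : RExp → ℝ
  | .ofWord e => (e.eval w s : ℝ)
  | .cell a i => s.real a (i.eval w s)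
  | .op o x y => o.eval (x.eval p w s) (y.eval p w s)
  | .pow x => |x.eval p w s| ^ p.toReal
  | .root x => |x.eval p w s| ^ (p.toReal)⁻¹

/-- Number of operations in a real expression. -/
def RExp.size : RExp → ℕ
  | .ofWord e => e.size + 1
  | .cell _ i => i.size + 1
  | .op _ x y => x.size + y.size + 1
  | .pow x => x.size + 1
  | .root x => x.size + 1

/-- Tests. -/
inductive BExp where
  | wlt (e f : WExp)
  | weq (e f : WExp)
  | rlt (x y : RExp)
  | not (b : BExp)
  | and (b b' : BExp)

def BExp.Holds (p : ℝ≥0∞) (w : ℕ) (s : State) : BExp → Prop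
  | .wlt e f => e.eval w s < f.eval w s
  | .weq e f => e.eval w s = f.eval w s
  | .rlt x y => x.eval p w s < y.eval p w s
  | .not b => ¬ b.Holds p w s
  | .and b b' => b.Holds p w s ∧ b'.Holds p w s

/-- Number of operations in a test. -/
def BExp.size : BExp → ℕ
  | .wlt e f => e.size + f.size + 1
  | .weq e f => e.size + f.size + 1
  | .rlt x y => x.size + y.size + 1
  | .not b => b.size + 1
  | .and b b' => b.size + b'.size + 1

/-- Programs. `floor a i x` stores the integer part of `x` in a word, if it fits in one;
`emit e len` appends the `len` lowest bits of the word `e` to the output. -/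
inductive Prog where
  | skip
  | wset (a : ℕ) (i e : WExp)
  | rset (a : ℕ) (i : WExp) (x : RExp)
  | floor (a : ℕ) (i : WExp) (x : RExp)
  | emit (e len : WExp)
  | seq (c c' : Prog)
  | ite (b : BExp) (c c' : Prog)
  | loop (b : BExp) (c : Prog)

def State.setWord (s : State) (a i v : ℕ) : State :=
  { s with word := Function.update s.word a (Function.update (s.word a) i v) }

def State.setReal (s : State) (a i : ℕ) (v : ℝ) : State :=
  { s with real := Function.update s.real a (Function.update (s.real a) i v) }

def State.emit (s : State) (v len : ℕ) : State :=
  { s with output := s.output ++ writeBits v len }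

/-- The integer part of `x` if it is a `w`-bit word, and `0` otherwise. -/
noncomputable def floorWord (w : ℕ) (x : ℝ) : ℕ := if ⌊x⌋₊ < 2 ^ w then ⌊x⌋₊ else 0

/-- `Exec p w c s t s'`: started in state `s`, the program `c` halts in state `s'` after exactly `t`
steps, where each operation, each test and each assignment counts as a step. -/
inductive Exec (p : ℝ≥0∞) (w : ℕ) : Prog → State → ℕ → State → Prop where
  | skip (s : State) : Exec p w .skip s 1 s
  | wset (a : ℕ) (i e : WExp) (s : State) :
      Exec p w (.wset a i e) s (i.size + e.size + 1) (s.setWord a (i.eval w s) (e.eval w s))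
  | rset (a : ℕ) (i : WExp) (x : RExp) (s : State) :
      Exec p w (.rset a i x) s (i.size + x.size + 1) (s.setReal a (i.eval w s) (x.eval p w s))
  | floor (a : ℕ) (i : WExp) (x : RExp) (s : State) :
      Exec p w (.floor a i x) s (i.size + x.size + 1)
        (s.setWord a (i.eval w s) (floorWord w (x.eval p w s)))
  | emit (e len : WExp) (s : State) :
      Exec p w (.emit e len) s (e.size + len.size + 1)
        (s.emit (e.eval w s) (min (len.eval w s) w))
  | seq {c c' : Prog} {s s₁ s₂ : State} {t t' : ℕ} (h : Exec p w c s t s₁)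
      (h' : Exec p w c' s₁ t' s₂) : Exec p w (.seq c c') s (t + t') s₂
  | iteTrue {b : BExp} {c c' : Prog} {s s₁ : State} {t : ℕ} (hb : b.Holds p w s)
      (h : Exec p w c s t s₁) : Exec p w (.ite b c c') s (b.size + t + 1) s₁
  | iteFalse {b : BExp} {c c' : Prog} {s s₁ : State} {t : ℕ} (hb : ¬ b.Holds p w s)
      (h : Exec p w c' s t s₁) : Exec p w (.ite b c c') s (b.size + t + 1) s₁
  | loopTrue {b : BExp} {c : Prog} {s s₁ s₂ : State} {t t' : ℕ} (hb : b.Holds p w s)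
      (h : Exec p w c s t s₁) (h' : Exec p w (.loop b c) s₁ t' s₂) :
      Exec p w (.loop b c) s (b.size + t + t' + 1) s₂
  | loopFalse {b : BExp} {c : Prog} {s : State} (hb : ¬ b.Holds p w s) :
      Exec p w (.loop b c) s (b.size + 1) s

/-- Started in `s`, the program `c` halts within `T` steps, in a state that satisfies `post`. -/
def HaltsWithin (p : ℝ≥0∞) (w : ℕ) (c : Prog) (s : State) (T : ℝ) (post : State → Prop) : Prop :=
  ∃ (t : ℕ) (s' : State), Exec p w c s t s' ∧ (t : ℝ) ≤ T ∧ post s'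

/-- The word arrays that hold `a`, `b` and the word size `w` in the first cells of array `0`, and
are `0` elsewhere. -/
def wordInput (a b w : ℕ) : ℕ → ℕ → ℕ
  | 0, 0 => a
  | 0, 1 => b
  | 0, 2 => w
  | _, _ => 0

/-- The sketching input without precomputed distances: the words `n`, `d`, `w`; real array `0` holds
the `n * d` coordinates of the points, row by row; real array `2` holds `ε` and `Φ`. -/
noncomputable def pointsInput {p : ℝ≥0∞} {n d : ℕ} (w : ℕ) (ε Φ : ℝ)
    (x : Fin n → PiLp p (fun _ : Fin d => ℝ)) : State where
  word := wordInput n d w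
  real
    | 0, t => if h : t < n * d then
        x (finProdFinEquiv.symm ⟨t, h⟩).1 (finProdFinEquiv.symm ⟨t, h⟩).2 else 0
    | 2, 0 => ε
    | 2, 1 => Φ
    | _, _ => 0
  input := []
  output := []

/-- The sketching input in which the points come with their metric: as above, and real array `1`
holds the `n * n` distances, row by row. -/
noncomputable def metricInput {p : ℝ≥0∞} [Fact (1 ≤ p)] {n d : ℕ} (w : ℕ) (ε Φ : ℝ)
    (x : Fin n → PiLp p (fun _ : Fin d => ℝ)) : State where
  word := wordInput n d w
  real
    | 0, t => if h : t < n * d then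
        x (finProdFinEquiv.symm ⟨t, h⟩).1 (finProdFinEquiv.symm ⟨t, h⟩).2 else 0
    | 1, t => if h : t < n * n then
        ‖x (finProdFinEquiv.symm ⟨t, h⟩).1 - x (finProdFinEquiv.symm ⟨t, h⟩).2‖ else 0
    | 2, 0 => ε
    | 2, 1 => Φ
    | _, _ => 0
  input := []
  output := []

/-- The input of the estimation algorithm: the sketch, the two indices, and the word size. -/
def queryInput (w : ℕ) (sketch : List Bool) (i j : ℕ) : State where
  word := wordInput i j w
  real := fun _ _ => 0
  input := sketch
  output := []

end RealRAM

/-! The points are arranged in nested nets. The net of level `k` consists of the points `a` with `k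
≤ T a`; its points are at least 2^k/16 apart, every point lies within 2^k/16 of it, and at the top
level M = O(log Φ) only the point 0 is left. A net point `a` of level `k` has a predecessor `q` in
the net of level k+1 with D a q ≤ 2^(k+1)/16, where q = a if `a` is already there. Coordinates are
scaled by g = 16·2^e·d^(1/p) with 2^e > 1/ε. The scaled displacement from `q` to `a` is rounded to
multiples of 2^k and stored in a record that points to the record of `q`. The sum of the
displacements on the path to the root is the sketched position S a, and the estimate is ‖S i - S
j‖/g.

Accuracy. A rounding residual is not lost: it is added to the displacements of the next level. With
the offset O a = g·X a - S a - residual, this means that `a` inherits the offset of `q` exactly. The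
residual is dropped only if `a` is isolated, that is, if no other net point of level `k` lies within
2^k/2; this moves the offset by at most 2^k in each coordinate. Hence the offsets of two net points
at distance r agree if r ≤ 2^k/2, and differ by at most 16r - 6·2^k otherwise (`frameErr`,
`frame_step`). At level 0 the minimum distance 1 makes all points isolated, so no residual is left,
and S a - S b differs from g(X a - X b) by at most 16·D a b in each coordinate. In the norm this is
at most 16·d^(1/p)·D a b = g·D a b/2^e, a relative error below ε (`estimate_accuracy`).

Number of records. An older net point that is isolated at level k+1 has residual 0 and needs no
record at level `k`. A record of any other older point has a neighbour that pays for it, and a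
packing argument gives at most 11n records (`card_records_le`).

Size of a record. The power mean inequality bounds the ℓ_1 norm of a scaled displacement by
d·2^(e+2)·2^k for every p (`sum_abs_le_lpn`, `Mid.run_storeRecord`). A coordinate is written as
several saturated digits followed by a last one; a potential argument shows that 2d digits of e+5
bits suffice for all coordinates together (`QuantInv.step`, `QuantInv.final`). Pointers, levels and
the header use fields of width O(log n + log d + log e + log log Φ).

Time. Building the nets and finding neighbours costs O(n²) per level and O(d) per record. An
estimate follows two paths of at most M records, at cost O(d) each. These bounds are proved together
with correctness in a Hoare calculus whose postconditions see the running time (`Run`). -/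

namespace RealRAM

/-! ### Notation for programs -/

instance : Add WExp := ⟨WExp.op .add⟩
instance : Sub WExp := ⟨WExp.op .sub⟩
instance : Mul WExp := ⟨WExp.op .mul⟩
instance : Div WExp := ⟨WExp.op .div⟩
instance : Mod WExp := ⟨WExp.op .mod⟩
instance (k : ℕ) : OfNat WExp k := ⟨WExp.lit k⟩
instance : Add RExp := ⟨RExp.op .add⟩
instance : Sub RExp := ⟨RExp.op .sub⟩
instance : Mul RExp := ⟨RExp.op .mul⟩
instance : Div RExp := ⟨RExp.op .div⟩

/-- The scalar word variable number `j`. -/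
def WVar (j : ℕ) : WExp := .cell 0 (.lit j)

/-- The scalar real variable number `j`. -/
def RVar (j : ℕ) : RExp := .cell 2 (.lit j)

/-- The power of two with exponent `e`. -/
def twoPow (e : WExp) : WExp := .op .shl 1 e

/-- Assignment to a scalar word variable. -/
def assign (j : ℕ) (e : WExp) : Prog := .wset 0 (.lit j) e

/-- `for j < bnd do body`. -/
def forTo (j : ℕ) (bnd : WExp) (body : Prog) : Prog :=
  .seq (assign j 0) (.loop (.wlt (WVar j) bnd) (.seq body (assign j (WVar j + 1))))

infixr:60 " ⨾ " => Prog.seq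

/-! ### Evaluation -/

section eval
variable {p : ℝ≥0∞} {w : ℕ} {s : State}

/-- All literals and variable numbers in the programs are below 64, so this one bound on the word
size excludes wrap-around for them. -/
theorem WExp.eval_ofNat {k : ℕ} (hw : 64 ≤ 2 ^ w) (hk : k < 64) :
    WExp.eval w s (OfNat.ofNat k) = k :=
  Nat.mod_eq_of_lt (hk.trans_le hw)

theorem WExp.eval_lit {k : ℕ} (hw : 64 ≤ 2 ^ w) (hk : k < 64) : (WExp.lit k).eval w s = k :=
  Nat.mod_eq_of_lt (hk.trans_le hw)

theorem eval_WVar {j : ℕ} (hw : 64 ≤ 2 ^ w) (hj : j < 64) :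
    (WVar j).eval w s = s.word 0 j := by
  simp only [WVar, WExp.eval, Nat.mod_eq_of_lt (hj.trans_le hw)]

theorem eval_RVar {j : ℕ} (hw : 64 ≤ 2 ^ w) (hj : j < 64) :
    (RVar j).eval p w s = s.real 2 j := by
  simp only [RVar, RExp.eval, WExp.eval, Nat.mod_eq_of_lt (hj.trans_le hw)]

theorem WExp.eval_add (e f : WExp) : (e + f).eval w s = (e.eval w s + f.eval w s) % 2 ^ w := rfl
theorem WExp.eval_sub (e f : WExp) :
    (e - f).eval w s = (e.eval w s + (2 ^ w - f.eval w s)) % 2 ^ w := rfl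
theorem WExp.eval_mul (e f : WExp) : (e * f).eval w s = (e.eval w s * f.eval w s) % 2 ^ w := rfl
theorem WExp.eval_div (e f : WExp) : (e / f).eval w s = e.eval w s / f.eval w s := rfl
theorem WExp.eval_mod (e f : WExp) : (e % f).eval w s = e.eval w s % f.eval w s := rfl
theorem WExp.eval_cell (a : ℕ) (i : WExp) : (WExp.cell a i).eval w s = s.word a (i.eval w s) := rfl
theorem WExp.eval_log2 (e : WExp) : (WExp.log2 e).eval w s = Nat.log 2 (e.eval w s) := rfl

theorem WExp.eval_add_of {e f : WExp} {m n : ℕ} (he : e.eval w s = m) (hf : f.eval w s = n)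
    (h : m + n < 2 ^ w) : (e + f).eval w s = m + n := by
  rw [WExp.eval_add, he, hf, Nat.mod_eq_of_lt h]

theorem WExp.eval_mul_of {e f : WExp} {m n : ℕ} (he : e.eval w s = m) (hf : f.eval w s = n)
    (h : m * n < 2 ^ w) : (e * f).eval w s = m * n := by
  rw [WExp.eval_mul, he, hf, Nat.mod_eq_of_lt h]

theorem WExp.eval_sub_of {e f : WExp} {m n : ℕ} (he : e.eval w s = m) (hf : f.eval w s = n)
    (h : n ≤ m) (h' : m < 2 ^ w) : (e - f).eval w s = m - n := by
  rw [WExp.eval_sub, he, hf]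
  have : m + (2 ^ w - n) = (m - n) + 2 ^ w := by omega
  rw [this, Nat.add_mod_right, Nat.mod_eq_of_lt (by omega)]

theorem eval_twoPow_of {e : WExp} {m : ℕ} (hw : 64 ≤ 2 ^ w) (he : e.eval w s = m)
    (h : 2 ^ m < 2 ^ w) : (twoPow e).eval w s = 2 ^ m := by
  change ((WExp.lit 1).eval w s * 2 ^ (e.eval w s)) % 2 ^ w = _
  rw [WExp.eval_lit hw (by norm_num), he, one_mul, Nat.mod_eq_of_lt h]

theorem WExp.eval_madd_of {e f g : WExp} {l m n : ℕ} (he : e.eval w s = l) (hf : f.eval w s = m)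
    (hg : g.eval w s = n) (h : l * m + n < 2 ^ w) : (e * f + g).eval w s = l * m + n :=
  WExp.eval_add_of (WExp.eval_mul_of he hf (by omega)) hg h

theorem RExp.eval_add (x y : RExp) : (x + y).eval p w s = x.eval p w s + y.eval p w s := rfl
theorem RExp.eval_sub (x y : RExp) : (x - y).eval p w s = x.eval p w s - y.eval p w s := rfl
theorem RExp.eval_mul (x y : RExp) : (x * y).eval p w s = x.eval p w s * y.eval p w s := rfl
theorem RExp.eval_div (x y : RExp) : (x / y).eval p w s = x.eval p w s / y.eval p w s := rfl
theorem RExp.eval_cell (a : ℕ) (i : WExp) :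
    (RExp.cell a i).eval p w s = s.real a (i.eval w s) := rfl
theorem RExp.eval_ofWord (e : WExp) : (RExp.ofWord e).eval p w s = (e.eval w s : ℝ) := rfl

theorem size_WVar (j : ℕ) : (WVar j).size = 2 := rfl

end eval

/-! ### States -/

section state
variable (s : State) (a b i j v : ℕ) (r : ℝ)

@[simp] theorem State.word_setWord_same :
    (s.setWord a i v).word a j = if j = i then v else s.word a j := by
  simp [State.setWord, Function.update_apply]

@[simp] theorem State.word_setWord_ne (h : b ≠ a) : (s.setWord a i v).word b = s.word b := by
  simp [State.setWord, h]

@[simp] theorem State.real_setWord : (s.setWord a i v).real = s.real := rfl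
@[simp] theorem State.input_setWord : (s.setWord a i v).input = s.input := rfl
@[simp] theorem State.output_setWord : (s.setWord a i v).output = s.output := rfl

@[simp] theorem State.real_setReal_same :
    (s.setReal a i r).real a j = if j = i then r else s.real a j := by
  simp [State.setReal, Function.update_apply]

@[simp] theorem State.real_setReal_ne (h : b ≠ a) : (s.setReal a i r).real b = s.real b := by
  simp [State.setReal, h]

@[simp] theorem State.word_setReal : (s.setReal a i r).word = s.word := rfl
@[simp] theorem State.input_setReal : (s.setReal a i r).input = s.input := rfl
@[simp] theorem State.output_setReal : (s.setReal a i r).output = s.output := rfl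

@[simp] theorem State.word_emit : (s.emit a b).word = s.word := rfl
@[simp] theorem State.real_emit : (s.emit a b).real = s.real := rfl
@[simp] theorem State.input_emit : (s.emit a b).input = s.input := rfl
@[simp] theorem State.output_emit : (s.emit a b).output = s.output ++ writeBits a b := rfl

theorem State.ext' {s s' : State} (h₁ : ∀ a i, s.word a i = s'.word a i)
    (h₂ : ∀ a i, s.real a i = s'.real a i) (h₃ : s.input = s'.input) (h₄ : s.output = s'.output) :
    s = s' := by
  cases s; cases s'
  simp only [State.mk.injEq]
  exact ⟨funext fun a => funext (h₁ a), funext fun a => funext (h₂ a), h₃, h₄⟩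

theorem State.word_setWord :
    (s.setWord a i v).word b j = if b = a ∧ j = i then v else s.word b j := by
  by_cases h : b = a
  · subst h; simp
  · simp [h]

theorem State.real_setReal :
    (s.setReal a i r).real b j = if b = a ∧ j = i then r else s.real b j := by
  by_cases h : b = a
  · subst h; simp
  · simp [h]

end state

/-! ### Total correctness with time -/

/-- Started in `s`, the program `c` halts after `t` steps in a state `s'` such that `Q t s'`. -/
def Run (p : ℝ≥0∞) (w : ℕ) (c : Prog) (s : State) (Q : ℕ → State → Prop) : Prop :=
  ∃ t s', Exec p w c s t s' ∧ Q t s'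

section run
variable {p : ℝ≥0∞} {w : ℕ} {s : State} {Q : ℕ → State → Prop}

theorem Run.mono {c : Prog} {Q' : ℕ → State → Prop} (h : Run p w c s Q)
    (hQ : ∀ t s', Q t s' → Q' t s') : Run p w c s Q' := by
  obtain ⟨t, s', h, h'⟩ := h
  exact ⟨t, s', h, hQ _ _ h'⟩

theorem Run.skip (h : Q 1 s) : Run p w .skip s Q := ⟨_, _, .skip s, h⟩

theorem Run.wset {a : ℕ} {i e : WExp} {m v : ℕ} (hi : i.eval w s = m) (he : e.eval w s = v)
    (h : Q (i.size + e.size + 1) (s.setWord a m v)) : Run p w (.wset a i e) s Q := by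
  subst hi he; exact ⟨_, _, .wset a i e s, h⟩

theorem Run.rset {a : ℕ} {i : WExp} {x : RExp} {m : ℕ} {v : ℝ} (hi : i.eval w s = m)
    (he : x.eval p w s = v)
    (h : Q (i.size + x.size + 1) (s.setReal a m v)) : Run p w (.rset a i x) s Q := by
  subst hi he; exact ⟨_, _, .rset a i x s, h⟩

theorem Run.assign {j : ℕ} {e : WExp} {v : ℕ} (hw : 64 ≤ 2 ^ w) (hj : j < 64)
    (he : e.eval w s = v) (h : Q (e.size + 2) (s.setWord 0 j v)) :
    Run p w (assign j e) s Q :=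
  Run.wset (WExp.eval_lit hw hj) he (by
    have : (WExp.lit j).size + e.size + 1 = e.size + 2 := by
      change 1 + e.size + 1 = _; omega
    rwa [this])

theorem Run.floor {a : ℕ} {i : WExp} {x : RExp} {m : ℕ} {v : ℝ} (hi : i.eval w s = m)
    (he : x.eval p w s = v) (hv : ⌊v⌋₊ < 2 ^ w)
    (h : Q (i.size + x.size + 1) (s.setWord a m ⌊v⌋₊)) : Run p w (.floor a i x) s Q := by
  subst hi he; refine ⟨_, _, .floor a i x s, ?_⟩
  rwa [floorWord, if_pos hv]

theorem Run.emit {e len : WExp} {v l : ℕ} (he : e.eval w s = v) (hl : len.eval w s = l)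
    (hlw : l ≤ w) (h : Q (e.size + len.size + 1) (s.emit v l)) : Run p w (.emit e len) s Q := by
  subst he hl; refine ⟨_, _, .emit e len s, ?_⟩
  rwa [min_eq_left hlw]

theorem Run.seq {c c' : Prog}
    (h : Run p w c s fun t s' => Run p w c' s' fun t' s'' => Q (t + t') s'') :
    Run p w (c ⨾ c') s Q := by
  obtain ⟨t, s', h, t', s'', h', hQ⟩ := h
  exact ⟨_, _, .seq h h', hQ⟩

theorem Run.ite {b : BExp} {c c' : Prog}
    (h₁ : b.Holds p w s → Run p w c s fun t s' => Q (b.size + t + 1) s')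
    (h₂ : ¬ b.Holds p w s → Run p w c' s fun t s' => Q (b.size + t + 1) s') :
    Run p w (.ite b c c') s Q := by
  by_cases hb : b.Holds p w s
  · obtain ⟨t, s', h, hQ⟩ := h₁ hb
    exact ⟨_, _, .iteTrue hb h, hQ⟩
  · obtain ⟨t, s', h, hQ⟩ := h₂ hb
    exact ⟨_, _, .iteFalse hb h, hQ⟩

/-- A loop with exactly `m` iterations; the invariant `I` depends on the number of remaining
iterations and on the time elapsed. -/
theorem Run.loop {b : BExp} {c : Prog} (I : ℕ → ℕ → State → Prop) (m : ℕ) (h0 : I m 0 s)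
    (hs : ∀ m t s, I (m + 1) t s →
      b.Holds p w s ∧ Run p w c s fun t' s' => I m (t + t' + (b.size + 1)) s')
    (hQ : ∀ t s, I 0 t s → ¬ b.Holds p w s ∧ Q (t + (b.size + 1)) s) :
    Run p w (.loop b c) s Q := by
  suffices H : ∀ m t s, I m t s → ∃ t' s', Exec p w (.loop b c) s t' s' ∧ Q (t + t') s' by
    obtain ⟨t', s', h, h'⟩ := H m 0 s h0
    exact ⟨t', s', h, by simpa using h'⟩
  intro m
  induction m with
  | zero =>
    intro t s h
    exact ⟨_, _, .loopFalse (hQ t s h).1, by simpa using (hQ t s h).2⟩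
  | succ m ih =>
    intro t s h
    obtain ⟨hb, t₁, s₁, h₁, hI⟩ := hs m t s h
    obtain ⟨t₂, s₂, h₂, hQ'⟩ := ih _ _ hI
    refine ⟨_, _, .loopTrue hb h₁ h₂, ?_⟩
    have : t + (b.size + t₁ + t₂ + 1) = t + t₁ + (b.size + 1) + t₂ := by omega
    rwa [this]

/-- The constants count steps: 3 for the initial assignment, `bnd.size + 4` for a test, and 6 for
the increment, so that a round costs `bnd.size + 10` besides its body. -/
theorem Run.forTo {j N : ℕ} {bnd : WExp} {body : Prog} (I : ℕ → ℕ → State → Prop)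
    (hw : 64 ≤ 2 ^ w) (hj : j < 64) (hN : N < 2 ^ w)
    (hI : ∀ i t s, i ≤ N → I i t s → s.word 0 j = i ∧ bnd.eval w s = N)
    (h0 : I 0 3 (s.setWord 0 j 0))
    (hs : ∀ i t s, i < N → I i t s → Run p w body s fun t' s' =>
      s'.word 0 j = i ∧ I (i + 1) (t + t' + (bnd.size + 10)) (s'.setWord 0 j (i + 1)))
    (hQ : ∀ t s, I N t s → Q (t + (bnd.size + 4)) s) :
    Run p w (forTo j bnd body) s Q := by
  have hsz : (BExp.wlt (WVar j) bnd).size + 1 = bnd.size + 4 := by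
    change 2 + bnd.size + 1 + 1 = _; omega
  refine Run.seq (Run.assign hw hj (WExp.eval_ofNat hw (by norm_num)) ?_)
  refine Run.loop (fun m t s => m ≤ N ∧ I (N - m) (t + 3) s) N ⟨le_rfl, ?_⟩ ?_ ?_
  · simpa using h0
  · rintro m t s ⟨hm, h⟩
    obtain ⟨h₁, h₂⟩ := hI _ _ _ (by omega) h
    constructor
    · change (WVar j).eval w s < bnd.eval w s
      rw [eval_WVar hw hj, h₁, h₂]; omega
    · refine Run.seq ((hs _ _ _ (by omega) h).mono ?_)
      rintro t' s' ⟨h₃, h₄⟩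
      refine Run.assign hw hj (v := N - (m + 1) + 1) (WExp.eval_add_of ?_
        (WExp.eval_ofNat hw (by norm_num)) (by omega)) ⟨by omega, ?_⟩
      · rw [eval_WVar hw hj, h₃]
      · have e₁ : N - m = N - (m + 1) + 1 := by omega
        have e₂ : (WVar j + 1 : WExp).size = 4 := rfl
        rw [hsz, e₂, e₁]
        convert h₄ using 1
        omega
  · rintro t s ⟨-, h⟩
    obtain ⟨h₁, h₂⟩ := hI _ _ _ (by omega) h
    constructor
    · change ¬ (WVar j).eval w s < bnd.eval w s
      rw [eval_WVar hw hj, h₁, h₂]; omega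
    · rw [hsz]
      have : (0:WExp).size = 1 := rfl
      rw [this]
      convert hQ _ _ h using 1
      omega

/-- `9 := 0; for 8 < n do if cond then 9 := val`. -/
def scan (cond : BExp) (val : WExp) : Prog :=
  assign 9 0 ⨾ forTo 8 (WVar 0) (.ite cond (assign 9 val) .skip)

/-- Only the cells 8 and 9 change, so every intermediate state is explicit. The result 0 signals
that nothing was found as long as `F` takes no value 0; all uses respect this. -/
theorem Run.scan {cond : BExp} {val : WExp} {n : ℕ} (P : ℕ → Prop) (F : ℕ → ℕ)
    (hw : 64 ≤ 2 ^ w) (hn : s.word 0 0 = n) (hnw : n < 2 ^ w)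
    (hc : ∀ b < n, ∀ v, cond.Holds p w ((s.setWord 0 9 v).setWord 0 8 b) ↔ P b)
    (hv : ∀ b < n, ∀ v, val.eval w ((s.setWord 0 9 v).setWord 0 8 b) = F b)
    (hQ : ∀ t v, t ≤ (cond.size + val.size + 15) * n + 12 →
      ((v = 0 ∧ ∀ b < n, ¬ P b) ∨ ∃ b < n, P b ∧ v = F b) →
      Q t ((s.setWord 0 9 v).setWord 0 8 n)) :
    Run p w (scan cond val) s Q := by
  refine Run.seq (Run.assign hw (by norm_num) (WExp.eval_ofNat hw (by norm_num)) ?_)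
  refine Run.forTo (N := n) (fun i t s' => t ≤ (cond.size + val.size + 15) * i + 3 ∧
      ∃ v, s' = (s.setWord 0 9 v).setWord 0 8 i ∧
        ((v = 0 ∧ ∀ b < i, ¬ P b) ∨ ∃ b < i, P b ∧ v = F b)) hw (by norm_num) hnw ?_ ?_ ?_ ?_
  · rintro i t s' - ⟨-, v, rfl, -⟩
    refine ⟨by simp, ?_⟩
    rw [eval_WVar hw (by norm_num)]
    simpa using hn
  · exact ⟨by omega, 0, rfl, Or.inl ⟨rfl, by omega⟩⟩
  · rintro i t s' hi ⟨ht, v, rfl, h⟩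
    have hz : (WVar 0).size = 2 := rfl
    refine Run.ite (fun hb => ?_) (fun hb => ?_)
    · have hb' := (hc i hi v).1 hb
      refine Run.assign hw (by norm_num) (hv i hi v) ⟨by simp, ?_, F i, ?_,
        Or.inr ⟨i, by omega, hb', rfl⟩⟩
      · rw [hz]; nlinarith
      · apply State.ext' <;> intros <;> simp [State.word_setWord] <;> grind
    · have hb' := fun h => hb ((hc i hi v).2 h)
      refine Run.skip ⟨by simp, ?_, v, ?_, ?_⟩
      · rw [hz]; nlinarith
      · apply State.ext' <;> intros <;> simp [State.word_setWord] <;> grind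
      · rcases h with ⟨h, h'⟩ | ⟨b, h, h'⟩
        · refine Or.inl ⟨h, fun b hb => ?_⟩
          rcases Nat.lt_succ_iff_lt_or_eq.1 hb with h | rfl
          · exact h' b h
          · exact hb'
        · exact Or.inr ⟨b, by omega, h'⟩
  · rintro t s' ⟨ht, v, rfl, h⟩
    refine hQ _ _ ?_ h
    have hz : (WVar 0).size = 2 := rfl
    have hz' : (0 : WExp).size = 1 := rfl
    rw [hz, hz']; omega

end run


/-! ### Displacements and chains of displacements -/

/-- The coordinate that the slot `u` contributes to. -/
def slotPos (f : ℕ → ℕ) (u : ℕ) : ℕ := ∑ v ∈ Finset.range u, f v % 2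

/-- The total contribution of the first `u` slots to the coordinate `t`. -/
noncomputable def slotSum (f : ℕ → ℕ) (B u t : ℕ) : ℝ :=
  ∑ v ∈ Finset.range u, if slotPos f v = t then ((f v / 2 : ℕ) : ℝ) - B else 0

theorem slotPos_succ (f : ℕ → ℕ) (u : ℕ) : slotPos f (u + 1) = slotPos f u + f u % 2 :=
  Finset.sum_range_succ _ _

theorem slotSum_succ (f : ℕ → ℕ) (B u t : ℕ) : slotSum f B (u + 1) t =
    slotSum f B u t + if slotPos f u = t then ((f u / 2 : ℕ) : ℝ) - B else 0 :=
  Finset.sum_range_succ _ _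

theorem slotPos_congr {f g : ℕ → ℕ} {u : ℕ} (h : ∀ v < u, f v = g v) :
    slotPos f u = slotPos g u :=
  Finset.sum_congr rfl fun v hv => by rw [h v (Finset.mem_range.1 hv)]

theorem slotSum_congr {f g : ℕ → ℕ} {u : ℕ} (B t : ℕ) (h : ∀ v < u, f v = g v) :
    slotSum f B u t = slotSum g B u t :=
  Finset.sum_congr rfl fun v hv => by
    have hv := Finset.mem_range.1 hv
    rw [h v hv, slotPos_congr fun v' hv' => h v' (hv'.trans hv)]

/-- `Reach rp rl sl d B m r v`: from record `r`, following the parent pointers `rp` leads in `m`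
steps to the root `0`, and the displacements on the way sum up to `v`. -/
inductive Reach (rp rl : ℕ → ℕ) (sl : ℕ → ℕ → ℕ) (d B : ℕ) : ℕ → ℕ → (ℕ → ℝ) → Prop where
  | root {v : ℕ → ℝ} (hv : ∀ t < d, v t = 0) : Reach rp rl sl d B 0 0 v
  | step {m r : ℕ} {v v' : ℕ → ℝ} (hr : rp r < r) (h : Reach rp rl sl d B m (rp r) v)
      (hv : ∀ t < d, v' t = v t + 2 ^ rl r * slotSum (sl r) B (2 * d) t) :
      Reach rp rl sl d B (m + 1) r v'

/-- Parents have smaller indices, so a path never leaves the records up to `r`; storing later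
records does not disturb it. -/
theorem Reach.congr {rp rl rp' rl' : ℕ → ℕ} {sl sl' : ℕ → ℕ → ℕ} {d B m r : ℕ} {v : ℕ → ℝ}
    (h : Reach rp rl sl d B m r v)
    (h' : ∀ r' ≤ r, rp' r' = rp r' ∧ rl' r' = rl r' ∧ ∀ u < 2 * d, sl' r' u = sl r' u) :
    Reach rp' rl' sl' d B m r v := by
  induction h with
  | root hv => exact .root hv
  | @step m r v v' hr _ hv ih =>
    obtain ⟨h₁, h₂, h₃⟩ := h' _ le_rfl
    refine .step (v := v) (by omega) ?_ ?_
    · rw [h₁]; exact ih fun r' hr' => h' r' (by omega)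
    · intro t ht
      rw [hv t ht, h₂, slotSum_congr _ _ h₃]

/-! ### Nets -/

/-- Another net point of level `k` lies close to `a`, at the scale of level `k`. -/
def Near (n : ℕ) (D : ℕ → ℕ → ℝ) (T : ℕ → ℕ) (k a : ℕ) : Prop :=
  ∃ b < n, b ≠ a ∧ k ≤ T b ∧ 2 * D a b ≤ 2 ^ k

structure IsDist (D : ℕ → ℕ → ℝ) : Prop where
  self (a : ℕ) : D a a = 0
  comm (a b : ℕ) : D a b = D b a
  tri (a b c : ℕ) : D a c ≤ D a b + D b c

/-- The separation 2^k/16 is smaller than the radius 2^k/2 in `Near` by a constant factor: packing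
still bounds the number of neighbours, while a move by the covering radius 2^k/16 is small against
the radius of isolation. -/
def Separated (n : ℕ) (D : ℕ → ℕ → ℝ) (T : ℕ → ℕ) : Prop :=
  ∀ a < n, ∀ b < n, a ≠ b → ∀ k ≤ T a, k ≤ T b → (2 : ℝ) ^ k ≤ 16 * D a b

/-- A pair (level, point) is charged to a net point whose top level is at most five above that
level. A first record is charged to its own point, and so is a later record if the point tops out
within five levels. Otherwise the close neighbour must top out soon, since two points that survive
six more levels would be too close, and the neighbour is charged. Each point receives at most 1 + 5
+ 5 charges. -/
theorem card_records_le {n : ℕ} {D : ℕ → ℕ → ℝ} {T : ℕ → ℕ} (hD : IsDist D)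
    (hs : Separated n D T) (F : Finset (ℕ × ℕ))
    (hF : ∀ x ∈ F, x.2 < n ∧ (T x.2 = x.1 ∨ x.1 < T x.2 ∧ Near n D T (x.1 + 1) x.2)) :
    F.card ≤ 11 * n := by
  classical
  have hb : ∀ x : ℕ × ℕ, ∃ b, Near n D T (x.1 + 1) x.2 →
      b < n ∧ b ≠ x.2 ∧ x.1 + 1 ≤ T b ∧ 2 * D x.2 b ≤ 2 ^ (x.1 + 1) := by
    intro x
    by_cases h : Near n D T (x.1 + 1) x.2
    · obtain ⟨b, h⟩ := h
      exact ⟨b, fun _ => h⟩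
    · exact ⟨0, fun h' => absurd h' h⟩
  choose nb hnb using hb
  -- The first component tells the kinds of charges apart and allows the level to be recovered: 0
  -- for first records, 1 to 5 for charges to the point itself, 6 to 10 for charges to the
  -- neighbour.
  let g : ℕ × ℕ → ℕ × ℕ := fun x =>
    if T x.2 = x.1 then (0, x.2)
    else if T x.2 < x.1 + 6 then (T x.2 - x.1, x.2)
    else (6 + (T (nb x) - (x.1 + 1)), nb x)
  -- With k = x.1, nearness at level k+1 gives 16D ≤ 2^(k+4), which is less than the separation
  -- 2^(k+6) of two points of level k+6.
  have hsmall : ∀ x ∈ F, T x.2 ≠ x.1 → ¬ T x.2 < x.1 + 6 → T (nb x) < x.1 + 6 := by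
    intro x hx h1 h2
    obtain ⟨hn, h | h⟩ := hF x hx
    · exact absurd h h1
    · obtain ⟨h3, h4, h5, h6⟩ := hnb x h.2
      by_contra h7
      have := hs x.2 hn _ h3 (Ne.symm h4) (x.1 + 6) (by omega) (by omega)
      have hp : (0 : ℝ) < 2 ^ x.1 := by positivity
      rw [pow_add] at this
      rw [pow_succ] at h6
      linarith
  have hcard : F.card ≤ (Finset.range 11 ×ˢ Finset.range n).card := by
    refine Finset.card_le_card_of_injOn g ?_ ?_
    · intro x hx
      have hx : x ∈ F := hx
      obtain ⟨hn, h⟩ := hF x hx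
      simp only [Finset.coe_product, Finset.coe_range, Set.mem_prod, Set.mem_Iio, g]
      split_ifs with h1 h2
      · exact ⟨by norm_num, hn⟩
      · exact ⟨by show T x.2 - x.1 < 11; omega, hn⟩
      · have := hsmall x hx h1 h2
        exact ⟨by show 6 + (T (nb x) - (x.1 + 1)) < 11; omega,
          (hnb x ((h.resolve_left h1).2)).1⟩
    · intro x hx y hy hxy
      have hx : x ∈ F := hx
      have hy : y ∈ F := hy
      obtain ⟨hn, h⟩ := hF x hx
      obtain ⟨hn', h'⟩ := hF y hy
      simp only [g] at hxy
      split_ifs at hxy with h1 h2 h3 h4 h5 h6 h7 h8 <;> simp only [Prod.mk.injEq] at hxy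
      · obtain ⟨-, h⟩ := hxy
        exact Prod.ext (by rw [← h1, ← h2, h]) h
      · omega
      · omega
      · omega
      · obtain ⟨h, h'⟩ := hxy
        refine Prod.ext ?_ h'
        rw [h'] at h
        have h1' := h'
        rw [h'] at h1
        rcases ‹_ ∨ _ ∧ Near n D T (x.1 + 1) x.2› with h9 | h9
        · rw [h'] at h9; omega
        · rw [h'] at h9
          rcases hF y hy with ⟨-, h10 | h10⟩ <;> omega
      · omega
      · omega
      · omega
      · have e₁ := hsmall x hx h1 h4
        have e₂ := hsmall y hy h7 h8
        obtain ⟨a1, a2, a3, a4⟩ := hnb x ((h.resolve_left h1).2)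
        obtain ⟨b1, b2, b3, b4⟩ := hnb y ((h'.resolve_left h7).2)
        obtain ⟨c1, c2⟩ := hxy
        rw [c2] at c1 a3 a4
        have hk : x.1 = y.1 := by omega
        refine Prod.ext hk ?_
        -- Two points that charge the same neighbour at the same level k are within 2·2^k of each
        -- other, hence 16D ≤ 2^(k+5). Both have level at least k+6, so separation forces them to
        -- coincide.
        by_contra hne
        have hsp := hs x.2 hn y.2 hn' hne (x.1 + 6) (by omega) (by omega)
        have ht := hD.tri x.2 (nb y) y.2
        rw [hD.comm (nb y)] at ht
        rw [hk] at hsp a4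
        have hp : (0 : ℝ) < 2 ^ y.1 := by positivity
        rw [pow_add] at hsp
        rw [pow_succ] at a4 b4
        linarith
  simpa using hcard

/-- Bound on the discrepancy of the frames of two net points of level `k` at distance `r`. -/
noncomputable def frameErr (k : ℕ) (r : ℝ) : ℝ :=
  if 8 * 2 ^ k < 16 * r then 16 * r - 6 * 2 ^ k else 0

theorem frameErr_zero_le {r : ℝ} (hr : 0 ≤ r) : frameErr 0 r ≤ 16 * r := by
  unfold frameErr; split_ifs <;> norm_num <;> linarith

/-- The constant 6 reproduces itself: 16r' - 12·2^k ≤ 16r - 8·2^k, and two dropped residuals add at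
most 2·2^k. For 2r ≤ 2^k nothing is dropped, and 16r' ≤ 12·2^k is below the threshold 16·2^k of
level k+1, so the error stays 0. If the old error is 0 but 2r > 2^k, the new error is at most 2·2^k
≤ 16r - 6·2^k. -/
theorem frameErr_step {k : ℕ} {r r' u v e₀ e : ℝ} (hr : 16 * r' ≤ 16 * r + 4 * 2 ^ k)
    (hu : u ≤ if 2 * r ≤ 2 ^ k then 0 else 2 ^ k) (hv : v ≤ if 2 * r ≤ 2 ^ k then 0 else 2 ^ k)
    (he₀ : e₀ ≤ frameErr (k + 1) r') (he : e ≤ e₀ + u + v) : e ≤ frameErr k r := by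
  unfold frameErr at *
  rw [pow_succ] at he₀
  have hp : (0 : ℝ) < 2 ^ k := by positivity
  split_ifs at * <;> linarith

/-- The predecessors are within 2^(k+1)/16 of their points, so passing to them changes the distance
by at most 2^k/4. If `a` and `b` are within 2^k/2, each witnesses that the other is not isolated, so
both inherit their offsets exactly. -/
theorem frame_step {n k : ℕ} {D : ℕ → ℕ → ℝ} {T : ℕ → ℕ} (hD : IsDist D) {a b qa qb : ℕ}
    (ha : a < n) (hb : b < n) (hab : a ≠ b) (hTa : k ≤ T a) (hTb : k ≤ T b)
    (hqa : 16 * D a qa ≤ 2 ^ (k + 1)) (hqb : 16 * D b qb ≤ 2 ^ (k + 1))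
    {oa ob oa' ob' : ℝ} (h₀ : |oa' - ob'| ≤ frameErr (k + 1) (D qa qb))
    (h₁ : |oa - oa'| ≤ 2 ^ k) (h₁' : Near n D T k a → oa = oa')
    (h₂ : |ob - ob'| ≤ 2 ^ k) (h₂' : Near n D T k b → ob = ob') :
    |oa - ob| ≤ frameErr k (D a b) := by
  refine frameErr_step (r' := D qa qb) (u := |oa - oa'|) (v := |ob - ob'|) ?_ ?_ ?_ h₀ ?_
  · have := hD.tri qa a qb
    have := hD.tri a b qb
    rw [hD.comm qa a] at *
    rw [pow_succ] at *
    linarith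
  · split_ifs with h
    · rw [h₁' ⟨b, hb, hab.symm, hTb, h⟩]; simp
    · exact h₁
  · split_ifs with h
    · rw [h₂' ⟨a, ha, hab, hTa, by rwa [hD.comm]⟩]; simp
    · exact h₂
  · rw [abs_sub_comm ob]
    calc |oa - ob| = |(oa - oa') + (oa' - ob') + (ob' - ob)| := by ring_nf
      _ ≤ |oa - oa'| + |oa' - ob'| + |ob' - ob| := abs_add_three _ _ _
      _ = _ := by ring

/-! ### The `p`-norm of the first `d` terms of a sequence -/

noncomputable def lpn (p : ℝ≥0∞) (d : ℕ) (f : ℕ → ℝ) : ℝ :=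
  ‖(WithLp.toLp p fun t : Fin d => f t : PiLp p fun _ : Fin d => ℝ)‖

theorem lpn_congr {p : ℝ≥0∞} {d : ℕ} {f g : ℕ → ℝ} (h : ∀ t < d, f t = g t) : lpn p d f = lpn p d g := by
  unfold lpn
  congr 2
  ext t
  exact h t t.2

section lpn
variable (p : ℝ≥0∞) [Fact (1 ≤ p)] (d : ℕ) (f : ℕ → ℝ)

theorem lpn_eq_sum (hp : p ≠ ⊤) :
    lpn p d f = (∑ t ∈ Finset.range d, |f t| ^ p.toReal) ^ (p.toReal)⁻¹ := by
  have h0 : 0 < p.toReal :=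
    ENNReal.toReal_pos (zero_lt_one.trans_le Fact.out).ne' hp
  rw [lpn, PiLp.norm_eq_sum h0, Finset.sum_range, one_div]
  simp [Real.norm_eq_abs]

theorem lpn_top : lpn ⊤ d f = ⨆ t : Fin d, |f t| := by
  rw [lpn, PiLp.norm_eq_ciSup]
  simp [Real.norm_eq_abs]

variable {d f}

/-- For p = ∞ the exponent is 0⁻¹ = 0, so the factor is 1; the same formula thus covers all p. -/
theorem lpn_le {c : ℝ} (hd : 1 ≤ d) (h : ∀ t < d, |f t| ≤ c) :
    lpn p d f ≤ c * (d : ℝ) ^ (p.toReal)⁻¹ := by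
  have hc : 0 ≤ c := (abs_nonneg _).trans (h 0 hd)
  rcases eq_or_ne p ⊤ with rfl | hp
  · rw [lpn_top]
    have : Nonempty (Fin d) := ⟨⟨0, hd⟩⟩
    simpa using ciSup_le fun t : Fin d => h t t.2
  · have h0 : 0 < p.toReal :=
      ENNReal.toReal_pos (zero_lt_one.trans_le Fact.out).ne' hp
    rw [lpn_eq_sum p d f hp]
    calc (∑ t ∈ Finset.range d, |f t| ^ p.toReal) ^ (p.toReal)⁻¹
        ≤ (∑ t ∈ Finset.range d, c ^ p.toReal) ^ (p.toReal)⁻¹ := by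
          refine Real.rpow_le_rpow (Finset.sum_nonneg fun _ _ => by positivity)
            (Finset.sum_le_sum fun t ht => ?_) (by positivity)
          exact Real.rpow_le_rpow (abs_nonneg _) (h t (Finset.mem_range.1 ht)) h0.le
      _ = c * (d : ℝ) ^ (p.toReal)⁻¹ := by
          rw [Finset.sum_const, Finset.card_range, nsmul_eq_mul, mul_comm,
            Real.mul_rpow (by positivity) (by positivity), ← Real.rpow_mul hc,
            mul_inv_cancel₀ h0.ne', Real.rpow_one]

/-- The power mean inequality in a form that also makes sense for p = ∞. It turns a bound on the
distance into a bound on the ℓ_1 norm of the scaled displacement, which is what the quantization can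
afford. -/
theorem sum_abs_le_lpn (hd : 1 ≤ d) :
    (d : ℝ) ^ (p.toReal)⁻¹ * ∑ t ∈ Finset.range d, |f t| ≤ d * lpn p d f := by
  have hd0 : (0 : ℝ) < d := by exact_mod_cast hd
  rcases eq_or_ne p ⊤ with rfl | hp
  · rw [lpn_top]
    have : ∀ t ∈ Finset.range d, |f t| ≤ ⨆ t : Fin d, |f t| := fun t ht =>
      le_ciSup (f := fun t : Fin d => |f t|) (Set.finite_range _).bddAbove
        ⟨t, Finset.mem_range.1 ht⟩
    simpa using Finset.sum_le_sum this
  · have h1 : 1 ≤ p.toReal := by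
      rw [← ENNReal.toReal_one]
      exact ENNReal.toReal_mono hp Fact.out
    have h0 : 0 < p.toReal := by linarith
    rw [lpn_eq_sum p d f hp]
    have key := Real.rpow_sum_le_const_mul_sum_rpow (Finset.range d) f h1
    rw [Finset.card_range] at key
    set A := ∑ t ∈ Finset.range d, |f t|
    set S := ∑ t ∈ Finset.range d, |f t| ^ p.toReal
    have hA : 0 ≤ A := Finset.sum_nonneg fun _ _ => abs_nonneg _
    have hS : 0 ≤ S := Finset.sum_nonneg fun _ _ => by positivity
    have h2 : A ≤ ((d : ℝ) ^ (p.toReal - 1) * S) ^ (p.toReal)⁻¹ := by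
      calc A = (A ^ p.toReal) ^ (p.toReal)⁻¹ := by
            rw [← Real.rpow_mul hA, mul_inv_cancel₀ h0.ne', Real.rpow_one]
        _ ≤ _ := Real.rpow_le_rpow (by positivity) key (by positivity)
    rw [Real.mul_rpow (by positivity) hS, ← Real.rpow_mul hd0.le] at h2
    calc (d : ℝ) ^ (p.toReal)⁻¹ * A ≤ (d : ℝ) ^ (p.toReal)⁻¹ *
          ((d : ℝ) ^ ((p.toReal - 1) * (p.toReal)⁻¹) * S ^ (p.toReal)⁻¹) := by gcongr
      _ = d * S ^ (p.toReal)⁻¹ := by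
          rw [← mul_assoc, ← Real.rpow_add hd0]
          have : (p.toReal)⁻¹ + (p.toReal - 1) * (p.toReal)⁻¹ = 1 := by
            rw [sub_mul, mul_inv_cancel₀ h0.ne']; ring
          rw [this, Real.rpow_one]

end lpn


/-! ### The environment of the sketching program -/

/-- The words are long enough for all numbers that occur. -/
structure WordBounds (w n d e M P : ℕ) : Prop where
  hw : 64 ≤ 2 ^ w
  n_pos : 1 ≤ n
  d_pos : 1 ≤ d
  e_pos : 1 ≤ e
  M_pos : 6 ≤ M
  nn : n * n + n < 2 ^ w
  nd : n * d + d < 2 ^ w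
  slots : 12 * n * (2 * d) + 2 * d < 2 ^ w
  powM : 2 ^ (M + 1) < 2 ^ w
  powe : 2 ^ (e + 5) < 2 ^ w
  out : 3 * P + 1 + 12 * n * (3 * P + 2 * d * (e + 5)) < 2 ^ w
  nP : 12 * n < 2 ^ P
  dP : d < 2 ^ P
  eP : e < 2 ^ P
  MP : M < 2 ^ P
  Pw : P + 1 ≤ w

/-- The input and the global parameters are in their places; `T a` is the level of the point `a`. -/
structure Env (w n d e M P : ℕ) (g : ℝ) (X D : ℕ → ℕ → ℝ) (T : ℕ → ℕ) (s : State) : Prop where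
  n_eq : s.word 0 0 = n
  d_eq : s.word 0 1 = d
  w_eq : s.word 0 2 = w
  e_eq : s.word 0 3 = e
  M_eq : s.word 0 4 = M
  P_eq : s.word 0 5 = P
  g_eq : s.real 2 2 = g
  x_eq : ∀ a < n, ∀ t < d, s.real 0 (a * d + t) = X a t
  dist_eq : ∀ a < n, ∀ b < n, s.real 1 (a * n + b) = D a b
  T_eq : ∀ a < n, s.word 1 a = T a

section
variable {p : ℝ≥0∞} {w n d e M P : ℕ} {g : ℝ} {X D : ℕ → ℕ → ℝ} {T : ℕ → ℕ} {s s' : State}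

theorem Env.setWord (h : Env w n d e M P g X D T s) {a i v : ℕ} (ha : a = 0 ∧ 6 ≤ i ∨ 2 ≤ a) :
    Env w n d e M P g X D T (s.setWord a i v) := by
  obtain ⟨h1, h2, h3, h4, h5, h6, h7, h8, h9, h10⟩ := h
  constructor <;> intros <;> simp only [State.word_setWord, State.real_setWord] <;>
    first
    | (rw [if_neg (by omega)]; simp_all)
    | simp_all

/-- `s'` arises from `s` by changing scratch cells, slots with index in `[l, h)` and residuals with
index in `[l', h')` only. -/
structure Frame (l h l' h' : ℕ) (s s' : State) : Prop where
  word0 : ∀ j, j < 8 ∨ j = 10 ∨ j = 11 → s'.word 0 j = s.word 0 j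
  word : ∀ a, a ≠ 0 → a ≠ 5 → s'.word a = s.word a
  slot : ∀ i, i < l ∨ h ≤ i → s'.word 5 i = s.word 5 i
  real2 : ∀ j, j ≠ 3 → s'.real 2 j = s.real 2 j
  real : ∀ a, a ≠ 2 → a ≠ 3 → s'.real a = s.real a
  res : ∀ i, i < l' ∨ h' ≤ i → s'.real 3 i = s.real 3 i
  output : s'.output = s.output

theorem Frame.refl (l h l' h' : ℕ) (s : State) : Frame l h l' h' s s := by
  constructor <;> intros <;> rfl

theorem Frame.trans {l h l' h' : ℕ} {s s' s'' : State} (h₁ : Frame l h l' h' s s')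
    (h₂ : Frame l h l' h' s' s'') : Frame l h l' h' s s'' where
  word0 j hj := (h₂.word0 j hj).trans (h₁.word0 j hj)
  word a ha ha' := (h₂.word a ha ha').trans (h₁.word a ha ha')
  slot i hi := (h₂.slot i hi).trans (h₁.slot i hi)
  real2 j hj := (h₂.real2 j hj).trans (h₁.real2 j hj)
  real a ha ha' := (h₂.real a ha ha').trans (h₁.real a ha ha')
  res i hi := (h₂.res i hi).trans (h₁.res i hi)
  output := h₂.output.trans h₁.output

variable {l h l' h' : ℕ}

theorem Frame.setWord (hf : Frame l h l' h' s s') {j v : ℕ} (hj : j = 8 ∨ j = 9 ∨ 12 ≤ j) :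
    Frame l h l' h' s (s'.setWord 0 j v) := by
  refine hf.trans ?_
  constructor <;> intros <;> simp_all <;> omega

theorem Frame.setSlot (hf : Frame l h l' h' s s') {i v : ℕ} (hi : l ≤ i ∧ i < h) :
    Frame l h l' h' s (s'.setWord 5 i v) := by
  refine hf.trans ?_
  constructor <;> intros <;> simp_all
  omega

theorem Frame.setReal2 (hf : Frame l h l' h' s s') {v : ℝ} :
    Frame l h l' h' s (s'.setReal 2 3 v) := by
  refine hf.trans ?_
  constructor <;> intros <;> simp_all

theorem Frame.setRes (hf : Frame l h l' h' s s') {i : ℕ} {v : ℝ} (hi : l' ≤ i ∧ i < h') :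
    Frame l h l' h' s (s'.setReal 3 i v) := by
  refine hf.trans ?_
  constructor <;> intros <;> simp_all
  omega

theorem Env.frame (hE : Env w n d e M P g X D T s) (hf : Frame l h l' h' s s') :
    Env w n d e M P g X D T s' where
  n_eq := (hf.word0 _ (by omega)).trans hE.n_eq
  d_eq := (hf.word0 _ (by omega)).trans hE.d_eq
  w_eq := (hf.word0 _ (by omega)).trans hE.w_eq
  e_eq := (hf.word0 _ (by omega)).trans hE.e_eq
  M_eq := (hf.word0 _ (by omega)).trans hE.M_eq
  P_eq := (hf.word0 _ (by omega)).trans hE.P_eq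
  g_eq := (hf.real2 _ (by omega)).trans hE.g_eq
  x_eq a ha t ht := by rw [hf.real _ (by omega) (by omega)]; exact hE.x_eq a ha t ht
  dist_eq a ha t ht := by rw [hf.real _ (by omega) (by omega)]; exact hE.dist_eq a ha t ht
  T_eq a ha := by rw [hf.word _ (by omega) (by omega)]; exact hE.T_eq a ha

/-! ### Quantization of a displacement -/

/-- The index of the residual of the current point in the current coordinate. -/
def resIdx : WExp := WVar 7 * WVar 1 + WVar 12

/-- The index of the current slot of the current record. -/
def slotIdx : WExp := WVar 11 * (2 * WVar 1) + WVar 13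

/-- The bias of the slots. -/
def biasExp : WExp := twoPow (WVar 3 + 2)

/-- Cell 14 receives the biased digit and cell 15 the end mark. A residual out of range gets the
extreme digit without end mark, so that the same coordinate continues in the next slot. -/
def chooseSlot : Prog :=
  .rset 2 3 (.cell 3 resIdx / .ofWord (twoPow (WVar 6))) ⨾
  .ite (.rlt (RVar 3 + .ofWord biasExp) (.ofWord 0)) (assign 14 0 ⨾ assign 15 0)
    (.ite (.rlt (.ofWord biasExp) (RVar 3)) (assign 14 (2 * biasExp) ⨾ assign 15 0)
      (.floor 0 14 (RVar 3 + .ofWord biasExp) ⨾ assign 15 1))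

def quantStep : Prog :=
  .ite (.wlt (WVar 12) (WVar 1))
    (chooseSlot ⨾
      .rset 3 resIdx (.cell 3 resIdx -
        (.ofWord (WVar 14) - .ofWord biasExp) * .ofWord (twoPow (WVar 6))) ⨾
      .wset 5 slotIdx (2 * WVar 14 + WVar 15) ⨾
      assign 12 (WVar 12 + WVar 15))
    (.wset 5 slotIdx 0)

def quantize : Prog := assign 12 0 ⨾ forTo 13 (2 * WVar 1) quantStep

/-- The slot content `z`, with end mark `f`, for the residual `y` and the bias `B`. -/
def SlotChoice (B : ℕ) (y : ℝ) (z f : ℕ) : Prop :=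
  (y + B < 0 ∧ z = 0 ∧ f = 0) ∨ ((B : ℝ) < y ∧ z = 2 * B ∧ f = 0) ∨
    (0 ≤ y + B ∧ y ≤ B ∧ z = ⌊y + B⌋₊ ∧ f = 1)

theorem SlotChoice.le {B z f : ℕ} {y : ℝ} (h : SlotChoice B y z f) : z ≤ 2 * B ∧ f ≤ 1 := by
  rcases h with ⟨-, rfl, rfl⟩ | ⟨-, rfl, rfl⟩ | ⟨h1, h2, rfl, rfl⟩
  · omega
  · omega
  · refine ⟨?_, le_rfl⟩
    rw [← Nat.floor_natCast (R := ℝ) (2 * B)]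
    exact Nat.floor_le_floor (by push_cast; linarith)

theorem eval_biasExp (hB : WordBounds w n d e M P) (he : s.word 0 3 = e) :
    biasExp.eval w s = 2 ^ (e + 2) := by
  have := hB.powe
  have h2 : 2 ^ (e + 2) < 2 ^ w := lt_of_le_of_lt (Nat.pow_le_pow_right (by norm_num) (by omega)) this
  exact eval_twoPow_of hB.hw (WExp.eval_add_of (by rw [eval_WVar hB.hw (by norm_num), he])
    (WExp.eval_ofNat hB.hw (by norm_num)) ((Nat.lt_two_pow_self).trans h2)) h2

theorem eval_powLevel (hB : WordBounds w n d e M P) {k : ℕ} (hk : k ≤ M) (h6 : s.word 0 6 = k) :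
    (twoPow (WVar 6)).eval w s = 2 ^ k := by
  have := hB.powM
  have h2 : 2 ^ k < 2 ^ w := lt_of_le_of_lt (Nat.pow_le_pow_right (by norm_num) (by omega)) this
  exact eval_twoPow_of hB.hw (by rw [eval_WVar hB.hw (by norm_num), h6]) h2

theorem idx_lt {a n d t : ℕ} (ha : a < n) (ht : t < d) : a * d + t < n * d := by
  calc a * d + t < a * d + d := by omega
    _ = (a + 1) * d := by ring
    _ ≤ n * d := Nat.mul_le_mul_right _ ha

theorem eval_idx (hw : 64 ≤ 2 ^ w) (hB : n * d + d < 2 ^ w) {i j l a t : ℕ} (ha : a < n)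
    (ht : t ≤ d) (hi : i < 64) (hj : j < 64) (hl : l < 64) (hi' : s.word 0 i = a)
    (hj' : s.word 0 j = d) (hl' : s.word 0 l = t) :
    (WVar i * WVar j + WVar l).eval w s = a * d + t := by
  refine WExp.eval_madd_of ?_ ?_ ?_ ?_
  · rw [eval_WVar hw hi, hi']
  · rw [eval_WVar hw hj, hj']
  · rw [eval_WVar hw hl, hl']
  · have := Nat.mul_le_mul_right d ha.le
    omega

theorem eval_slotIdx (hB : WordBounds w n d e M P) {c u : ℕ} (hd : s.word 0 1 = d)
    (hc : c < 12 * n) (hu : u < 2 * d)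
    (h11 : s.word 0 11 = c) (h13 : s.word 0 13 = u) :
    slotIdx.eval w s = c * (2 * d) + u := by
  have h1 := hB.slots
  have h2 := idx_lt hc hu
  have h3 : 2 * d ≤ 12 * n * (2 * d) := Nat.le_mul_of_pos_left _ (by have := hB.n_pos; omega)
  refine WExp.eval_madd_of ?_ (WExp.eval_mul_of (WExp.eval_ofNat hB.hw (by norm_num)) ?_ (by omega))
    ?_ (by omega)
  · rw [eval_WVar hB.hw (by norm_num), h11]
  · rw [eval_WVar hB.hw (by norm_num), hd]
  · rw [eval_WVar hB.hw (by norm_num), h13]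

theorem run_chooseSlot (hB : WordBounds w n d e M P) {Q : ℕ → State → Prop}
    (hE : Env w n d e M P g X D T s) {a k t : ℕ} (ha : a < n) (ht : t < d) (hk : k ≤ M)
    (h6 : s.word 0 6 = k) (h7 : s.word 0 7 = a) (h12 : s.word 0 12 = t)
    (hQ : ∀ τ z f, τ ≤ 80 → SlotChoice (2 ^ (e + 2)) (s.real 3 (a * d + t) / 2 ^ k) z f →
      Q τ (((s.setReal 2 3 (s.real 3 (a * d + t) / 2 ^ k)).setWord 0 14 z).setWord 0 15 f)) :
    Run p w chooseSlot s Q := by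
  have hw := hB.hw
  set y := s.real 3 (a * d + t) / 2 ^ k with hy
  have hres : resIdx.eval w s = a * d + t :=
    eval_idx hw hB.nd ha ht.le (by norm_num) (by norm_num) (by norm_num) h7 hE.d_eq h12
  refine Run.seq (Run.rset (m := 3) (v := y) (WExp.eval_ofNat hw (by norm_num)) ?_ ?_)
  · rw [RExp.eval_div, RExp.eval_cell, hres, RExp.eval_ofWord, eval_powLevel hB hk h6]
    push_cast; rfl
  set s₁ := s.setReal 2 3 y with hs₁
  have hb : (RExp.ofWord biasExp).eval p w s₁ = ((2 ^ (e + 2) : ℕ) : ℝ) := by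
    rw [RExp.eval_ofWord, eval_biasExp hB (by simp [hs₁, hE.e_eq])]
  have hy₁ : (RVar 3).eval p w s₁ = y := by
    rw [eval_RVar hw (by norm_num)]; simp [hs₁]
  have hz : (RExp.ofWord 0).eval p w s₁ = 0 := by
    rw [RExp.eval_ofWord, WExp.eval_ofNat hw (by norm_num)]; simp
  refine Run.ite (fun h => ?_) (fun h => ?_)
  · refine Run.seq (Run.assign hw (by norm_num) (WExp.eval_ofNat hw (by norm_num)) ?_)
    refine Run.assign hw (by norm_num) (WExp.eval_ofNat hw (by norm_num)) ?_
    refine hQ _ _ _ (by decide) (Or.inl ⟨?_, rfl, rfl⟩)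
    simpa only [BExp.Holds, RExp.eval_add, hb, hy₁, hz] using h
  · have h' : 0 ≤ y + ((2 ^ (e + 2) : ℕ) : ℝ) := by
      simpa only [BExp.Holds, RExp.eval_add, hb, hy₁, hz, not_lt] using h
    have h2B : 2 * 2 ^ (e + 2) < 2 ^ w := by
      refine lt_of_le_of_lt ?_ hB.powe
      rw [← pow_succ']; exact Nat.pow_le_pow_right (by norm_num) (by omega)
    refine Run.ite (fun h₁ => ?_) (fun h₁ => ?_)
    · refine Run.seq (Run.assign hw (by norm_num) (WExp.eval_mul_of (WExp.eval_ofNat hw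
        (by norm_num)) (eval_biasExp hB (by simp [hs₁, hE.e_eq])) h2B) ?_)
      refine Run.assign hw (by norm_num) (WExp.eval_ofNat hw (by norm_num)) ?_
      refine hQ _ _ _ (by decide) (Or.inr (Or.inl ⟨?_, rfl, rfl⟩))
      simpa only [BExp.Holds, hb, hy₁] using h₁
    · have h₁' : y ≤ ((2 ^ (e + 2) : ℕ) : ℝ) := by
        simpa only [BExp.Holds, hb, hy₁, not_lt] using h₁
      have hc : SlotChoice (2 ^ (e + 2)) y ⌊y + ((2 ^ (e + 2) : ℕ) : ℝ)⌋₊ 1 :=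
        Or.inr (Or.inr ⟨h', h₁', rfl, rfl⟩)
      refine Run.seq (Run.floor (m := 14) (v := y + ((2 ^ (e + 2) : ℕ) : ℝ))
        (WExp.eval_ofNat hw (by norm_num)) (by rw [RExp.eval_add, hb, hy₁])
        (lt_of_le_of_lt hc.le.1 h2B) ?_)
      refine Run.assign hw (by norm_num) (WExp.eval_ofNat hw (by norm_num)) ?_
      exact hQ _ _ _ (by decide) hc

end

/-- The state of the quantization of `r₀` after `u` slots: `f` are the slots, `r` the residuals and
`c` is the current coordinate. -/
structure QuantInv (d B k : ℕ) (r₀ : ℕ → ℝ) (f : ℕ → ℕ) (r : ℕ → ℝ) (u c : ℕ) : Prop where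
  pos : slotPos f u = c
  le : c ≤ d
  res : ∀ t < d, r t = r₀ t - 2 ^ k * slotSum f B u t
  done : ∀ t < c, 0 ≤ r t ∧ r t < 2 ^ k
  pot : ∑ t ∈ Finset.Ico c d, |r t| + ((d : ℝ) - c) * (B * 2 ^ k) ≤ (2 * d - u) * (B * 2 ^ k)
  small : ∀ v < u, f v ≤ 4 * B + 1

/-! ### The potential argument for the quantization -/

section
variable {d B k u c z e : ℕ} {r₀ r r' : ℕ → ℝ} {f f' : ℕ → ℕ}

/-- The two ways of making progress: a saturated digit shortens the residual by the full B·2^k, and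
a last digit leaves a remainder in [0, 2^k). -/
theorem SlotChoice.residual {x : ℝ} (h : SlotChoice B (x / 2 ^ k) z e) :
    (e = 0 ∧ |x - ((z : ℝ) - B) * 2 ^ k| ≤ |x| - B * 2 ^ k) ∨
      (e = 1 ∧ 0 ≤ x - ((z : ℝ) - B) * 2 ^ k ∧ x - ((z : ℝ) - B) * 2 ^ k < 2 ^ k) := by
  have hp : (0 : ℝ) < 2 ^ k := by positivity
  have hB : (0 : ℝ) ≤ B := Nat.cast_nonneg B
  obtain ⟨y, rfl⟩ : ∃ y, x = y * 2 ^ k := ⟨x / 2 ^ k, by field_simp⟩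
  rw [mul_div_cancel_right₀ _ hp.ne'] at h
  rw [← sub_mul, abs_mul, abs_mul, abs_of_pos hp, ← sub_mul]
  rcases h with ⟨h, rfl, rfl⟩ | ⟨h, rfl, rfl⟩ | ⟨h1, h2, rfl, rfl⟩
  · refine Or.inl ⟨rfl, mul_le_mul_of_nonneg_right ?_ hp.le⟩
    rw [abs_of_neg (by linarith : y < 0)]
    push_cast
    rw [abs_of_neg] <;> linarith
  · refine Or.inl ⟨rfl, mul_le_mul_of_nonneg_right ?_ hp.le⟩
    rw [abs_of_pos (by linarith : 0 < y)]
    push_cast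
    rw [abs_of_pos] <;> linarith
  · refine Or.inr ⟨rfl, ?_, ?_⟩
    · exact mul_nonneg (by linarith [Nat.floor_le h1]) hp.le
    · have : y - ((⌊y + B⌋₊ : ℝ) - B) < 1 := by linarith [Nat.lt_floor_add_one (y + B)]
      calc _ < 1 * (2 : ℝ) ^ k := mul_lt_mul_of_pos_right this hp
        _ = _ := one_mul _

theorem QuantInv.init (hr : ∑ t ∈ Finset.range d, |r₀ t| ≤ d * (B * 2 ^ k)) :
    QuantInv d B k r₀ f r₀ 0 0 where
  pos := by simp [slotPos]
  le := Nat.zero_le _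
  res := by simp [slotSum]
  done := by simp
  pot := by
    rw [← Finset.range_eq_Ico]; push_cast; linarith
  small := by simp

/-- The potential is the ℓ_1 norm of the unfinished coordinates plus B·2^k for each of them. Every
slot lowers it by at least B·2^k, either by shortening a residual or by finishing a coordinate. -/
theorem QuantInv.step (h : QuantInv d B k r₀ f r u c) (hc : c < d)
    (hz : SlotChoice B (r c / 2 ^ k) z e) (hf : ∀ v < u, f' v = f v) (hf' : f' u = 2 * z + e)
    (hr : ∀ t < d, r' t = if t = c then r c - ((z : ℝ) - B) * 2 ^ k else r t) :
    QuantInv d B k r₀ f' r' (u + 1) (c + e) := by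
  have he := hz.le
  have hp : (0 : ℝ) < 2 ^ k := by positivity
  have hB : (0 : ℝ) ≤ B * 2 ^ k := by positivity
  have h1 : f' u % 2 = e := by omega
  have h2 : f' u / 2 = z := by omega
  have hpos : slotPos f' u = c := by rw [slotPos_congr hf, h.pos]
  have hsum : ∑ t ∈ Finset.Ico (c + 1) d, |r' t| = ∑ t ∈ Finset.Ico (c + 1) d, |r t| := by
    refine Finset.sum_congr rfl fun t ht => ?_
    rw [Finset.mem_Ico] at ht
    rw [hr t ht.2, if_neg (by omega)]
  have hpot := h.pot
  rw [Finset.sum_eq_sum_Ico_succ_bot hc] at hpot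
  have hrc := hr c hc
  rw [if_pos rfl] at hrc
  have hres := hz.residual
  rw [← hrc] at hres
  refine ⟨?_, by omega, fun t ht => ?_, fun t ht => ?_, ?_, fun v hv => ?_⟩
  · rw [slotPos_succ, hpos, h1]
  · rw [slotSum_succ, slotSum_congr _ _ hf, hpos, h2, hr t ht]
    rcases eq_or_ne t c with rfl | htc
    · rw [if_pos rfl, if_pos rfl, h.res t ht]; ring
    · rw [if_neg htc, if_neg htc.symm, h.res t ht]; ring
  · rcases lt_or_ge t c with htc | htc
    · rw [hr t (by omega), if_neg htc.ne]; exact h.done t htc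
    · rcases hres with ⟨h3, -⟩ | ⟨-, h4⟩
      · omega
      · obtain rfl : t = c := by omega
        exact h4
  · push_cast
    rcases hres with ⟨rfl, h3⟩ | ⟨rfl, -⟩
    · rw [add_zero, Finset.sum_eq_sum_Ico_succ_bot hc, hsum]
      push_cast
      linarith
    · rw [hsum]
      push_cast
      linarith [abs_nonneg (r c)]
  · rcases Nat.lt_succ_iff_lt_or_eq.1 hv with hv | rfl
    · rw [hf v hv]; exact h.small v hv
    · omega

/-- Once all coordinates are finished, the content 0 decodes to the digit -B at the position `d`.
This lies beyond the coordinates that count, and the missing end mark keeps the position there. -/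
theorem QuantInv.idle (h : QuantInv d B k r₀ f r u c) (hc : c = d) (hu : u < 2 * d)
    (hf : ∀ v < u, f' v = f v) (hf' : f' u = 0) : QuantInv d B k r₀ f' r (u + 1) c := by
  have hpos : slotPos f' u = c := by rw [slotPos_congr hf, h.pos]
  refine ⟨?_, h.le, fun t ht => ?_, h.done, ?_, fun v hv => ?_⟩
  · rw [slotPos_succ, hpos, hf', Nat.zero_mod, add_zero]
  · rw [slotSum_succ, slotSum_congr _ _ hf, hpos, if_neg (by omega), add_zero]
    exact h.res t ht
  · subst hc
    have : (u : ℝ) + 1 ≤ 2 * c := by exact_mod_cast hu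
    simp only [Finset.Ico_self, Finset.sum_empty, sub_self, zero_mul, add_zero]
    push_cast
    exact mul_nonneg (by linarith) (by positivity)
  · rcases Nat.lt_succ_iff_lt_or_eq.1 hv with hv | rfl
    · rw [hf v hv]; exact h.small v hv
    · omega

/-- After 2d slots the bound on the potential is 0, whereas an unfinished coordinate would
contribute B·2^k > 0. -/
theorem QuantInv.final (h : QuantInv d B k r₀ f r (2 * d) c) (hB : 0 < B) : c = d := by
  have hpot := h.pot
  have h0 : (0 : ℝ) ≤ ∑ t ∈ Finset.Ico c d, |r t| := Finset.sum_nonneg fun _ _ => abs_nonneg _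
  have hB' : (0 : ℝ) < B * 2 ^ k := by positivity
  push_cast at hpot
  rw [sub_self, zero_mul] at hpot
  have h1 : ((d : ℝ) - c) * (B * 2 ^ k) ≤ 0 := by linarith
  have h2 : (d : ℝ) ≤ c := by
    by_contra h2
    have : (0 : ℝ) < ((d : ℝ) - c) * (B * 2 ^ k) := mul_pos (by linarith [not_le.1 h2]) hB'
    linarith
  exact le_antisymm h.le (by exact_mod_cast h2)

end

/-! ### Correctness of the quantization program -/

section
variable {p : ℝ≥0∞} {w n d e M P : ℕ} {g : ℝ} {X D : ℕ → ℕ → ℝ} {T : ℕ → ℕ} {s s' : State}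
  {a k c : ℕ}

/-- The frame of the computation of the record `c` for the point `a`. -/
abbrev RecFrame (d a c : ℕ) : State → State → Prop :=
  Frame (c * (2 * d)) (c * (2 * d) + 2 * d) (a * d) (a * d + d)

theorem run_quantStep (hB : WordBounds w n d e M P) {Q : ℕ → State → Prop} {r₀ : ℕ → ℝ}
    (hE : Env w n d e M P g X D T s) (ha : a < n) (hk : k ≤ M) (hc : c < 12 * n) {u t : ℕ}
    (hu : u < 2 * d)
    (h6 : s.word 0 6 = k) (h7 : s.word 0 7 = a) (h11 : s.word 0 11 = c) (h12 : s.word 0 12 = t)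
    (h13 : s.word 0 13 = u)
    (hq : QuantInv d (2 ^ (e + 2)) k r₀ (fun v => s.word 5 (c * (2 * d) + v))
      (fun i => s.real 3 (a * d + i)) u t)
    (hQ : ∀ τ s', τ ≤ 170 → RecFrame d a c s s' → s'.word 0 13 = u →
      QuantInv d (2 ^ (e + 2)) k r₀ (fun v => s'.word 5 (c * (2 * d) + v))
        (fun i => s'.real 3 (a * d + i)) (u + 1) (s'.word 0 12) → Q τ s') :
    Run p w quantStep s Q := by
  have hw := hB.hw
  have hslot : ∀ {s' : State}, RecFrame d a c s s' → s'.word 0 13 = u →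
      slotIdx.eval w s' = c * (2 * d) + u := fun hf h =>
    eval_slotIdx hB (hE.frame hf).d_eq hc hu (by rw [hf.word0 _ (by omega), h11]) h
  have hdw : 2 * d < 2 ^ w := by
    have := hB.slots
    omega
  refine Run.ite (fun h => ?_) (fun h => ?_)
  · have ht : t < d := by
      simpa only [BExp.Holds, eval_WVar hw (show 12 < 64 by norm_num),
        eval_WVar hw (show 1 < 64 by norm_num), h12, hE.d_eq] using h
    refine Run.seq (run_chooseSlot hB hE ha ht hk h6 h7 h12 fun τ z f hτ hz => ?_)
    have hzf := hz.le
    set y := s.real 3 (a * d + t) / 2 ^ k with hy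
    set s₁ := ((s.setReal 2 3 y).setWord 0 14 z).setWord 0 15 f with hs₁
    have hf₁ : RecFrame d a c s s₁ :=
      (((Frame.refl _ _ _ _ s).setReal2).setWord (by omega)).setWord (by omega)
    have hres : resIdx.eval w s₁ = a * d + t :=
      eval_idx hw hB.nd ha ht.le (by norm_num) (by norm_num) (by norm_num)
        (by rw [hf₁.word0 _ (by omega), h7]) (hE.frame hf₁).d_eq (by simp [hs₁, h12])
    refine Run.seq (Run.rset hres (v := s.real 3 (a * d + t) -
      ((z : ℝ) - (2 ^ (e + 2) : ℕ)) * 2 ^ k) ?_ ?_)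
    · simp only [RExp.eval_sub, RExp.eval_mul, RExp.eval_cell, RExp.eval_ofWord, hres,
        eval_WVar hw (show 14 < 64 by norm_num), eval_biasExp hB (hE.frame hf₁).e_eq,
        eval_powLevel hB hk (show s₁.word 0 6 = k by rw [hf₁.word0 _ (by omega), h6])]
      simp [hs₁]
    set x := s.real 3 (a * d + t) - ((z : ℝ) - (2 ^ (e + 2) : ℕ)) * 2 ^ k with hx
    set s₂ := s₁.setReal 3 (a * d + t) x with hs₂
    have hf₂ : RecFrame d a c s s₂ := hf₁.setRes (by omega)
    have hpe : 2 ^ (e + 5) = 8 * 2 ^ (e + 2) := by rw [pow_succ, pow_succ, pow_succ]; omega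
    have hpow := hB.powe
    refine Run.seq (Run.wset (hslot hf₂ (by simp [hs₂, hs₁, h13])) (v := 2 * z + f)
      (WExp.eval_madd_of (WExp.eval_ofNat hw (by norm_num)) ?_ ?_ ?_) ?_)
    · rw [eval_WVar hw (by norm_num)]; simp [hs₂, hs₁]
    · rw [eval_WVar hw (by norm_num)]; simp [hs₂, hs₁]
    · omega
    set s₃ := s₂.setWord 5 (c * (2 * d) + u) (2 * z + f) with hs₃
    have hf₃ : RecFrame d a c s s₃ := hf₂.setSlot (by omega)
    refine Run.assign hw (by norm_num) (v := t + f) (WExp.eval_add_of ?_ ?_ (by omega)) ?_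
    · rw [eval_WVar hw (by norm_num)]; simp [hs₃, hs₂, hs₁, h12]
    · rw [eval_WVar hw (by norm_num)]; simp [hs₃, hs₂, hs₁]
    refine hQ _ _ ?_ (hf₃.setWord (by omega)) (by simp [hs₃, hs₂, hs₁, h13]) ?_
    · have : (BExp.wlt (WVar 12) (WVar 1)).size = 5 := rfl
      have : resIdx.size + (RExp.cell 3 resIdx -
        (.ofWord (WVar 14) - .ofWord biasExp) * .ofWord (twoPow (WVar 6)) : RExp).size ≤ 40 := by
        decide
      have : slotIdx.size + (2 * WVar 14 + WVar 15 : WExp).size + (WVar 12 + WVar 15).size ≤ 25 := by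
        decide
      omega
    · have := hq.step ht hz (f' := fun v =>
        (s₃.setWord 0 12 (t + f)).word 5 (c * (2 * d) + v))
        (r' := fun i => (s₃.setWord 0 12 (t + f)).real 3 (a * d + i)) ?_ ?_ ?_
      · simpa using this
      · intro v hv
        simp [hs₃, hs₂, hs₁]; omega
      · simp [hs₃]
      · intro i hi
        simp [hs₃, hs₂, hs₁, hx]
  · have ht : t = d := by
      have h' := hq.le
      have : ¬ t < d := by
        simpa only [BExp.Holds, eval_WVar hw (show 12 < 64 by norm_num),
          eval_WVar hw (show 1 < 64 by norm_num), h12, hE.d_eq] using h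
      omega
    have hf : RecFrame d a c s s := Frame.refl _ _ _ _ s
    refine Run.wset (hslot hf h13) (WExp.eval_ofNat hw (by norm_num)) ?_
    refine hQ _ _ (by decide) (hf.setSlot (by omega)) (by simp [h13]) ?_
    have := hq.idle ht hu (f' := fun v =>
        (s.setWord 5 (c * (2 * d) + u) 0).word 5 (c * (2 * d) + v)) ?_ ?_
    · simpa [h12] using this
    · intro v hv
      simp; omega
    · simp

/-- A slot holds at most 4B + 1 < 8B = 2^(e+5) for B = 2^(e+2); this is the reason for the slot
width e+5. -/
theorem run_quantize (hB : WordBounds w n d e M P) {Q : ℕ → State → Prop}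
    (hE : Env w n d e M P g X D T s) (ha : a < n) (hk : k ≤ M) (hc : c < 12 * n)
    (h6 : s.word 0 6 = k) (h7 : s.word 0 7 = a) (h11 : s.word 0 11 = c)
    (hr : ∑ t ∈ Finset.range d, |s.real 3 (a * d + t)| ≤ d * ((2 ^ (e + 2) : ℕ) * 2 ^ k))
    (hQ : ∀ τ s', τ ≤ 400 * d → RecFrame d a c s s' →
      (∀ u < 2 * d, s'.word 5 (c * (2 * d) + u) < 2 ^ (e + 5)) →
      (∀ t < d, s'.real 3 (a * d + t) = s.real 3 (a * d + t) -
        2 ^ k * slotSum (fun v => s'.word 5 (c * (2 * d) + v)) (2 ^ (e + 2)) (2 * d) t) →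
      (∀ t < d, |s'.real 3 (a * d + t)| ≤ 2 ^ k) → Q τ s') :
    Run p w quantize s Q := by
  have hw := hB.hw
  have hd := hB.d_pos
  have hdw : 2 * d < 2 ^ w := by
    have := hB.slots
    omega
  refine Run.seq (Run.assign hw (by norm_num) (WExp.eval_ofNat hw (by norm_num)) ?_)
  refine Run.forTo (N := 2 * d) (fun u τ s' => τ ≤ 190 * u + 3 ∧ RecFrame d a c s s' ∧
      s'.word 0 13 = u ∧ QuantInv d (2 ^ (e + 2)) k (fun i => s.real 3 (a * d + i))
        (fun v => s'.word 5 (c * (2 * d) + v)) (fun i => s'.real 3 (a * d + i)) u (s'.word 0 12))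
      hw (by norm_num) hdw ?_ ?_ ?_ ?_
  · rintro u τ s' - ⟨-, hf, h13, -⟩
    refine ⟨h13, WExp.eval_mul_of (WExp.eval_ofNat hw (by norm_num)) ?_ hdw⟩
    rw [eval_WVar hw (by norm_num), (hE.frame hf).d_eq]
  · refine ⟨by omega, ?_, by simp, ?_⟩
    · exact ((Frame.refl _ _ _ _ s).setWord (by omega)).setWord (by omega)
    · simpa using QuantInv.init (f := fun v => s.word 5 (c * (2 * d) + v)) hr
  · rintro u τ s' hu ⟨hτ, hf, h13, hq⟩
    refine run_quantStep hB (hE.frame hf) ha hk hc hu (by rw [hf.word0 _ (by omega), h6])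
      (by rw [hf.word0 _ (by omega), h7]) (by rw [hf.word0 _ (by omega), h11]) rfl h13 hq ?_
    intro τ' s'' hτ' hf' h13' hq'
    refine ⟨h13', ?_, (hf.trans hf').setWord (by omega), by simp, ?_⟩
    · have : (2 * WVar 1 : WExp).size = 4 := rfl
      omega
    · simpa using hq'
  · rintro τ s' ⟨hτ, hf, h13, hq⟩
    have hfin := hq.final (by positivity)
    refine hQ _ _ ?_ hf ?_ hq.res ?_
    · have : (2 * WVar 1 : WExp).size = 4 := rfl
      have : (0 : WExp).size = 1 := rfl
      omega
    · intro u hu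
      have := hq.small u hu
      have hpe : 2 ^ (e + 5) = 8 * 2 ^ (e + 2) := by rw [pow_succ, pow_succ, pow_succ]; omega
      have : 0 < 2 ^ (e + 2) := by positivity
      omega
    · intro t ht
      have := hq.done t (by omega)
      rw [abs_of_nonneg this.1]
      exact this.2.le

end

/-- The distance of the points `7` and `8`. -/
def distExp : RExp := .cell 1 (WVar 7 * WVar 0 + WVar 8)

/-- The net point `8` of level `l` is close to the point `7`. -/
def nearCond (l : WExp) : BExp :=
  .and (.not (.weq (WVar 8) (WVar 7))) (.and (.not (.wlt (.cell 1 (WVar 8)) l))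
    (.not (.rlt (.ofWord (twoPow l)) (.ofWord 2 * distExp))))

/-- The point `8` may be the parent of the point `7`, whose level is `6`. -/
def parentCond : BExp :=
  .and (.wlt (WVar 6) (.cell 1 (WVar 8)))
    (.not (.rlt (.ofWord (twoPow (WVar 6 + 1))) (.ofWord 16 * distExp)))

def coordIdx : WExp := WVar 10 * WVar 1 + WVar 12

def initRes : Prog :=
  forTo 12 (WVar 1) (.rset 3 resIdx
    (RVar 2 * (.cell 0 resIdx - .cell 0 coordIdx) + .cell 3 coordIdx))

/-- Cell 9 is the outcome of the preceding scan for neighbours: 1 keeps the residual and 0 drops it.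
-/
def clearRes : Prog := forTo 12 (WVar 1) (.rset 3 resIdx (.ofWord (WVar 9) * .cell 3 resIdx))

/-- Stores a new record for the point `7` at level `6`, relative to the point `10`. -/
def storeRecord : Prog :=
  initRes ⨾ quantize ⨾ .wset 3 (WVar 11) (.cell 2 (WVar 10)) ⨾ .wset 4 (WVar 11) (WVar 6) ⨾
  .wset 2 (WVar 7) (WVar 11) ⨾ assign 11 (WVar 11 + 1) ⨾ scan (nearCond (WVar 6)) 1 ⨾ clearRes

/-! ### Storing one record -/

section
variable {p : ℝ≥0∞} {w n d e M P : ℕ} {g : ℝ} {X D : ℕ → ℕ → ℝ} {T : ℕ → ℕ} {s s' : State}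
  {a b k c q : ℕ}

theorem eval_distExp (hB : WordBounds w n d e M P) (hE : Env w n d e M P g X D T s) (ha : a < n)
    (hb : b < n) (h7 : s.word 0 7 = a) (h8 : s.word 0 8 = b) : distExp.eval p w s = D a b := by
  rw [distExp, RExp.eval_cell, eval_idx hB.hw hB.nn ha hb.le (by norm_num) (by norm_num)
    (by norm_num) h7 hE.n_eq h8, hE.dist_eq a ha b hb]

theorem holds_nearCond (hB : WordBounds w n d e M P) (hE : Env w n d e M P g X D T s) (ha : a < n)
    (hb : b < n) (h7 : s.word 0 7 = a) (h8 : s.word 0 8 = b) {l : WExp} (hl : l.eval w s = k)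
    (hk : k ≤ M) : (nearCond l).Holds p w s ↔ b ≠ a ∧ k ≤ T b ∧ 2 * D a b ≤ 2 ^ k := by
  have hp : 2 ^ k < 2 ^ w :=
    lt_of_le_of_lt (Nat.pow_le_pow_right (by norm_num) (by omega)) hB.powM
  simp only [nearCond, BExp.Holds, RExp.eval_mul, RExp.eval_ofWord, WExp.eval_cell,
    eval_distExp hB hE ha hb h7 h8, eval_WVar hB.hw (show 8 < 64 by norm_num),
    eval_WVar hB.hw (show 7 < 64 by norm_num), h7, h8, hl, eval_twoPow_of hB.hw hl hp,
    WExp.eval_ofNat hB.hw (show 2 < 64 by norm_num), hE.T_eq b hb, not_lt]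
  push_cast
  rfl

theorem holds_parentCond (hB : WordBounds w n d e M P) (hE : Env w n d e M P g X D T s)
    (ha : a < n) (hb : b < n) (h6 : s.word 0 6 = k) (h7 : s.word 0 7 = a) (h8 : s.word 0 8 = b)
    (hk : k < M) : parentCond.Holds p w s ↔ k + 1 ≤ T b ∧ 16 * D a b ≤ 2 ^ (k + 1) := by
  have hp : 2 ^ (k + 1) < 2 ^ w :=
    lt_of_le_of_lt (Nat.pow_le_pow_right (by norm_num) (by omega)) hB.powM
  have hl : (WVar 6 + 1 : WExp).eval w s = k + 1 :=
    WExp.eval_add_of (by rw [eval_WVar hB.hw (by norm_num), h6])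
      (WExp.eval_ofNat hB.hw (by norm_num)) (Nat.lt_two_pow_self.trans hp)
  simp only [parentCond, BExp.Holds, RExp.eval_mul, RExp.eval_ofWord, WExp.eval_cell,
    eval_distExp hB hE ha hb h7 h8, eval_WVar hB.hw (show 8 < 64 by norm_num),
    eval_WVar hB.hw (show 6 < 64 by norm_num), h6, h8, eval_twoPow_of hB.hw hl hp,
    WExp.eval_ofNat hB.hw (show 16 < 64 by norm_num), hE.T_eq b hb, not_lt]
  push_cast
  rfl

theorem row_disjoint {t : ℕ} (hab : b ≠ a) (ht : t < d) :
    b * d + t < a * d ∨ a * d + d ≤ b * d + t := by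
  rcases lt_or_gt_of_ne hab with h | h
  · left; exact idx_lt h ht
  · right
    have := Nat.mul_le_mul_right d (Nat.succ_le_of_lt h)
    rw [Nat.succ_mul] at this
    omega

theorem run_initRes (hB : WordBounds w n d e M P) {Q : ℕ → State → Prop}
    (hE : Env w n d e M P g X D T s) (ha : a < n) (hq : q < n)
    (h7 : s.word 0 7 = a) (h10 : s.word 0 10 = q)
    (hQ : ∀ τ s', τ ≤ 80 * d → RecFrame d a c s s' →
      (∀ t < d, s'.real 3 (a * d + t) = g * (X a t - X q t) + s.real 3 (q * d + t)) → Q τ s') :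
    Run p w initRes s Q := by
  have hw := hB.hw
  have hd := hB.d_pos
  have hdw : d < 2 ^ w := by have := hB.nd; omega
  -- The predecessor `q` may be `a` itself, so the row that is read may be the row that is
  -- overwritten. The last clause records that its entries from `t` on are still the old ones.
  refine Run.forTo (N := d) (fun t τ s' => τ ≤ 60 * t + 3 ∧ RecFrame d a c s s' ∧
      s'.word 0 12 = t ∧
      (∀ i < t, s'.real 3 (a * d + i) = g * (X a i - X q i) + s.real 3 (q * d + i)) ∧
      (∀ i < d, t ≤ i → s'.real 3 (q * d + i) = s.real 3 (q * d + i)))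
      hw (by norm_num) hdw ?_ ?_ ?_ ?_
  · rintro t τ s' - ⟨-, hf, h12, -⟩
    exact ⟨h12, by rw [eval_WVar hw (by norm_num), (hE.frame hf).d_eq]⟩
  · exact ⟨by omega, (Frame.refl _ _ _ _ s).setWord (by omega), by simp, by simp, by simp⟩
  · rintro t τ s' ht ⟨hτ, hf, h12, hr, hr'⟩
    have hE' := hE.frame hf
    have hres : resIdx.eval w s' = a * d + t :=
      eval_idx hw hB.nd ha ht.le (by norm_num) (by norm_num) (by norm_num)
        (by rw [hf.word0 _ (by omega), h7]) hE'.d_eq h12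
    have hco : coordIdx.eval w s' = q * d + t :=
      eval_idx hw hB.nd hq ht.le (by norm_num) (by norm_num) (by norm_num)
        (by rw [hf.word0 _ (by omega), h10]) hE'.d_eq h12
    refine Run.rset hres (v := g * (X a t - X q t) + s.real 3 (q * d + t)) ?_ ?_
    · simp only [RExp.eval_add, RExp.eval_sub, RExp.eval_mul, RExp.eval_cell, hres, hco,
        eval_RVar hw (show 2 < 64 by norm_num), hE'.g_eq, hE'.x_eq a ha t ht, hE'.x_eq q hq t ht,
        hr' t ht le_rfl]
    · refine ⟨by simp [h12], ?_, (hf.setRes (by omega)).setWord (by omega), by simp, ?_, ?_⟩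
      · have : resIdx.size + (RVar 2 * (.cell 0 resIdx - .cell 0 coordIdx) + .cell 3 coordIdx :
          RExp).size + 1 + ((WVar 1).size + 10) ≤ 60 := by decide
        omega
      · intro i hi
        rcases Nat.lt_succ_iff_lt_or_eq.1 hi with hi | rfl
        · simp [hi.ne, hr i hi]
        · simp
      · intro i hi hti
        have : q * d + i ≠ a * d + t := by
          rcases eq_or_ne q a with rfl | hqa
          · omega
          · have := row_disjoint hqa hi
            omega
        simp [this, hr' i hi (by omega)]
  · rintro τ s' ⟨hτ, hf, -, hr, -⟩
    refine hQ _ _ ?_ hf hr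
    have : (WVar 1).size = 2 := rfl
    omega

theorem run_clearRes (hB : WordBounds w n d e M P) {Q : ℕ → State → Prop}
    (hE : Env w n d e M P g X D T s) (ha : a < n) {v : ℕ}
    (h7 : s.word 0 7 = a) (h9 : s.word 0 9 = v)
    (hQ : ∀ τ s', τ ≤ 80 * d → RecFrame d a c s s' →
      (∀ t < d, s'.real 3 (a * d + t) = v * s.real 3 (a * d + t)) →
      (∀ i, s'.word 5 i = s.word 5 i) → Q τ s') :
    Run p w clearRes s Q := by
  have hw := hB.hw
  have hd := hB.d_pos
  have hdw : d < 2 ^ w := by have := hB.nd; omega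
  refine Run.forTo (N := d) (fun t τ s' => τ ≤ 60 * t + 3 ∧ RecFrame d a c s s' ∧
      s'.word 0 12 = t ∧ s'.word 0 9 = v ∧
      (∀ i < t, s'.real 3 (a * d + i) = v * s.real 3 (a * d + i)) ∧
      (∀ i < d, t ≤ i → s'.real 3 (a * d + i) = s.real 3 (a * d + i)) ∧
      (∀ i, s'.word 5 i = s.word 5 i))
      hw (by norm_num) hdw ?_ ?_ ?_ ?_
  · rintro t τ s' - ⟨-, hf, h12, -⟩
    exact ⟨h12, by rw [eval_WVar hw (by norm_num), (hE.frame hf).d_eq]⟩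
  · exact ⟨by omega, (Frame.refl _ _ _ _ s).setWord (by omega), by simp, by simp [h9], by simp,
      by simp, by simp⟩
  · rintro t τ s' ht ⟨hτ, hf, h12, h9', hr, hr', hs⟩
    have hE' := hE.frame hf
    have hres : resIdx.eval w s' = a * d + t :=
      eval_idx hw hB.nd ha ht.le (by norm_num) (by norm_num) (by norm_num)
        (by rw [hf.word0 _ (by omega), h7]) hE'.d_eq h12
    refine Run.rset hres (v := v * s.real 3 (a * d + t)) ?_ ?_
    · simp only [RExp.eval_mul, RExp.eval_cell, hres, RExp.eval_ofWord,
        eval_WVar hw (show 9 < 64 by norm_num), h9', hr' t ht le_rfl]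
    · refine ⟨by simp [h12], ?_, (hf.setRes (by omega)).setWord (by omega), by simp, by simp [h9'],
        ?_, ?_, ?_⟩
      · have : resIdx.size + (.ofWord (WVar 9) * .cell 3 resIdx : RExp).size + 1 +
          ((WVar 1).size + 10) ≤ 60 := by decide
        omega
      · intro i hi
        rcases Nat.lt_succ_iff_lt_or_eq.1 hi with hi | rfl
        · simp [hi.ne, hr i hi]
        · simp
      · intro i hi hti
        have : i ≠ t := by omega
        simp [this, hr' i hi (by omega)]
      · intro i; simp [hs]
  · rintro τ s' ⟨hτ, hf, -, -, hr, -, hs⟩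
    refine hQ _ _ ?_ hf hr hs
    have : (WVar 1).size = 2 := rfl
    omega

/-- Effect on the memory of storing the record `c` for the point `a`. -/
structure RecStep (d a c : ℕ) (s s' : State) : Prop where
  word0 : ∀ j, j < 8 ∨ j = 10 → j ≠ 11 → s'.word 0 j = s.word 0 j
  cnt : s'.word 0 11 = c + 1
  top : s'.word 1 = s.word 1
  recOf : ∀ i, s'.word 2 i = if i = a then c else s.word 2 i
  parent : ∀ r < c, s'.word 3 r = s.word 3 r
  level : ∀ r < c, s'.word 4 r = s.word 4 r
  slot : ∀ i, i < c * (2 * d) → s'.word 5 i = s.word 5 i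
  real2 : ∀ j, j ≠ 3 → s'.real 2 j = s.real 2 j
  real : ∀ a, a ≠ 2 → a ≠ 3 → s'.real a = s.real a
  res : ∀ b t, b ≠ a → t < d → s'.real 3 (b * d + t) = s.real 3 (b * d + t)
  output : s'.output = s.output

/-- `Reach` for the records in the memory. -/
abbrev MReach (d e : ℕ) (s : State) : ℕ → ℕ → (ℕ → ℝ) → Prop :=
  Reach (s.word 3) (s.word 4) (fun r u => s.word 5 (r * (2 * d) + u)) d (2 ^ (e + 2))

theorem RecStep.reach (h : RecStep d a c s s') {m r : ℕ} {v : ℕ → ℝ} (hr : r < c)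
    (hR : MReach d e s m r v) : MReach d e s' m r v :=
  hR.congr fun r' hr' => ⟨h.parent _ (by omega), h.level _ (by omega), fun u hu =>
    h.slot _ (idx_lt (by omega) hu)⟩

theorem Env.recStep (hE : Env w n d e M P g X D T s) (hf : RecStep d a c s s') :
    Env w n d e M P g X D T s' where
  n_eq := (hf.word0 _ (by omega) (by omega)).trans hE.n_eq
  d_eq := (hf.word0 _ (by omega) (by omega)).trans hE.d_eq
  w_eq := (hf.word0 _ (by omega) (by omega)).trans hE.w_eq
  e_eq := (hf.word0 _ (by omega) (by omega)).trans hE.e_eq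
  M_eq := (hf.word0 _ (by omega) (by omega)).trans hE.M_eq
  P_eq := (hf.word0 _ (by omega) (by omega)).trans hE.P_eq
  g_eq := (hf.real2 _ (by omega)).trans hE.g_eq
  x_eq a ha t ht := by rw [hf.real _ (by omega) (by omega)]; exact hE.x_eq a ha t ht
  dist_eq a ha t ht := by rw [hf.real _ (by omega) (by omega)]; exact hE.dist_eq a ha t ht
  T_eq a ha := by rw [hf.top]; exact hE.T_eq a ha

/-- Here `v` is the sketched position of `q` and `v'` that of `a`. The quantity in the last
conditions is the scaled displacement plus the residual of `q`, minus the stored part v' - v; it is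
the new residual if `a` has a neighbour, and is dropped otherwise. -/
theorem run_storeRecord (hB : WordBounds w n d e M P) {Q : ℕ → State → Prop}
    (hE : Env w n d e M P g X D T s) (ha : a < n) (hq : q < n) (hk : k ≤ M) (hc : c < 12 * n)
    (h6 : s.word 0 6 = k) (h7 : s.word 0 7 = a) (h10 : s.word 0 10 = q) (h11 : s.word 0 11 = c)
    (hr : ∑ t ∈ Finset.range d, |g * (X a t - X q t) + s.real 3 (q * d + t)| ≤
      d * ((2 ^ (e + 2) : ℕ) * 2 ^ k))
    {m : ℕ} {v : ℕ → ℝ} (hR : MReach d e s m (s.word 2 q) v) (hlt : s.word 2 q < c)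
    (hQ : ∀ τ s' v', τ ≤ 100 * n + 700 * d → RecStep d a c s s' →
      MReach d e s' (m + 1) c v' →
      s'.word 3 c < c → s'.word 4 c = k →
      (∀ u < 2 * d, s'.word 5 (c * (2 * d) + u) < 2 ^ (e + 5)) →
      (∀ t < d, |g * (X a t - X q t) + s.real 3 (q * d + t) - (v' t - v t)| ≤ 2 ^ k) →
      (Near n D T k a → ∀ t < d, s'.real 3 (a * d + t) =
        g * (X a t - X q t) + s.real 3 (q * d + t) - (v' t - v t)) →
      (¬ Near n D T k a → ∀ t < d, s'.real 3 (a * d + t) = 0) → Q τ s') :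
    Run p w storeRecord s Q := by
  have hw := hB.hw
  have hn := hB.n_pos
  have hd := hB.d_pos
  have h12n : 12 * n < 2 ^ w := by
    have := hB.slots
    have : 12 * n ≤ 12 * n * (2 * d) := Nat.le_mul_of_pos_right _ (by omega)
    omega
  refine Run.seq (run_initRes (c := c) hB hE ha hq h7 h10 fun τ₁ s₁ hτ₁ hf₁ hr₁ => ?_)
  refine Run.seq (run_quantize hB (hE.frame hf₁) ha hk hc (by rw [hf₁.word0 _ (by omega), h6])
    (by rw [hf₁.word0 _ (by omega), h7]) (by rw [hf₁.word0 _ (by omega), h11]) ?_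
    fun τ₂ s₂ hτ₂ hf₂ hs₂ hr₂ hb₂ => ?_)
  · refine le_trans (le_of_eq (Finset.sum_congr rfl fun t ht => ?_)) hr
    rw [hr₁ t (Finset.mem_range.1 ht)]
  have hf₁₂ := hf₁.trans hf₂
  have hV : ∀ {j : ℕ} {s : State}, j < 64 → (WVar j).eval w s = s.word 0 j := fun hj =>
    eval_WVar hw hj
  refine Run.seq (Run.wset (m := c) (v := s.word 2 q) ?_ ?_ ?_)
  · rw [hV (by norm_num), hf₁₂.word0 _ (by omega), h11]
  · rw [WExp.eval_cell, hV (by norm_num), hf₁₂.word0 _ (by omega), h10,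
      hf₁₂.word _ (by omega) (by omega)]
  refine Run.seq (Run.wset (m := c) (v := k) ?_ ?_ ?_)
  · rw [hV (by norm_num)]; simp [hf₁₂.word0, h11]
  · rw [hV (by norm_num)]; simp [hf₁₂.word0, h6]
  refine Run.seq (Run.wset (m := a) (v := c) ?_ ?_ ?_)
  · rw [hV (by norm_num)]; simp [hf₁₂.word0, h7]
  · rw [hV (by norm_num)]; simp [hf₁₂.word0, h11]
  refine Run.seq (Run.assign hw (by norm_num) (v := c + 1) (WExp.eval_add_of (m := c) ?_
    (WExp.eval_ofNat hw (by norm_num)) (by omega)) ?_)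
  · rw [hV (by norm_num)]; simp [hf₁₂.word0, h11]
  set s₃ := ((((s₂.setWord 3 c (s.word 2 q)).setWord 4 c k).setWord 2 a c).setWord 0 11 (c + 1))
    with hs₃
  have hE₃ : Env w n d e M P g X D T s₃ := by
    refine (((Env.setWord (hE.frame hf₁₂) ?_).setWord ?_).setWord ?_).setWord ?_ <;> omega
  have hE₃' : ∀ b v, Env w n d e M P g X D T ((s₃.setWord 0 9 v).setWord 0 8 b) := fun b v =>
    (hE₃.setWord (by omega)).setWord (by omega)
  have h6₃ : s₃.word 0 6 = k := by simp [hs₃, hf₁₂.word0, h6]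
  have h7₃ : s₃.word 0 7 = a := by simp [hs₃, hf₁₂.word0, h7]
  refine Run.seq (Run.scan (fun b => b ≠ a ∧ k ≤ T b ∧ 2 * D a b ≤ 2 ^ k) (fun _ => 1) hw
    hE₃.n_eq (by omega) ?_ ?_ fun τ₄ z hτ₄ hz => ?_)
  · intro b hb v
    refine holds_nearCond hB (hE₃' b v) ha hb (by simp [h7₃]) (by simp) ?_ hk
    rw [hV (by norm_num)]; simp [h6₃]
  · intro b hb v
    exact WExp.eval_ofNat hw (by norm_num)
  set s₄ := (s₃.setWord 0 9 z).setWord 0 8 n with hs₄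
  refine run_clearRes (c := c) (v := z) hB (hE₃' n z) ha (by simp [hs₄, h7₃]) (by simp [hs₄])
    fun τ₅ s₅ hτ₅ hf₅ hr₅ hs₅ => ?_
  have h34 : s₅.word 3 = s₄.word 3 ∧ s₅.word 4 = s₄.word 4 :=
    ⟨hf₅.word _ (by omega) (by omega), hf₅.word _ (by omega) (by omega)⟩
  have hslots : ∀ i, s₅.word 5 i = s₂.word 5 i := fun i => by rw [hs₅ i]; simp [hs₄, hs₃]
  have hstep : RecStep d a c s s₅ := by
    constructor
    · intro j hj hj'
      rw [hf₅.word0 j (by omega)]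
      have h8 : j ≠ 8 := by omega
      have h9 : j ≠ 9 := by omega
      simp [hs₄, hs₃, h8, h9, hj']
      exact hf₁₂.word0 j (by omega)
    · rw [hf₅.word0 _ (by omega)]; simp [hs₄, hs₃]
    · rw [hf₅.word _ (by omega) (by omega)]; simp [hs₄, hs₃]
      exact hf₁₂.word _ (by omega) (by omega)
    · intro i
      rw [hf₅.word _ (by omega) (by omega)]; simp [hs₄, hs₃]
      rw [hf₁₂.word _ (by omega) (by omega)]
    · intro r hr
      rw [hf₅.word _ (by omega) (by omega)]; simp [hs₄, hs₃, hr.ne]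
      rw [hf₁₂.word _ (by omega) (by omega)]
    · intro r hr
      rw [hf₅.word _ (by omega) (by omega)]; simp [hs₄, hs₃, hr.ne]
      rw [hf₁₂.word _ (by omega) (by omega)]
    · intro i hi
      rw [hslots, hf₁₂.slot _ (Or.inl hi)]
    · intro j hj
      rw [hf₅.real2 _ hj]; simp [hs₄, hs₃]
      exact hf₁₂.real2 _ hj
    · intro b hb hb'
      rw [hf₅.real _ hb hb']; simp [hs₄, hs₃]
      exact hf₁₂.real _ hb hb'
    · intro b t hb ht
      have := row_disjoint hb ht
      rw [hf₅.res _ this]; simp [hs₄, hs₃]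
      exact hf₁₂.res _ this
    · rw [hf₅.output]; simp [hs₄, hs₃]
      exact hf₁₂.output
  have hcp : s₅.word 3 c = s.word 2 q := by rw [h34.1]; simp [hs₄, hs₃]
  have hcl : s₅.word 4 c = k := by rw [h34.2]; simp [hs₄, hs₃]
  have hres : ∀ t < d, s₅.real 3 (a * d + t) = z * (g * (X a t - X q t) + s.real 3 (q * d + t) -
      2 ^ k * slotSum (fun u => s₅.word 5 (c * (2 * d) + u)) (2 ^ (e + 2)) (2 * d) t) := by
    intro t ht
    rw [hr₅ t ht]
    simp only [hs₄, hs₃, State.real_setWord, hr₂ t ht, hr₁ t ht, hslots]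
  refine hQ _ s₅ (fun t => v t + 2 ^ k * slotSum (fun u => s₅.word 5 (c * (2 * d) + u))
    (2 ^ (e + 2)) (2 * d) t) ?_ hstep ?_ (by omega) hcl ?_ ?_ ?_ ?_
  · have e1 : (nearCond (WVar 6)).size + (1 : WExp).size + 15 ≤ 50 := by decide
    have e2 := Nat.mul_le_mul_right n e1
    have e3 : (WVar 11).size + (WExp.cell 2 (WVar 10)).size + 1 +
      ((WVar 11).size + (WVar 6).size + 1 + ((WVar 7).size + (WVar 11).size + 1)) ≤ 30 := by decide
    have e4 : (WVar 11 + 1 : WExp).size = 4 := rfl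
    omega
  · refine .step (v := v) (by omega) ?_ ?_
    · rw [hcp]; exact hstep.reach hlt hR
    · intro t ht; rw [hcl]
  · intro u hu; rw [hslots]; exact hs₂ u hu
  · intro t ht
    have := hb₂ t ht
    rw [hr₂ t ht, hr₁ t ht] at this
    simpa [hslots] using this
  · intro hnear t ht
    obtain ⟨b, hb, h1, h2, h3⟩ := hnear
    have : z = 1 := by
      rcases hz with ⟨-, hz⟩ | ⟨-, -, -, hz⟩
      · exact absurd ⟨h1, h2, h3⟩ (hz b hb)
      · exact hz
    rw [hres t ht, this]
    push_cast; ring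
  · intro hnear t ht
    have : z = 0 := by
      rcases hz with ⟨hz, -⟩ | ⟨b, hb, hz, -⟩
      · exact hz
      · exact absurd ⟨b, hb, hz⟩ hnear
    rw [hres t ht, this]
    push_cast; ring

end

/-- Gives records to the points that enter the net at level `6`. -/
def newPoints : Prog :=
  forTo 7 (WVar 0) (.ite (.weq (.cell 1 (WVar 7)) (WVar 6))
    (scan parentCond (WVar 8 + 1) ⨾ assign 10 (WVar 9 - 1) ⨾ storeRecord) .skip)

/-- Refines the older net points that are not isolated at level `6 + 1`. -/
def oldPoints : Prog :=
  forTo 7 (WVar 0) (.ite (.wlt (WVar 6) (.cell 1 (WVar 7)))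
    (scan (nearCond (WVar 6 + 1)) 1 ⨾
      .ite (.weq (WVar 9) 0) .skip (assign 10 (WVar 7) ⨾ storeRecord)) .skip)

def makeRecords : Prog :=
  assign 6 (WVar 4) ⨾ .loop (.wlt 0 (WVar 6)) (assign 6 (WVar 6 - 1) ⨾ newPoints ⨾ oldPoints)

/-- `T` is the level function of a hierarchy of nets for the distance `D`. -/
structure Net (n d e M : ℕ) (g : ℝ) (X D : ℕ → ℕ → ℝ) (T : ℕ → ℕ) : Prop where
  dist : IsDist D
  sep : Separated n D T
  root : T 0 = M
  top : ∀ a < n, a ≠ 0 → T a < M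
  cover : ∀ a < n, a ≠ 0 → ∃ b < n, T a + 1 ≤ T b ∧ 16 * D a b ≤ 2 ^ (T a + 1)
  far : ∀ a < n, ∀ b < n, a ≠ b → 1 ≤ D a b
  sum : ∀ a < n, ∀ b < n,
    ∑ t ∈ Finset.range d, |g * (X a t - X b t)| ≤ 16 * 2 ^ e * (d * D a b)

/-! ### Making the records level by level -/

section
variable {p : ℝ≥0∞} {w n d e M P : ℕ} {g : ℝ} {X D : ℕ → ℕ → ℝ} {T : ℕ → ℕ} {s s' : State}
  {a b k c q : ℕ} {O : ℕ → ℝ} {O₀ : ℕ → ℕ → ℝ} {Z Z' : ℕ → Prop}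

/-- The data of the net point `a` at level `k`, where `O` is the offset of its frame. -/
def PointAt (n d e M : ℕ) (g : ℝ) (X D : ℕ → ℕ → ℝ) (T : ℕ → ℕ) (k : ℕ) (s : State) (a : ℕ)
    (O : ℕ → ℝ) : Prop :=
  ∃ m S, m + k ≤ M ∧ MReach d e s m (s.word 2 a) S ∧ s.word 2 a < s.word 0 11 ∧
    ∀ t < d, |s.real 3 (a * d + t)| ≤ 2 ^ k ∧
      (¬ Near n D T k a → s.real 3 (a * d + t) = 0) ∧
      O t = g * X a t - S t - s.real 3 (a * d + t)

/-- The data of a net point after the processing at level `k`, where `O₀` contains the offsets at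
level `k + 1`. -/
def PointDone (n d e M : ℕ) (g : ℝ) (X D : ℕ → ℕ → ℝ) (T : ℕ → ℕ) (k : ℕ) (O₀ : ℕ → ℕ → ℝ)
    (s : State) (a : ℕ) : Prop :=
  ∃ q < n, ∃ O, PointAt n d e M g X D T k s a O ∧ k + 1 ≤ T q ∧ 16 * D a q ≤ 2 ^ (k + 1) ∧
    ∀ t < d, |O t - O₀ q t| ≤ 2 ^ k ∧ (Near n D T k a → O t = O₀ q t)

/-- The records made so far, where at level `k` only points in `Z` have been processed. -/
structure Book (n d e M : ℕ) (D : ℕ → ℕ → ℝ) (T : ℕ → ℕ) (k : ℕ) (Z : ℕ → Prop) (s : State) :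
    Prop where
  card : ∃ F : Finset (ℕ × ℕ), s.word 0 11 = F.card + 1 ∧ ∀ x ∈ F, (x.2 < n ∧
    (T x.2 = x.1 ∨ x.1 < T x.2 ∧ Near n D T (x.1 + 1) x.2)) ∧ (k < x.1 ∨ x.1 = k ∧ Z x.2)
  parent : ∀ r < s.word 0 11, s.word 3 r ≤ r
  level : ∀ r < s.word 0 11, s.word 4 r ≤ M
  slot : ∀ r < s.word 0 11, ∀ u < 2 * d, s.word 5 (r * (2 * d) + u) < 2 ^ (e + 5)

/-- The memory at level `k` when the points in `Z` have been processed. -/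
structure Mid (w n d e M P : ℕ) (g : ℝ) (X D : ℕ → ℕ → ℝ) (T : ℕ → ℕ) (k : ℕ) (O₀ : ℕ → ℕ → ℝ)
    (Z : ℕ → Prop) (s : State) : Prop where
  env : Env w n d e M P g X D T s
  level : s.word 0 6 = k
  output : s.output = []
  book : Book n d e M D T k Z s
  todo : ∀ a < n, k + 1 ≤ T a → ¬ Z a → PointAt n d e M g X D T (k + 1) s a (O₀ a)
  done : ∀ a < n, k ≤ T a → Z a → PointDone n d e M g X D T k O₀ s a

/-- The memory after the processing of level `k`. -/
structure LevelDone (w n d e M P : ℕ) (g : ℝ) (X D : ℕ → ℕ → ℝ) (T : ℕ → ℕ) (k : ℕ)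
    (O : ℕ → ℕ → ℝ) (s : State) : Prop where
  env : Env w n d e M P g X D T s
  level : s.word 0 6 = k
  output : s.output = []
  book : Book n d e M D T k (fun _ => True) s
  point : ∀ a < n, k ≤ T a → PointAt n d e M g X D T k s a (O a)
  frame : ∀ a < n, ∀ b < n, k ≤ T a → k ≤ T b → a ≠ b → ∀ t < d,
    |O a t - O b t| ≤ frameErr k (D a b)

/-- The additional record is the root, with index 0, which belongs to no pair in the charging
argument. -/
theorem Book.lt (hN : Net n d e M g X D T) (h : Book n d e M D T k Z s) (hn : 1 ≤ n) :
    s.word 0 11 < 12 * n + 1 ∧ s.word 0 11 ≤ 11 * n + 1 := by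
  obtain ⟨F, hF, hF'⟩ := h.card
  have := card_records_le hN.dist hN.sep F fun x hx => (hF' x hx).1
  omega

theorem PointAt.congr (h : PointAt n d e M g X D T k s a O) (h2 : s'.word 2 a = s.word 2 a)
    (h11 : s.word 0 11 ≤ s'.word 0 11)
    (hR : ∀ m r v, r < s.word 0 11 → MReach d e s m r v → MReach d e s' m r v)
    (h3 : ∀ t < d, s'.real 3 (a * d + t) = s.real 3 (a * d + t)) :
    PointAt n d e M g X D T k s' a O := by
  obtain ⟨m, S, h, h', h'', h'''⟩ := h
  refine ⟨m, S, h, ?_, ?_, ?_⟩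
  · rw [h2]; exact hR _ _ _ h'' h'
  · rw [h2]; omega
  · intro t ht
    rw [h3 t ht]; exact h''' t ht

theorem PointDone.congr (h : PointDone n d e M g X D T k O₀ s a)
    (H : ∀ O, PointAt n d e M g X D T k s a O → PointAt n d e M g X D T k s' a O) :
    PointDone n d e M g X D T k O₀ s' a := by
  obtain ⟨q, hq, O, h, h'⟩ := h
  exact ⟨q, hq, O, H O h, h'⟩

theorem Book.setWord (h : Book n d e M D T k Z s) {j v : ℕ} (hj : j ≠ 11) :
    Book n d e M D T k Z (s.setWord 0 j v) := by
  obtain ⟨h1, h2, h3, h4⟩ := h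
  have hj' : ∀ i, (s.setWord 0 j v).word 0 11 = s.word 0 11 ∧
      (s.setWord 0 j v).word (i + 1) = s.word (i + 1) := by simp [hj.symm]
  refine ⟨?_, ?_, ?_, ?_⟩ <;> rw [(hj' 0).1]
  · exact h1
  · exact h2
  · exact h3
  · exact h4

theorem Mid.setWord (h : Mid w n d e M P g X D T k O₀ Z s) {j v : ℕ} (hj : 7 ≤ j ∧ j ≤ 10) :
    Mid w n d e M P g X D T k O₀ Z (s.setWord 0 j v) := by
  have hP : ∀ k a O, PointAt n d e M g X D T k s a O →
      PointAt n d e M g X D T k (s.setWord 0 j v) a O := fun k a O h => by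
    have hj' : 11 ≠ j := by omega
    refine h.congr (by simp) (by simp [hj']) ?_ (by simp)
    intro m r v' _ h'
    simpa [MReach] using h'
  exact ⟨h.env.setWord (by omega), by simp [h.level]; omega, h.output, h.book.setWord (by omega),
    fun a ha hk hZ => hP _ _ _ (h.todo a ha hk hZ),
    fun a ha hk hZ => (h.done a ha hk hZ).congr fun O => hP _ _ _⟩

theorem Mid.congr (h : Mid w n d e M P g X D T k O₀ Z s)
    (hZ : ∀ a < n, k ≤ T a → (Z a ↔ Z' a)) : Mid w n d e M P g X D T k O₀ Z' s := by
  refine ⟨h.env, h.level, h.output, ⟨?_, h.book.parent, h.book.level, h.book.slot⟩,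
    fun a ha hk hZa => ?_, fun a ha hk hZa => ?_⟩
  · obtain ⟨F, hF, hF'⟩ := h.book.card
    refine ⟨F, hF, fun x hx => ⟨(hF' x hx).1, (hF' x hx).2.imp_right fun h' => ⟨h'.1, ?_⟩⟩⟩
    refine (hZ _ (hF' x hx).1.1 ?_).1 h'.2
    rcases (hF' x hx).1.2 with h'' | h'' <;> omega
  · exact h.todo a ha hk fun h' => hZa ((hZ a ha (by omega)).1 h')
  · exact h.done a ha hk ((hZ a ha hk).2 hZa)

/-- Both kinds of points use this step. That `q` is unprocessed matters: its record, residual and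
offset still belong to level k+1. -/
theorem Mid.run_storeRecord (hB : WordBounds w n d e M P) (hN : Net n d e M g X D T)
    {Q : ℕ → State → Prop} (h : Mid w n d e M P g X D T k O₀ Z s) (hk : k < M) (ha : a < n)
    (hq : q < n) (h7 : s.word 0 7 = a) (h10 : s.word 0 10 = q) (hZa : ¬ Z a) (hZq : ¬ Z q)
    (hTq : k + 1 ≤ T q) (hDq : 16 * D a q ≤ 2 ^ (k + 1))
    (hst : T a = k ∨ k < T a ∧ Near n D T (k + 1) a)
    (hQ : ∀ τ s', τ ≤ 100 * n + 700 * d → s'.word 0 7 = a → s'.word 0 11 = s.word 0 11 + 1 →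
      Mid w n d e M P g X D T k O₀ (fun b => Z b ∨ b = a) s' → Q τ s') :
    Run p w storeRecord s Q := by
  obtain ⟨m, S, hm, hR, hlt, hpt⟩ := h.todo q hq hTq hZq
  obtain ⟨F, hF, hF'⟩ := h.book.card
  -- Each pair (level, point) receives at most one record, so counting pairs counts records.
  have hnot : (k, a) ∉ F := fun hx => by
    rcases (hF' _ hx).2 with h' | h'
    · exact absurd h' (lt_irrefl _)
    · exact hZa h'.2
  have hF₁ : ∀ x ∈ insert (k, a) F, x.2 < n ∧
      (T x.2 = x.1 ∨ x.1 < T x.2 ∧ Near n D T (x.1 + 1) x.2) := fun x hx => by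
    rcases Finset.mem_insert.1 hx with rfl | hx
    · exact ⟨ha, hst⟩
    · exact (hF' x hx).1
  have hcard := card_records_le hN.dist hN.sep _ hF₁
  rw [Finset.card_insert_of_notMem hnot] at hcard
  have hp : (0 : ℝ) < 2 ^ k := by positivity
  have hn := hB.n_pos
  refine RealRAM.run_storeRecord (c := s.word 0 11) hB h.env ha hq hk.le (by omega) h.level h7 h10 rfl ?_
    hR hlt ?_
  -- Since 16·D a q ≤ 2^(k+1), the displacement contributes at most 2^e·d·2^(k+1). The residual of
  -- `q` contributes at most 2^(k+1) per coordinate. The bias B = 2^(e+2) is chosen so that the sum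
  -- is at most d·B·2^k.
  · calc ∑ t ∈ Finset.range d, |g * (X a t - X q t) + s.real 3 (q * d + t)|
        ≤ ∑ t ∈ Finset.range d, (|g * (X a t - X q t)| + 2 ^ (k + 1)) := by
          refine Finset.sum_le_sum fun t ht => (abs_add_le _ _).trans ?_
          gcongr
          exact (hpt t (Finset.mem_range.1 ht)).1
      _ ≤ 16 * 2 ^ e * (d * D a q) + d * 2 ^ (k + 1) := by
          rw [Finset.sum_add_distrib, Finset.sum_const, Finset.card_range, nsmul_eq_mul]
          gcongr
          exact hN.sum a ha q hq
      _ = 2 ^ e * d * (16 * D a q) + d * 2 ^ (k + 1) := by ring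
      _ ≤ 2 ^ e * d * 2 ^ (k + 1) + 2 ^ e * d * 2 ^ (k + 1) := by
          have h1 : (1 : ℝ) ≤ 2 ^ e := one_le_pow₀ (by norm_num)
          have h2 : (0 : ℝ) ≤ d * 2 ^ (k + 1) := by positivity
          gcongr
          nlinarith
      _ = _ := by push_cast; ring
  · intro τ s' v' hτ hstep hR' hpar hlev hslot hv hnear hfar
    refine hQ τ s' hτ (by rw [hstep.word0 _ (by omega) (by omega), h7]) hstep.cnt ?_
    have hP : ∀ k b O, b ≠ a → PointAt n d e M g X D T k s b O →
        PointAt n d e M g X D T k s' b O := fun k b O hb h' => by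
      refine h'.congr (by rw [hstep.recOf, if_neg hb]) (by rw [hstep.cnt]; omega) ?_ ?_
      · intro m r v hr; exact hstep.reach hr
      · intro t ht; exact hstep.res b t hb ht
    refine ⟨h.env.recStep hstep, ?_, ?_, ⟨?_, ?_, ?_, ?_⟩, ?_, ?_⟩
    · rw [hstep.word0 _ (by omega) (by omega), h.level]
    · rw [hstep.output, h.output]
    · refine ⟨insert (k, a) F, ?_, ?_⟩
      · rw [Finset.card_insert_of_notMem hnot, hstep.cnt, hF]
      · intro x hx
        refine ⟨hF₁ x hx, ?_⟩
        rcases Finset.mem_insert.1 hx with rfl | hx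
        · exact Or.inr ⟨rfl, Or.inr rfl⟩
        · exact (hF' x hx).2.imp_right fun h' => ⟨h'.1, Or.inl h'.2⟩
    · intro r hr
      rw [hstep.cnt] at hr
      rcases Nat.lt_succ_iff_lt_or_eq.1 hr with hr | rfl
      · rw [hstep.parent r hr]; exact h.book.parent r hr
      · exact hpar.le
    · intro r hr
      rw [hstep.cnt] at hr
      rcases Nat.lt_succ_iff_lt_or_eq.1 hr with hr | rfl
      · rw [hstep.level r hr]; exact h.book.level r hr
      · omega
    · intro r hr u hu
      rw [hstep.cnt] at hr
      rcases Nat.lt_succ_iff_lt_or_eq.1 hr with hr | rfl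
      · rw [hstep.slot _ (idx_lt hr hu)]; exact h.book.slot r hr u hu
      · exact hslot u hu
    · intro b hb hTb hZb
      exact hP _ b _ (fun h' => hZb (Or.inr h')) (h.todo b hb hTb fun h' => hZb (Or.inl h'))
    · rintro b hb hTb hZb
      by_cases hba : b = a
      · subst hba
        have hrec : s'.word 2 b = s.word 0 11 := by rw [hstep.recOf, if_pos rfl]
        refine ⟨q, hq, fun t => g * X b t - v' t - s'.real 3 (b * d + t), ⟨m + 1, v', by omega, ?_,
          ?_, ?_⟩, hTq, hDq, ?_⟩
        · rw [hrec]; exact hR'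
        · rw [hrec, hstep.cnt]; omega
        · intro t ht
          refine ⟨?_, fun h' => hfar h' t ht, rfl⟩
          by_cases h' : Near n D T k b
          · rw [hnear h' t ht]; exact hv t ht
          · rw [hfar h' t ht, abs_zero]; positivity
        · intro t ht
          -- If the residual is kept, the definition of the offset gives exactly the offset of `q`;
          -- if it is dropped, the offset moves by its absolute value, at most 2^k.
          have h1 := (hpt t ht).2.2
          beta_reduce
          by_cases h' : Near n D T k b
          · have : g * X b t - v' t - s'.real 3 (b * d + t) = O₀ q t := by
              rw [hnear h' t ht, h1]; ring
            rw [this]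
            exact ⟨by rw [sub_self, abs_zero]; positivity, fun _ => rfl⟩
          · refine ⟨?_, fun h'' => absurd h'' h'⟩
            rw [hfar h' t ht, h1]
            convert hv t ht using 2
            ring
      · exact (h.done b hb hTb (hZb.resolve_right hba)).congr fun O => hP _ _ _ hba

/-- The time is amortized: each new record pays 700d, and only the scans, O(n²) per level, are
charged to the level. The same scheme serves the older points. -/
theorem Mid.run_newPoints (hB : WordBounds w n d e M P) (hN : Net n d e M g X D T)
    {Q : ℕ → State → Prop} (h : Mid w n d e M P g X D T k O₀ (fun _ => False) s) (hk : k < M)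
    (hQ : ∀ τ s', τ + 700 * d * s.word 0 11 ≤ 400 * n * n + 700 * d * s'.word 0 11 →
      Mid w n d e M P g X D T k O₀ (fun a => T a = k) s' → Q τ s') :
    Run p w newPoints s Q := by
  have hw := hB.hw
  have hn := hB.n_pos
  have hnw : n < 2 ^ w := by have := hB.nn; omega
  have hV : ∀ {j : ℕ} {s : State}, j < 64 → (WVar j).eval w s = s.word 0 j := fun hj =>
    eval_WVar hw hj
  refine Run.forTo (N := n) (fun i τ s' =>
    τ + 700 * d * s.word 0 11 ≤ 300 * n * i + 3 + 700 * d * s'.word 0 11 ∧ s'.word 0 7 = i ∧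
    Mid w n d e M P g X D T k O₀ (fun a => T a = k ∧ a < i) s') hw (by norm_num) hnw ?_ ?_ ?_ ?_
  · rintro i τ s' - ⟨-, h7, h'⟩
    exact ⟨h7, by rw [hV (by norm_num), h'.env.n_eq]⟩
  · exact ⟨by simp, by simp, (h.congr (by simp)).setWord (by omega)⟩
  · rintro i τ s' hi ⟨hτ, h7, h'⟩
    have hguard : (BExp.weq (.cell 1 (WVar 7)) (WVar 6)).Holds p w s' ↔ T i = k := by
      simp only [BExp.Holds, WExp.eval_cell, hV (show 7 < 64 by norm_num),
        hV (show 6 < 64 by norm_num), h7, h'.level, h'.env.T_eq i hi]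
    have hsz : (BExp.weq (.cell 1 (WVar 7)) (WVar 6)).size + 1 + ((WVar 0).size + 10) ≤ 20 := by
      decide
    have hni : 300 * n * (i + 1) = 300 * n * i + 300 * n := by ring
    refine Run.ite (fun hb => ?_) (fun hb => ?_)
    · have hTi := hguard.1 hb
      have hi0 : i ≠ 0 := by
        rintro rfl; rw [hN.root] at hTi; omega
      refine Run.seq (Run.scan (fun b => k + 1 ≤ T b ∧ 16 * D i b ≤ 2 ^ (k + 1)) (fun b => b + 1) hw
        h'.env.n_eq hnw ?_ ?_ fun τ₁ z hτ₁ hz => ?_)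
      · intro b hb v
        refine holds_parentCond hB ((h'.env.setWord (by omega)).setWord (by omega)) hi hb ?_ ?_ ?_ hk
        · simp [h'.level]
        · simp [h7]
        · simp
      · intro b hb v
        exact WExp.eval_add_of (by rw [hV (by norm_num)]; simp)
          (WExp.eval_ofNat hw (by norm_num)) (by omega)
      obtain ⟨q, hq, ⟨hTq, hDq⟩, rfl⟩ : ∃ b < n, (k + 1 ≤ T b ∧ 16 * D i b ≤ 2 ^ (k + 1)) ∧
          z = b + 1 := by
        rcases hz with ⟨-, hz⟩ | hz
        · obtain ⟨b, hb, h1⟩ := hN.cover i hi hi0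
          rw [hTi] at h1
          exact absurd h1 (hz b hb)
        · exact hz
      refine Run.seq (Run.assign hw (by norm_num) (v := q) ?_ ?_)
      · rw [WExp.eval_sub_of (m := q + 1) (n := 1)]
        · omega
        · rw [hV (by norm_num)]; simp
        · exact WExp.eval_ofNat hw (by norm_num)
        · omega
        · omega
      refine Mid.run_storeRecord (a := i) (q := q) hB hN (((h'.setWord (by omega)).setWord
        (by omega)).setWord (by omega)) hk hi hq (by simp [h7]) (by simp) (by simp) (by
          rintro ⟨h1, -⟩; omega) hTq hDq (Or.inl hTi) ?_
      intro τ₂ s'' hτ₂ h7'' h11 hM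
      refine ⟨h7'', ?_, by simp, (hM.congr ?_).setWord (by omega)⟩
      · have e1 : parentCond.size + (WVar 8 + 1 : WExp).size + 15 ≤ 60 := by decide
        have e2 := Nat.mul_le_mul_right n e1
        have e3 : (WVar 9 - 1 : WExp).size = 4 := rfl
        simp at h11 ⊢
        rw [h11, hni, show 700 * d * (s'.word 0 11 + 1) = 700 * d * s'.word 0 11 + 700 * d by ring]
        omega
      · intro b hb hkb
        constructor
        · rintro (⟨h1, h2⟩ | rfl)
          · exact ⟨h1, by omega⟩
          · exact ⟨hTi, by omega⟩
        · rintro ⟨h1, h2⟩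
          rcases Nat.lt_succ_iff_lt_or_eq.1 h2 with h2 | h2
          · exact Or.inl ⟨h1, h2⟩
          · exact Or.inr h2
    · have hTi := fun h => hb (hguard.2 h)
      refine Run.skip ⟨h7, ?_, by simp, (h'.congr ?_).setWord (by omega)⟩
      · simp; omega
      · intro b hb hkb
        constructor
        · rintro ⟨h1, h2⟩; exact ⟨h1, by omega⟩
        · rintro ⟨h1, h2⟩
          refine ⟨h1, ?_⟩
          rcases Nat.lt_succ_iff_lt_or_eq.1 h2 with h2 | rfl
          · exact h2
          · exact absurd h1 hTi
  · rintro τ s' ⟨hτ, -, h'⟩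
    refine hQ _ _ ?_ (h'.congr ?_)
    · have : (WVar 0).size = 2 := rfl
      have : n ≤ n * n := Nat.le_mul_self n
      have e : ∀ c, c * n * n = c * (n * n) := fun c => by ring
      rw [e] at hτ ⊢
      omega
    · intro b hb _
      simp [hb]

/-- An older point is its own predecessor, at distance 0, and its new record only refines the
residual of level k+1. It needs one only if it has a neighbour at level k+1. -/
theorem Mid.run_oldPoints (hB : WordBounds w n d e M P) (hN : Net n d e M g X D T)
    {Q : ℕ → State → Prop} (h : Mid w n d e M P g X D T k O₀ (fun a => T a = k) s) (hk : k < M)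
    (hQ : ∀ τ s', τ + 700 * d * s.word 0 11 ≤ 400 * n * n + 700 * d * s'.word 0 11 →
      Mid w n d e M P g X D T k O₀ (fun _ => True) s' → Q τ s') :
    Run p w oldPoints s Q := by
  have hw := hB.hw
  have hn := hB.n_pos
  have hnw : n < 2 ^ w := by have := hB.nn; omega
  have hV : ∀ {j : ℕ} {s : State}, j < 64 → (WVar j).eval w s = s.word 0 j := fun hj =>
    eval_WVar hw hj
  refine Run.forTo (N := n) (fun i τ s' =>
    τ + 700 * d * s.word 0 11 ≤ 300 * n * i + 3 + 700 * d * s'.word 0 11 ∧ s'.word 0 7 = i ∧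
    Mid w n d e M P g X D T k O₀ (fun a => T a = k ∨ a < i) s') hw (by norm_num) hnw ?_ ?_ ?_ ?_
  · rintro i τ s' - ⟨-, h7, h'⟩
    exact ⟨h7, by rw [hV (by norm_num), h'.env.n_eq]⟩
  · exact ⟨by simp, by simp, (h.congr (by simp)).setWord (by omega)⟩
  · rintro i τ s' hi ⟨hτ, h7, h'⟩
    have hguard : (BExp.wlt (WVar 6) (.cell 1 (WVar 7))).Holds p w s' ↔ k < T i := by
      simp only [BExp.Holds, WExp.eval_cell, hV (show 7 < 64 by norm_num),
        hV (show 6 < 64 by norm_num), h7, h'.level, h'.env.T_eq i hi]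
    have hsz : (BExp.wlt (WVar 6) (.cell 1 (WVar 7))).size + 1 + ((WVar 0).size + 10) ≤ 20 := by
      decide
    have hni : 300 * n * (i + 1) = 300 * n * i + 300 * n := by ring
    refine Run.ite (fun hb => ?_) (fun hb => ?_)
    · have hTi := hguard.1 hb
      have hZi : ¬ (T i = k ∨ i < i) := by omega
      have hpow : 2 ^ (k + 1) < 2 ^ w :=
        lt_of_le_of_lt (Nat.pow_le_pow_right (by norm_num) (by omega)) hB.powM
      refine Run.seq (Run.scan (fun b => b ≠ i ∧ k + 1 ≤ T b ∧ 2 * D i b ≤ 2 ^ (k + 1))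
        (fun _ => 1) hw h'.env.n_eq hnw ?_ ?_ fun τ₁ z hτ₁ hz => ?_)
      · intro b hb v
        refine holds_nearCond hB ((h'.env.setWord (by omega)).setWord (by omega)) hi hb ?_ ?_ ?_ hk
        · simp [h7]
        · simp
        · refine WExp.eval_add_of ?_ (WExp.eval_ofNat hw (by norm_num))
            (Nat.lt_two_pow_self.trans hpow)
          rw [hV (by norm_num)]
          simp [h'.level]
      · intro b hb v
        exact WExp.eval_ofNat hw (by norm_num)
      have e1 : (nearCond (WVar 6 + 1)).size + (1 : WExp).size + 15 ≤ 60 := by decide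
      have e2 := Nat.mul_le_mul_right n e1
      have e3 : (BExp.weq (WVar 9) 0).size = 4 := rfl
      have e4 : (WVar 7).size = 2 := rfl
      have hDi : 16 * D i i ≤ 2 ^ (k + 1) := by rw [hN.dist.self, mul_zero]; positivity
      have hM := (h'.setWord (j := 9) (v := z) (by omega)).setWord (j := 8) (v := n) (by omega)
      set s₁ := (s'.setWord 0 9 z).setWord 0 8 n with hs₁
      have h7₁ : s₁.word 0 7 = i := by simp [hs₁, h7]
      have hz' : (BExp.weq (WVar 9) 0).Holds p w s₁ ↔ z = 0 := by
        simp only [BExp.Holds, hV (show 9 < 64 by norm_num),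
          WExp.eval_ofNat hw (show 0 < 64 by norm_num)]
        simp [hs₁]
      refine Run.ite (fun hb => ?_) (fun hb => ?_)
      -- An isolated point has residual 0 already, so its old record and offset satisfy everything
      -- that is required at level `k`.
      · have hfar : ¬ Near n D T (k + 1) i := by
          rintro ⟨b, hb', h1⟩
          rcases hz with ⟨-, hz⟩ | ⟨-, -, -, hz⟩
          · exact hz b hb' h1
          · rw [hz'.1 hb] at hz; omega
        refine Run.skip ⟨h7₁, ?_, by simp, Mid.setWord ?_ (by omega)⟩
        · simp [hs₁]; omega
        obtain ⟨m, S, h1, h2, h3, h4⟩ := hM.todo i hi hTi hZi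
        refine ⟨hM.env, hM.level, hM.output, ⟨?_, hM.book.parent, hM.book.level, hM.book.slot⟩,
          ?_, ?_⟩
        · obtain ⟨F, hF, hF'⟩ := hM.book.card
          exact ⟨F, hF, fun x hx => ⟨(hF' x hx).1, (hF' x hx).2.imp_right fun h' =>
            ⟨h'.1, h'.2.imp_right fun h'' => by omega⟩⟩⟩
        · intro b hb hTb hZb
          exact hM.todo b hb hTb fun h' => hZb (h'.imp_right fun h'' => by omega)
        · intro b hb hTb hZb
          by_cases hbi : b = i
          · subst hbi
            refine ⟨b, hi, O₀ b, ⟨m, S, by omega, h2, h3, ?_⟩, hTi, hDi, ?_⟩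
            · intro t ht
              obtain ⟨-, h5, h6⟩ := h4 t ht
              exact ⟨by rw [h5 hfar, abs_zero]; positivity, fun _ => h5 hfar, h6⟩
            · intro t ht
              exact ⟨by rw [sub_self, abs_zero]; positivity, fun _ => rfl⟩
          · exact hM.done b hb hTb (hZb.imp_right fun h' => by omega)
      · have hnear : Near n D T (k + 1) i := by
          rcases hz with ⟨hz, -⟩ | ⟨b, hb', hz, -⟩
          · exact absurd (hz'.2 hz) hb
          · exact ⟨b, hb', hz⟩
        refine Run.seq (Run.assign hw (by norm_num) (v := i) (by rw [hV (by norm_num), h7₁]) ?_)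
        refine Mid.run_storeRecord (a := i) (q := i) hB hN (hM.setWord (by omega)) hk hi hi
          (by simp [h7₁]) (by simp) hZi hZi hTi hDi (Or.inr ⟨hTi, hnear⟩) ?_
        intro τ₂ s'' hτ₂ h7'' h11 hM'
        refine ⟨h7'', ?_, by simp, (hM'.congr ?_).setWord (by omega)⟩
        · simp [hs₁] at h11 ⊢
          rw [h11, hni, show 700 * d * (s'.word 0 11 + 1) = 700 * d * s'.word 0 11 + 700 * d by ring]
          omega
        · intro b hb hkb
          omega
    · have hTi : ¬ k < T i := fun h => hb (hguard.2 h)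
      refine Run.skip ⟨h7, ?_, by simp, (h'.congr ?_).setWord (by omega)⟩
      · simp; omega
      · intro b hb hkb
        constructor
        · omega
        · intro h1
          by_cases hbi : b = i
          · subst hbi; omega
          · omega
  · rintro τ s' ⟨hτ, -, h'⟩
    refine hQ _ _ ?_ (h'.congr ?_)
    · have : (WVar 0).size = 2 := rfl
      have : n ≤ n * n := Nat.le_mul_self n
      have e : ∀ c, c * n * n = c * (n * n) := fun c => by ring
      rw [e] at hτ ⊢
      omega
    · intro b hb _
      simp [hb]

theorem LevelDone.mid (h : LevelDone w n d e M P g X D T (k + 1) O₀ s) :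
    Mid w n d e M P g X D T k O₀ (fun _ => False) (s.setWord 0 6 k) := by
  refine ⟨h.env.setWord (by omega), by simp, h.output, Book.setWord ⟨?_, h.book.parent,
    h.book.level, h.book.slot⟩ (by omega), fun a ha hk _ => ?_, by simp⟩
  · obtain ⟨F, hF, hF'⟩ := h.book.card
    exact ⟨F, hF, fun x hx => ⟨(hF' x hx).1, Or.inl (by rcases (hF' x hx).2 with h' | h' <;> omega)⟩⟩
  · refine (h.point a ha hk).congr (by simp) (by simp) ?_ (by simp)
    intro m r v _ h'
    simpa [MReach] using h'

/-- The offsets of all net points at level `k` are chosen at once, and `frame_step` is applied to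
each pair. Two points with the same predecessor start with discrepancy 0. -/
theorem Mid.levelDone (hN : Net n d e M g X D T)
    (h₀ : ∀ a < n, ∀ b < n, k + 1 ≤ T a → k + 1 ≤ T b → a ≠ b → ∀ t < d,
      |O₀ a t - O₀ b t| ≤ frameErr (k + 1) (D a b))
    (h : Mid w n d e M P g X D T k O₀ (fun _ => True) s) :
    ∃ O, LevelDone w n d e M P g X D T k O s := by
  have H : ∀ a, ∃ q O, a < n → k ≤ T a → q < n ∧ PointAt n d e M g X D T k s a O ∧ k + 1 ≤ T q ∧
      16 * D a q ≤ 2 ^ (k + 1) ∧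
      ∀ t < d, |O t - O₀ q t| ≤ 2 ^ k ∧ (Near n D T k a → O t = O₀ q t) := by
    intro a
    by_cases h' : a < n ∧ k ≤ T a
    · obtain ⟨q, hq, O, h1, h2⟩ := h.done a h'.1 h'.2 trivial
      exact ⟨q, O, fun _ _ => ⟨hq, h1, h2⟩⟩
    · exact ⟨0, fun _ => 0, fun h1 h2 => absurd ⟨h1, h2⟩ h'⟩
  choose q O H using H
  refine ⟨O, h.env, h.level, h.output, h.book, fun a ha hk => (H a ha hk).2.1, ?_⟩
  intro a ha b hb hTa hTb hab t ht
  obtain ⟨hqa, -, hTqa, hDa, hOa⟩ := H a ha hTa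
  obtain ⟨hqb, -, hTqb, hDb, hOb⟩ := H b hb hTb
  refine frame_step hN.dist ha hb hab hTa hTb hDa hDb ?_ (hOa t ht).1 (hOa t ht).2
    (hOb t ht).1 (hOb t ht).2
  by_cases hq : q a = q b
  · rw [hq, sub_self, abs_zero, hN.dist.self]
    unfold frameErr
    have hp : (0 : ℝ) < 2 ^ (k + 1) := by positivity
    rw [if_neg (by linarith)]
  · exact h₀ _ hqa _ hqb hTqa hTqb hq t ht

theorem run_makeRecords (hB : WordBounds w n d e M P) (hN : Net n d e M g X D T)
    {Q : ℕ → State → Prop} (h : LevelDone w n d e M P g X D T M O₀ (s.setWord 0 6 M))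
    (hM : s.word 0 4 = M) (hQ : ∀ τ s' O, τ ≤ 900 * n * n * M + 8400 * n * d →
      LevelDone w n d e M P g X D T 0 O s' → Q τ s') :
    Run p w makeRecords s Q := by
  have hw := hB.hw
  have hn := hB.n_pos
  have hd := hB.d_pos
  have hMw : M < 2 ^ w := by
    have := hB.powM
    have : M + 1 < 2 ^ (M + 1) := Nat.lt_two_pow_self
    omega
  have hV : ∀ {j : ℕ} {s : State}, j < 64 → (WVar j).eval w s = s.word 0 j := fun hj =>
    eval_WVar hw hj
  refine Run.seq (Run.assign hw (by norm_num) (v := M) (by rw [hV (by norm_num), hM]) ?_)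
  set s₁ := s.setWord 0 6 M
  -- The record count is the potential: the time is at most 820n² per finished level plus 700d per
  -- record. The term 700d on the left compensates for the root, which is counted but costs nothing.
  -- The bound of 11n records enters only at the end.
  refine Run.loop (fun m τ s' => ∃ O, m ≤ M ∧
    τ + 700 * d ≤ 820 * (n * n) * (M - m) + 700 * d * s'.word 0 11 ∧
    LevelDone w n d e M P g X D T m O s') M ⟨O₀, le_rfl, ?_, h⟩ ?_ ?_
  · obtain ⟨F, hF, -⟩ := h.book.card
    rw [hF, Nat.mul_add]; omega
  · rintro m τ s' ⟨O, hm, hτ, h'⟩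
    refine ⟨?_, ?_⟩
    · change (0 : WExp).eval w s' < (WVar 6).eval w s'
      rw [hV (by norm_num), h'.level, WExp.eval_ofNat hw (by norm_num)]
      exact Nat.succ_pos m
    · refine Run.seq (Run.assign hw (by norm_num) (v := m) ?_ ?_)
      · rw [WExp.eval_sub_of (m := m + 1) (n := 1)]
        · omega
        · rw [hV (by norm_num), h'.level]
        · exact WExp.eval_ofNat hw (by norm_num)
        · omega
        · omega
      refine Run.seq (h'.mid.run_newPoints hB hN (by omega) ?_)
      intro τ₁ s₂ hτ₁ h₂
      refine h₂.run_oldPoints hB hN (by omega) ?_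
      intro τ₂ s₃ hτ₂ h₃
      obtain ⟨O', hO'⟩ := h₃.levelDone hN h'.frame
      refine ⟨O', by omega, ?_, hO'⟩
      have e1 : (WVar 6 - 1 : WExp).size = 4 := rfl
      have e2 : (BExp.wlt 0 (WVar 6)).size = 4 := rfl
      have e3 : M - m = (M - (m + 1)) + 1 := by omega
      have e4 : 1 ≤ n * n := Nat.mul_pos hn hn
      simp at hτ₁
      have e : ∀ c, c * n * n = c * (n * n) := fun c => by ring
      rw [e] at hτ₁ hτ₂
      rw [e3, Nat.mul_add (820 * (n * n))]
      omega
  · rintro τ s' ⟨O, -, hτ, h'⟩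
    refine ⟨?_, hQ _ _ O ?_ h'⟩
    · change ¬ (0 : WExp).eval w s' < (WVar 6).eval w s'
      rw [hV (by norm_num), h'.level, WExp.eval_ofNat hw (by norm_num)]
      omega
    · have e1 : (WVar 4).size = 2 := rfl
      have e2 : (BExp.wlt 0 (WVar 6)).size = 4 := rfl
      have h1 := (h'.book.lt hN hn).2
      have h2 := Nat.mul_le_mul_left (700 * d) h1
      have h3 : 700 * d * (11 * n + 1) = 7700 * (n * d) + 700 * d := by ring
      have h4 : 1 * d ≤ n * d := Nat.mul_le_mul_right d hn
      have h5 : 8400 * n * d = 8400 * (n * d) := by ring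
      have h6 : 900 * n * n * M = 820 * (n * n) * M + 80 * (n * n * M) := by ring
      have h7 : 1 ≤ n * n * M := Nat.mul_pos (Nat.mul_pos hn hn) (by have := hB.M_pos; omega)
      rw [Nat.sub_zero] at hτ
      omega

end

/-- The net point `8` covers the point `7` at level `6`. -/
def coverCond : BExp :=
  .and (.not (.wlt (.cell 1 (WVar 8)) (WVar 6)))
    (.rlt (.ofWord 16 * distExp) (.ofWord (twoPow (WVar 6))))

/-- Completes the net of level `6` greedily. -/
def addNetPoints : Prog :=
  forTo 7 (WVar 0) (.ite (.weq (.cell 1 (WVar 7)) 0)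
    (scan coverCond 1 ⨾ .ite (.weq (WVar 9) 0) (.wset 1 (WVar 7) (WVar 6)) .skip) .skip)

def makeNet : Prog :=
  assign 6 (WVar 4) ⨾ .loop (.wlt 1 (WVar 6)) (assign 6 (WVar 6 - 1) ⨾ addNetPoints)

/-- Computes the global parameters. -/
def initParams : Prog :=
  .floor 0 3 (.ofWord 1 / RVar 0) ⨾ assign 3 (.log2 (WVar 3) + 1) ⨾
  .floor 0 4 (RVar 1) ⨾ assign 4 (.log2 (WVar 4) + 5) ⨾
  assign 5 (.log2 (WVar 0) + .log2 (WVar 1) + .log2 (WVar 3) + .log2 (WVar 4) + 5) ⨾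
  .rset 2 2 (.ofWord 16 * .ofWord (twoPow (WVar 3)) * .root (.ofWord (WVar 1))) ⨾
  assign 11 1 ⨾ .wset 1 0 (WVar 4)

/-- The partially built hierarchy: the levels above `k` are complete, and the points below `i` have
been treated at level `k`. -/
structure NetInv (n M : ℕ) (D : ℕ → ℕ → ℝ) (k i : ℕ) (T : ℕ → ℕ) : Prop where
  root : T 0 = M
  val : ∀ a < n, T a = 0 ∨ k ≤ T a ∧ (a ≠ 0 → T a < M)
  sep : ∀ a < n, ∀ b < n, a ≠ b → T a ≠ 0 → T b ≠ 0 → ∀ l ≤ T a, l ≤ T b →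
    (2 : ℝ) ^ l ≤ 16 * D a b
  cover : ∀ a < n, a ≠ 0 → T a ≠ 0 → ∃ b < n, T a + 1 ≤ T b ∧ 16 * D a b ≤ 2 ^ (T a + 1)
  todo : ∀ a < n, T a = 0 → ∃ b < n, k + 1 ≤ T b ∧ 16 * D a b < 2 ^ (k + 1)
  done : ∀ a < n, a < i → T a = 0 → ∃ b < n, k ≤ T b ∧ 16 * D a b < 2 ^ k

/-! ### Greedy construction of the nets -/

section
variable {p : ℝ≥0∞} {w n d e M P : ℕ} {g : ℝ} {X D : ℕ → ℕ → ℝ} {T : ℕ → ℕ} {s s' : State}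
  {a b k i : ℕ}

/-- A point enters the net of level `k` exactly because it is not covered there, which is the
separation. That it was covered one level higher provides its predecessor. -/
theorem NetInv.add (h : NetInv n M D k i T) (hD : IsDist D) (hk : 1 ≤ k) (hkM : k < M) (hi : i < n)
    (hT : T i = 0) (hfar : ∀ b < n, ¬ (k ≤ T b ∧ 16 * D i b < 2 ^ k)) :
    NetInv n M D k (i + 1) fun a => if a = i then k else T a := by
  have hi0 : i ≠ 0 := by rintro rfl; rw [h.root] at hT; omega
  have hsep : ∀ b < n, T b ≠ 0 → ∀ l ≤ k, (2 : ℝ) ^ l ≤ 16 * D i b := fun b hb hTb l hl => by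
    have h1 := hfar b hb
    have h2 : k ≤ T b := by rcases h.val b hb with h' | h' <;> omega
    have h3 : (2 : ℝ) ^ k ≤ 16 * D i b := not_lt.1 fun h' => h1 ⟨h2, h'⟩
    exact (pow_le_pow_right₀ (by norm_num) hl).trans h3
  constructor
  · rw [if_neg hi0.symm, h.root]
  · intro a ha
    split_ifs with hai
    · exact Or.inr ⟨le_rfl, fun _ => hkM⟩
    · exact h.val a ha
  · intro a ha b hb hab
    split_ifs with hai hbi hbi
    · exact absurd (hai.trans hbi.symm) hab
    · subst hai
      intro _ hTb l hl _
      exact hsep b hb hTb l hl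
    · subst hbi
      intro hTa _ l _ hl
      rw [hD.comm]
      exact hsep a ha hTa l hl
    · exact h.sep a ha b hb hab
  · intro a ha ha0
    split_ifs with hai
    · subst hai
      intro _
      obtain ⟨b, hb, h1, h2⟩ := h.todo a ha hT
      refine ⟨b, hb, ?_, h2.le⟩
      rw [if_neg (by rintro rfl; omega)]; exact h1
    · intro hTa
      obtain ⟨b, hb, h1, h2⟩ := h.cover a ha ha0 hTa
      refine ⟨b, hb, ?_, h2⟩
      rw [if_neg (by rintro rfl; omega)]; exact h1
  · intro a ha
    split_ifs with hai
    · omega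
    · intro hTa
      obtain ⟨b, hb, h1, h2⟩ := h.todo a ha hTa
      refine ⟨b, hb, ?_, h2⟩
      rw [if_neg (by rintro rfl; omega)]; exact h1
  · intro a ha hai
    split_ifs with hai'
    · omega
    · intro hTa
      obtain ⟨b, hb, h1, h2⟩ := h.done a ha (by omega) hTa
      refine ⟨b, hb, ?_, h2⟩
      rw [if_neg (by rintro rfl; omega)]; exact h1

theorem NetInv.next (h : NetInv n M D (k + 1) n T) : NetInv n M D k 0 T where
  root := h.root
  val a ha := (h.val a ha).imp_right fun h' => ⟨by omega, h'.2⟩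
  sep := h.sep
  cover := h.cover
  todo a ha hT := h.done a ha ha hT
  done a ha h0 := by omega

/-- The value 0 of `T` means "not yet assigned" during the construction and "lowest level"
afterwards. At level 0 separation follows from the minimum distance 1, and the leftover points are
covered at level 1. -/
theorem NetInv.net (h : NetInv n M D 0 0 T) (hD : IsDist D)
    (hfar : ∀ a < n, ∀ b < n, a ≠ b → 1 ≤ D a b) (hM : 1 ≤ M)
    (hsum : ∀ a < n, ∀ b < n,
      ∑ t ∈ Finset.range d, |g * (X a t - X b t)| ≤ 16 * 2 ^ e * (d * D a b)) :
    Net n d e M g X D T where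
  dist := hD
  sep a ha b hb hab l hla hlb := by
    by_cases h0 : T a = 0 ∨ T b = 0
    · obtain rfl : l = 0 := by omega
      have := hfar a ha b hb hab
      rw [pow_zero]; linarith
    · push Not at h0
      exact h.sep a ha b hb hab h0.1 h0.2 l hla hlb
  root := h.root
  top a ha ha0 := by rcases h.val a ha with h' | h'; omega; exact h'.2 ha0
  cover a ha ha0 := by
    by_cases h0 : T a = 0
    · obtain ⟨b, hb, h1, h2⟩ := h.todo a ha h0
      exact ⟨b, hb, by omega, by rw [h0]; exact h2.le⟩
    · exact h.cover a ha ha0 h0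
  far := hfar
  sum := hsum

/-- While the nets are built, the level function is whatever the word array 1 currently contains, so
it changes along with the memory. -/
theorem Env.setTop (h : Env w n d e M P g X D (s.word 1) s) {i v : ℕ} :
    Env w n d e M P g X D ((s.setWord 1 i v).word 1) (s.setWord 1 i v) := by
  obtain ⟨h1, h2, h3, h4, h5, h6, h7, h8, h9, h10⟩ := h
  constructor <;> simp_all

theorem holds_coverCond (hB : WordBounds w n d e M P) (hE : Env w n d e M P g X D T s)
    (ha : a < n) (hb : b < n) (h6 : s.word 0 6 = k) (h7 : s.word 0 7 = a) (h8 : s.word 0 8 = b)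
    (hk : k ≤ M) : coverCond.Holds p w s ↔ k ≤ T b ∧ 16 * D a b < 2 ^ k := by
  simp only [coverCond, BExp.Holds, RExp.eval_mul, RExp.eval_ofWord, WExp.eval_cell,
    eval_distExp hB hE ha hb h7 h8, eval_WVar hB.hw (show 8 < 64 by norm_num),
    eval_WVar hB.hw (show 6 < 64 by norm_num), h6, h8, eval_powLevel hB hk h6,
    WExp.eval_ofNat hB.hw (show 16 < 64 by norm_num), hE.T_eq b hb, not_lt]
  push_cast
  rfl

/-- The part of the memory that is not touched in the construction of the net. -/
structure NetFrame (s s' : State) : Prop where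
  word0 : ∀ j, 10 ≤ j → s'.word 0 j = s.word 0 j
  word : ∀ a, 2 ≤ a → s'.word a = s.word a
  real : s'.real = s.real
  output : s'.output = s.output

theorem NetFrame.refl (s : State) : NetFrame s s := ⟨fun _ _ => rfl, fun _ _ => rfl, rfl, rfl⟩

theorem NetFrame.trans {s'' : State} (h : NetFrame s s') (h' : NetFrame s' s'') :
    NetFrame s s'' :=
  ⟨fun j hj => (h'.word0 j hj).trans (h.word0 j hj), fun j hj => (h'.word j hj).trans (h.word j hj),
    h'.real.trans h.real, h'.output.trans h.output⟩

theorem NetFrame.setWord (h : NetFrame s s') {a i v : ℕ} (ha : a = 0 ∧ i < 10 ∨ a = 1) :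
    NetFrame s (s'.setWord a i v) := by
  refine h.trans ⟨fun j hj => ?_, fun b hb => ?_, rfl, rfl⟩
  · rw [State.word_setWord, if_neg (by omega)]
  · rw [State.word_setWord_ne _ _ _ _ _ (by omega)]

theorem run_addNetPoints (hB : WordBounds w n d e M P) (hD : IsDist D) {Q : ℕ → State → Prop}
    (hE : Env w n d e M P g X D (s.word 1) s) (h : NetInv n M D k 0 (s.word 1)) (hk : 1 ≤ k)
    (hkM : k < M) (h6 : s.word 0 6 = k)
    (hQ : ∀ τ s', τ ≤ 100 * (n * n) → Env w n d e M P g X D (s'.word 1) s' →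
      NetInv n M D k n (s'.word 1) → s'.word 0 6 = k → NetFrame s s' → Q τ s') :
    Run p w addNetPoints s Q := by
  have hw := hB.hw
  have hn := hB.n_pos
  have hnw : n < 2 ^ w := by have := hB.nn; omega
  have hV : ∀ {j : ℕ} {s : State}, j < 64 → (WVar j).eval w s = s.word 0 j := fun hj =>
    eval_WVar hw hj
  refine Run.forTo (N := n) (fun i τ s' => τ ≤ 90 * n * i + 3 ∧ s'.word 0 7 = i ∧
    s'.word 0 6 = k ∧ Env w n d e M P g X D (s'.word 1) s' ∧ NetInv n M D k i (s'.word 1) ∧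
    NetFrame s s') hw (by norm_num) hnw ?_ ?_ ?_ ?_
  · rintro i τ s' - ⟨-, h7, -, h', -⟩
    exact ⟨h7, by rw [hV (by norm_num), h'.n_eq]⟩
  · exact ⟨by simp, by simp, by simp [h6], hE.setWord (by omega), by simpa using h,
      (NetFrame.refl s).setWord (by omega)⟩
  · rintro i τ s' hi ⟨hτ, h7, h6', hE', h', hf⟩
    have hsz : (BExp.weq (.cell 1 (WVar 7)) 0).size + 1 + ((WVar 0).size + 10) ≤ 20 := by
      decide
    have hni : 90 * n * (i + 1) = 90 * n * i + 90 * n := by ring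
    refine Run.ite (fun hb => ?_) (fun hb => ?_)
    · have hTi : s'.word 1 i = 0 := by
        simpa only [BExp.Holds, WExp.eval_cell, hV (show 7 < 64 by norm_num), h7,
          WExp.eval_ofNat hw (show 0 < 64 by norm_num)] using hb
      have e1 : coverCond.size + (1 : WExp).size + 15 ≤ 46 := by decide
      have e2 := Nat.mul_le_mul_right n e1
      have e3 : (BExp.weq (WVar 9) 0).size = 4 := rfl
      have e4 : (WVar 7).size + (WVar 6).size = 4 := rfl
      refine Run.seq (Run.scan (fun b => k ≤ s'.word 1 b ∧ 16 * D i b < 2 ^ k)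
        (fun _ => 1) hw hE'.n_eq hnw ?_ ?_ fun τ₁ z hτ₁ hz => ?_)
      · intro b hb v
        refine holds_coverCond hB ((hE'.setWord (by omega)).setWord (by omega)) hi hb ?_ ?_ ?_
          hkM.le <;> simp [h6', h7]
      · intro b hb v
        exact WExp.eval_ofNat hw (by norm_num)
      set s₁ := (s'.setWord 0 9 z).setWord 0 8 n with hs₁
      have hf₁ : NetFrame s s₁ := (hf.setWord (by omega)).setWord (by omega)
      have hE₁ : Env w n d e M P g X D (s₁.word 1) s₁ := by
        have : s₁.word 1 = s'.word 1 := by simp [hs₁]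
        rw [this]
        exact (hE'.setWord (by omega)).setWord (by omega)
      have h1 : s₁.word 1 = s'.word 1 := by simp [hs₁]
      have h7₁ : s₁.word 0 7 = i := by simp [hs₁, h7]
      have h6₁ : s₁.word 0 6 = k := by simp [hs₁, h6']
      have hz' : (BExp.weq (WVar 9) 0).Holds p w s₁ ↔ z = 0 := by
        simp only [BExp.Holds, hV (show 9 < 64 by norm_num),
          WExp.eval_ofNat hw (show 0 < 64 by norm_num)]
        simp [hs₁]
      refine Run.ite (fun hb => ?_) (fun hb => ?_)
      · have hfar : ∀ b < n, ¬ (k ≤ s'.word 1 b ∧ 16 * D i b < 2 ^ k) := by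
          rcases hz with ⟨-, hz⟩ | ⟨-, -, -, hz⟩
          · exact hz
          · rw [hz'.1 hb] at hz; omega
        refine Run.wset (m := i) (v := k) (by rw [hV (by norm_num), h7₁])
          (by rw [hV (by norm_num), h6₁]) ?_
        refine ⟨by simp [h7₁], by omega, by simp, by simp [h6₁], ?_, ?_,
          (hf₁.setWord (by omega)).setWord (by omega)⟩
        · have h2 := hE₁.setTop (i := i) (v := k)
          have h3 : (((s₁.setWord 1 i k).setWord 0 7 (i + 1)).word 1) = (s₁.setWord 1 i k).word 1 := by
            simp
          rw [h3]
          exact h2.setWord (by omega)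
        · have h2 := h'.add hD hk hkM hi hTi hfar
          have h3 : (((s₁.setWord 1 i k).setWord 0 7 (i + 1)).word 1) =
              fun a => if a = i then k else s'.word 1 a := by
            funext a
            simp [h1]
          rw [h3]
          exact h2
      · refine Run.skip ⟨by simp [h7₁], by omega, by simp, by simp [h6₁], ?_, ?_,
          hf₁.setWord (by omega)⟩
        · have h3 : ((s₁.setWord 0 7 (i + 1)).word 1) = s₁.word 1 := by simp
          rw [h3]
          exact hE₁.setWord (by omega)
        · have h3 : ((s₁.setWord 0 7 (i + 1)).word 1) = s'.word 1 := by simp [h1]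
          rw [h3]
          refine ⟨h'.root, h'.val, h'.sep, h'.cover, h'.todo, fun a ha hai hTa => ?_⟩
          rcases Nat.lt_succ_iff_lt_or_eq.1 hai with hai | rfl
          · exact h'.done a ha hai hTa
          · rcases hz with ⟨hz, -⟩ | ⟨b, hb', hz, -⟩
            · exact absurd (hz'.2 hz) hb
            · exact ⟨b, hb', hz⟩
    · have hTi : s'.word 1 i ≠ 0 := by
        simpa only [BExp.Holds, WExp.eval_cell, hV (show 7 < 64 by norm_num), h7,
          WExp.eval_ofNat hw (show 0 < 64 by norm_num)] using hb
      have h3 : ((s'.setWord 0 7 (i + 1)).word 1) = s'.word 1 := by simp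
      refine Run.skip ⟨h7, by omega, by simp, by simp [h6'], ?_, ?_, hf.setWord (by omega)⟩
      · rw [h3]; exact hE'.setWord (by omega)
      · rw [h3]
        refine ⟨h'.root, h'.val, h'.sep, h'.cover, h'.todo, fun a ha hai hTa => ?_⟩
        rcases Nat.lt_succ_iff_lt_or_eq.1 hai with hai | rfl
        · exact h'.done a ha hai hTa
        · exact absurd hTa hTi
  · rintro τ s' ⟨hτ, -, h6', hE', h', hf⟩
    refine hQ _ _ ?_ hE' h' h6' hf
    have : (WVar 0).size = 2 := rfl
    have : 1 ≤ n * n := Nat.mul_pos hn hn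
    have e : 90 * n * n = 90 * (n * n) := by ring
    rw [e] at hτ
    omega

theorem run_makeNet (hB : WordBounds w n d e M P) (hD : IsDist D) {Q : ℕ → State → Prop}
    (hE : Env w n d e M P g X D (s.word 1) s)
    (hT : ∀ a, s.word 1 a = if a = 0 then M else 0)
    (hfar : ∀ a < n, ∀ b < n, a ≠ b → 1 ≤ D a b)
    (hM : ∀ a < n, ∀ b < n, 16 * D a b < 2 ^ M)
    (hsum : ∀ a < n, ∀ b < n,
      ∑ t ∈ Finset.range d, |g * (X a t - X b t)| ≤ 16 * 2 ^ e * (d * D a b))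
    (hQ : ∀ τ s', τ ≤ 200 * n * n * M → Env w n d e M P g X D (s'.word 1) s' →
      Net n d e M g X D (s'.word 1) → NetFrame s s' → Q τ s') :
    Run p w makeNet s Q := by
  have hw := hB.hw
  have hn := hB.n_pos
  have hM6 := hB.M_pos
  have hMw : M < 2 ^ w := by
    have := hB.powM
    have : M + 1 < 2 ^ (M + 1) := Nat.lt_two_pow_self
    omega
  have hV : ∀ {j : ℕ} {s : State}, j < 64 → (WVar j).eval w s = s.word 0 j := fun hj =>
    eval_WVar hw hj
  have hnn : 1 ≤ n * n := Nat.mul_pos hn hn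
  have e2 : (BExp.wlt 1 (WVar 6)).size = 4 := rfl
  -- Because 16D < 2^M throughout, the point 0 alone is a net of level M.
  have hinit : NetInv n M D (M - 1) 0 (s.word 1) := by
    refine ⟨?_, fun a ha => ?_, fun a ha b hb hab hTa hTb => ?_, fun a ha ha0 hTa => ?_,
      fun a ha hTa => ⟨0, by omega, ?_, ?_⟩, fun a ha h0 => by omega⟩
    · simp [hT]
    · rw [hT]; split_ifs with h
      · exact Or.inr ⟨by omega, fun h' => absurd h h'⟩
      · exact Or.inl rfl
    · rw [hT] at hTa hTb; split_ifs at hTa hTb <;> omega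
    · rw [hT, if_neg ha0] at hTa; omega
    · rw [hT, if_pos rfl]; omega
    · rw [show M - 1 + 1 = M by omega]; exact hM a ha 0 (by omega)
  refine Run.seq (Run.assign hw (by norm_num) (v := M) (by rw [hV (by norm_num), hE.M_eq]) ?_)
  refine Run.loop (fun m τ s' => m ≤ M - 1 ∧ τ ≤ 115 * (n * n) * (M - 1 - m) ∧
    s'.word 0 6 = m + 1 ∧ Env w n d e M P g X D (s'.word 1) s' ∧
    NetInv n M D m 0 (s'.word 1) ∧ NetFrame s s') (M - 1)
    ⟨le_rfl, by omega, by simp; omega, ?_, by simpa using hinit,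
      (NetFrame.refl s).setWord (by omega)⟩ ?_ ?_
  · have h3 : ((s.setWord 0 6 M).word 1) = s.word 1 := by simp
    rw [h3]; exact hE.setWord (by omega)
  · rintro m τ s' ⟨hm, hτ, h6, hE', h', hf⟩
    refine ⟨?_, ?_⟩
    · change (1 : WExp).eval w s' < (WVar 6).eval w s'
      rw [hV (by norm_num), h6, WExp.eval_ofNat hw (by norm_num)]
      exact Nat.succ_lt_succ (Nat.succ_pos m)
    · refine Run.seq (Run.assign hw (by norm_num) (v := m + 1) ?_ ?_)
      · rw [WExp.eval_sub_of (m := m + 2) (n := 1)]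
        · omega
        · rw [hV (by norm_num), h6]
        · exact WExp.eval_ofNat hw (by norm_num)
        · omega
        · omega
      have h3 : ((s'.setWord 0 6 (m + 1)).word 1) = s'.word 1 := by simp
      refine run_addNetPoints (k := m + 1) hB hD (by rw [h3]; exact hE'.setWord (by omega))
        (by rw [h3]; exact h') (by omega) (by omega) (by simp) ?_
      intro τ₁ s₂ hτ₁ hE₂ h₂ h6₂ hf₂
      refine ⟨by omega, ?_, h6₂, hE₂, h₂.next, (hf.setWord (by omega)).trans hf₂⟩
      have e1 : (WVar 6 - 1 : WExp).size = 4 := rfl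
      have e3 : M - 1 - m = (M - 1 - (m + 1)) + 1 := by omega
      rw [e3, Nat.mul_add (115 * (n * n))]
      omega
  · rintro τ s' ⟨-, hτ, h6, hE', h', hf⟩
    refine ⟨?_, ?_⟩
    · change ¬ (1 : WExp).eval w s' < (WVar 6).eval w s'
      rw [hV (by norm_num), h6, WExp.eval_ofNat hw (by norm_num)]
      exact lt_irrefl _
    · refine hQ _ _ ?_ hE' (h'.net hD hfar (by omega) hsum) hf
      have e1 : (WVar 4).size = 2 := rfl
      have h6 : 200 * n * n * M = 115 * (n * n) * M + 85 * (n * n * M) := by ring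
      have h7 : 1 ≤ n * n * M := Nat.mul_pos (Nat.mul_pos hn hn) (by omega)
      have h8 : 115 * (n * n) * (M - 1 - 0) ≤ 115 * (n * n) * M := Nat.mul_le_mul_left _ (by omega)
      omega

end

/-! ### Reading and writing bits -/

theorem readBits_succ (l : List Bool) (pos len : ℕ) : readBits l pos (len + 1) =
    readBits l pos len + if l.getD (pos + len) false then 2 ^ len else 0 :=
  Finset.sum_range_succ _ _

theorem readBits_lt (l : List Bool) (pos len : ℕ) : readBits l pos len < 2 ^ len := by
  induction len with
  | zero => simp [readBits]
  | succ len ih =>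
    rw [readBits_succ, pow_succ]
    split_ifs <;> omega

theorem readBits_add (l : List Bool) (pos a b : ℕ) :
    readBits l pos (a + b) = readBits l pos a + 2 ^ a * readBits l (pos + a) b := by
  induction b with
  | zero => simp [readBits]
  | succ b ih =>
    rw [← add_assoc, readBits_succ, ih, readBits_succ, mul_add, add_assoc, add_assoc pos a b,
      mul_ite, pow_add, mul_zero]

theorem readBits_append (l l' : List Bool) {pos len : ℕ} (h : pos + len ≤ l.length) :
    readBits (l ++ l') pos len = readBits l pos len := by
  refine Finset.sum_congr rfl fun t ht => ?_
  rw [Finset.mem_range] at ht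
  rw [List.getD_append _ _ _ _ (by omega)]

theorem readBits_writeBits (l : List Bool) (v len : ℕ) :
    readBits (l ++ writeBits v len) l.length len = v % 2 ^ len := by
  have h : readBits (l ++ writeBits v len) l.length len =
      ∑ t ∈ Finset.range len, if v.testBit t then 2 ^ t else 0 := by
    refine Finset.sum_congr rfl fun t ht => ?_
    rw [Finset.mem_range] at ht
    rw [List.getD_append_right _ _ _ _ (by omega), Nat.add_sub_cancel_left]
    have : (writeBits v len).getD t false = v.testBit t := by
      simp [writeBits, List.getD, ht]
    rw [this]
  rw [h]
  clear h
  induction len with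
  | zero => simp [Nat.mod_one]
  | succ len ih =>
    rw [Finset.sum_range_succ, ih, Nat.mod_pow_succ, ← Nat.toNat_testBit]
    cases v.testBit len <;> simp

theorem length_writeBits (v len : ℕ) : (writeBits v len).length = len := by simp [writeBits]

/-- The bits of `l` from `pos` to `pos + len` encode `v`. -/
def Reads (l : List Bool) (pos len v : ℕ) : Prop := pos + len ≤ l.length ∧ readBits l pos len = v

theorem Reads.append {l : List Bool} {pos len v : ℕ} (h : Reads l pos len v) (l' : List Bool) :
    Reads (l ++ l') pos len v :=
  ⟨by rw [List.length_append]; have := h.1; omega, by rw [readBits_append _ _ h.1, h.2]⟩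

theorem reads_writeBits {l : List Bool} {pos len v : ℕ} (hl : l.length = pos) (hv : v < 2 ^ len) :
    Reads (l ++ writeBits v len) pos len v := by
  subst hl
  exact ⟨by rw [List.length_append, length_writeBits],
    by rw [readBits_writeBits, Nat.mod_eq_of_lt hv]⟩

/-! ### The format of the sketch -/

/-- The position of the record `r`. -/
def recPos (P d e r : ℕ) : ℕ := 3 * P + 1 + r * (3 * P + 2 * d * (e + 5))

/-- The record `r` with parent `rp`, level `rl`, slots `sl`; the field `lf` is unrelated to the
record. -/
structure HasRecord (P d e : ℕ) (l : List Bool) (r rp rl lf : ℕ) (sl : ℕ → ℕ) : Prop where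
  parent : Reads l (recPos P d e r) P rp
  level : Reads l (recPos P d e r + P) P rl
  leaf : Reads l (recPos P d e r + 2 * P) P (lf % 2 ^ P)
  slot : ∀ u < 2 * d, Reads l (recPos P d e r + 3 * P + u * (e + 5)) (e + 5) (sl u)

/-- The width is self-delimiting: the bits of 2^P, least significant first, are P zeros followed by
a one. All other fields can be located once P is known. -/
structure HasHeader (P d e : ℕ) (l : List Bool) : Prop where
  width : Reads l 0 (P + 1) (2 ^ P)
  dim : Reads l (P + 1) P d
  prec : Reads l (2 * P + 1) P e

theorem HasRecord.append {P d e : ℕ} {l : List Bool} {r rp rl lf : ℕ} {sl : ℕ → ℕ}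
    (h : HasRecord P d e l r rp rl lf sl) (l' : List Bool) :
    HasRecord P d e (l ++ l') r rp rl lf sl :=
  ⟨h.1.append l', h.2.append l', h.3.append l', fun u hu => (h.4 u hu).append l'⟩

theorem HasHeader.append {P d e : ℕ} {l : List Bool} (h : HasHeader P d e l) (l' : List Bool) :
    HasHeader P d e (l ++ l') :=
  ⟨h.1.append l', h.2.append l', h.3.append l'⟩

def emitHeader : Prog :=
  .emit (twoPow (WVar 5)) (WVar 5 + 1) ⨾ .emit (WVar 1) (WVar 5) ⨾ .emit (WVar 3) (WVar 5)

/-- The third field of the record `r` is the index of the last record of the point `r`. Storing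
these pointers inside the records avoids a separate table, and requires that there are at least n
records. -/
def emitRecord : Prog :=
  .emit (.cell 3 (WVar 7)) (WVar 5) ⨾ .emit (.cell 4 (WVar 7)) (WVar 5) ⨾
  .emit (.cell 2 (WVar 7)) (WVar 5) ⨾
  forTo 13 (2 * WVar 1) (.emit (.cell 5 (WVar 7 * (2 * WVar 1) + WVar 13)) (WVar 3 + 5))

def emitSketch : Prog := emitHeader ⨾ forTo 7 (WVar 11) emitRecord

section
variable {p : ℝ≥0∞} {w n d e M P : ℕ} {g : ℝ} {X D : ℕ → ℕ → ℝ} {T : ℕ → ℕ} {s s' : State}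

/-- Only the output and the counters `7` and `13` differ. -/
structure EmitFrame (s s' : State) : Prop where
  word0 : ∀ j, j ≠ 7 → j ≠ 13 → s'.word 0 j = s.word 0 j
  word : ∀ a, a ≠ 0 → s'.word a = s.word a

theorem EmitFrame.setWord (h : EmitFrame s s') {j v : ℕ} (hj : j = 7 ∨ j = 13) :
    EmitFrame s (s'.setWord 0 j v) :=
  ⟨fun i h7 h13 => by rw [State.word_setWord, if_neg (by omega), h.word0 i h7 h13],
    fun a ha => by rw [State.word_setWord_ne _ _ _ _ _ ha, h.word a ha]⟩

theorem EmitFrame.emit (h : EmitFrame s s') {v len : ℕ} : EmitFrame s (s'.emit v len) := ⟨h.1, h.2⟩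

theorem run_emitHeader (hB : WordBounds w n d e M P) {Q : ℕ → State → Prop}
    (h1 : s.word 0 1 = d) (h3 : s.word 0 3 = e) (h5 : s.word 0 5 = P) (ho : s.output = [])
    (hQ : ∀ τ s', τ ≤ 50 → EmitFrame s s' → HasHeader P d e s'.output →
      s'.output.length = 3 * P + 1 → Q τ s') :
    Run p w emitHeader s Q := by
  have hw := hB.hw
  have hPw := hB.Pw
  have hP2 : 2 ^ P < 2 ^ w := Nat.pow_lt_pow_right (by norm_num) (by omega)
  have hPP : P < 2 ^ P := Nat.lt_two_pow_self
  have hV : ∀ {j : ℕ} {s : State}, j < 64 → (WVar j).eval w s = s.word 0 j := fun hj =>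
    eval_WVar hw hj
  refine Run.seq (Run.emit (v := 2 ^ P) (l := P + 1) (eval_twoPow_of hw ?_ hP2)
    (WExp.eval_add_of ?_ (WExp.eval_ofNat hw (by norm_num)) (by omega)) hPw ?_)
  · rw [hV (by norm_num), h5]
  · rw [hV (by norm_num), h5]
  refine Run.seq (Run.emit (v := d) (l := P) ?_ ?_ (by omega) ?_)
  · rw [hV (by norm_num)]; simp [h1]
  · rw [hV (by norm_num)]; simp [h5]
  refine Run.emit (v := e) (l := P) ?_ ?_ (by omega) ?_
  · rw [hV (by norm_num)]; simp [h3]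
  · rw [hV (by norm_num)]; simp [h5]
  refine hQ _ _ (by decide) ⟨fun _ _ _ => rfl, fun _ _ => rfl⟩ ⟨?_, ?_, ?_⟩ ?_
  · refine ((reads_writeBits ?_ ?_).append _).append _
    · simp [ho]
    · exact Nat.pow_lt_pow_right (by norm_num) (by omega)
  · refine (reads_writeBits ?_ hB.dP).append _
    simp [ho, length_writeBits]
  · refine reads_writeBits ?_ hB.eP
    simp [ho, length_writeBits]; omega
  · simp [ho, length_writeBits]; omega

/-- No bound is assumed for the third field, since it has no meaning unless `r` is the index of a
point; hence it is only known modulo 2^P. -/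
theorem run_emitRecord (hB : WordBounds w n d e M P) {Q : ℕ → State → Prop} {r : ℕ}
    (h1 : s.word 0 1 = d) (h3 : s.word 0 3 = e) (h5 : s.word 0 5 = P) (h7 : s.word 0 7 = r)
    (hr : r < 12 * n) (ho : s.output.length = recPos P d e r)
    (hp : s.word 3 r < 2 ^ P) (hl : s.word 4 r < 2 ^ P)
    (hs : ∀ u < 2 * d, s.word 5 (r * (2 * d) + u) < 2 ^ (e + 5))
    (hQ : ∀ τ s', τ ≤ 120 * d → EmitFrame s s' → s'.word 0 7 = r → (∃ l', s'.output = s.output ++ l') →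
      s'.output.length = recPos P d e (r + 1) →
      HasRecord P d e s'.output r (s.word 3 r) (s.word 4 r) (s.word 2 r)
        (fun u => s.word 5 (r * (2 * d) + u)) → Q τ s') :
    Run p w emitRecord s Q := by
  have hw := hB.hw
  have hd := hB.d_pos
  have hPw := hB.Pw
  have hsl := hB.slots
  have hdw : 2 * d < 2 ^ w := by omega
  have hew : e + 5 < w := (Nat.pow_lt_pow_iff_right (by norm_num)).1 hB.powe
  have hew' : e + 5 < 2 ^ w := hew.trans Nat.lt_two_pow_self
  have hV : ∀ {j : ℕ} {s : State}, j < 64 → (WVar j).eval w s = s.word 0 j := fun hj =>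
    eval_WVar hw hj
  refine Run.seq (Run.emit (v := s.word 3 r) (l := P) ?_ ?_ (by omega) ?_)
  · rw [WExp.eval_cell, hV (by norm_num), h7]
  · rw [hV (by norm_num), h5]
  refine Run.seq (Run.emit (v := s.word 4 r) (l := P) ?_ ?_ (by omega) ?_)
  · rw [WExp.eval_cell, hV (by norm_num)]; simp [h7]
  · rw [hV (by norm_num)]; simp [h5]
  refine Run.seq (Run.emit (v := s.word 2 r) (l := P) ?_ ?_ (by omega) ?_)
  · rw [WExp.eval_cell, hV (by norm_num)]; simp [h7]
  · rw [hV (by norm_num)]; simp [h5]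
  set s₁ := ((s.emit (s.word 3 r) P).emit (s.word 4 r) P).emit (s.word 2 r) P with hs₁
  have hf₁ : EmitFrame s s₁ := ⟨fun _ _ _ => rfl, fun _ _ => rfl⟩
  have hR₁ : Reads s₁.output (recPos P d e r) P (s.word 3 r) :=
    ((reads_writeBits ho hp).append _).append _
  have hR₂ : Reads s₁.output (recPos P d e r + P) P (s.word 4 r) :=
    (reads_writeBits (by simp [ho, length_writeBits]) hl).append _
  have hlen : ((s.emit (s.word 3 r) P).emit (s.word 4 r) P).output.length =
      recPos P d e r + 2 * P := by
    simp [ho, length_writeBits]; omega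
  have hR₃ : Reads s₁.output (recPos P d e r + 2 * P) P (s.word 2 r % 2 ^ P) := by
    refine ⟨?_, ?_⟩
    · rw [hs₁, State.output_emit, List.length_append, hlen, length_writeBits]
    · rw [hs₁, State.output_emit, ← hlen, readBits_writeBits]
  refine Run.forTo (N := 2 * d) (fun u τ s' => τ ≤ 40 * u + 3 ∧ s'.word 0 13 = u ∧
    EmitFrame s s' ∧ s'.word 0 7 = r ∧ (∃ l', s'.output = s₁.output ++ l') ∧
    s'.output.length = recPos P d e r + 3 * P + u * (e + 5) ∧
    ∀ v < u, Reads s'.output (recPos P d e r + 3 * P + v * (e + 5)) (e + 5)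
      (s.word 5 (r * (2 * d) + v))) hw (by norm_num) hdw ?_ ?_ ?_ ?_
  · rintro u τ s' - ⟨-, h13, hf, -⟩
    refine ⟨h13, WExp.eval_mul_of (WExp.eval_ofNat hw (by norm_num)) ?_ hdw⟩
    rw [hV (by norm_num), hf.word0 _ (by omega) (by omega), h1]
  · refine ⟨by omega, by simp, hf₁.setWord (by omega), by simp [hs₁, h7], ⟨[], by simp⟩, ?_, by simp⟩
    simp [hs₁, ho, length_writeBits]; omega
  · rintro u τ s' hu ⟨hτ, h13, hf, h7', ⟨l', hl'⟩, hlen', hR⟩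
    refine Run.emit (v := s.word 5 (r * (2 * d) + u)) (l := e + 5) ?_ ?_ hew.le ?_
    · have h3d : 2 * d ≤ 12 * n * (2 * d) :=
        Nat.le_mul_of_pos_left _ (by have := hB.n_pos; omega)
      rw [WExp.eval_cell, WExp.eval_madd_of (l := r) (m := 2 * d) (n := u),
        hf.word _ (by omega)]
      · rw [hV (by norm_num), h7']
      · refine WExp.eval_mul_of (WExp.eval_ofNat hw (by norm_num)) ?_ hdw
        rw [hV (by norm_num), hf.word0 _ (by omega) (by omega), h1]
      · rw [hV (by norm_num), h13]
      · have := idx_lt hr hu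
        omega
    · refine WExp.eval_add_of ?_ (WExp.eval_ofNat hw (by norm_num)) hew'
      rw [hV (by norm_num), hf.word0 _ (by omega) (by omega), h3]
    · refine ⟨by simp [h13], ?_, by simp, hf.emit.setWord (by omega), by simp [h7'], ?_, ?_, ?_⟩
      · have : (WExp.cell 5 (WVar 7 * (2 * WVar 1) + WVar 13)).size + (WVar 3 + 5 : WExp).size + 1 +
          ((2 * WVar 1 : WExp).size + 10) ≤ 40 := by decide
        omega
      · refine ⟨l' ++ writeBits (s.word 5 (r * (2 * d) + u)) (e + 5), ?_⟩
        rw [State.output_setWord, State.output_emit, hl', List.append_assoc]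
      · simp [hlen', length_writeBits]; ring
      · intro v hv
        rcases Nat.lt_succ_iff_lt_or_eq.1 hv with hv | rfl
        · exact (hR v hv).append _
        · exact reads_writeBits hlen' (hs v hu)
  · rintro τ s' ⟨hτ, -, hf, h7', ⟨l', hl'⟩, hlen', hR⟩
    refine hQ _ _ ?_ hf h7' ⟨writeBits (s.word 3 r) P ++ writeBits (s.word 4 r) P ++
      writeBits (s.word 2 r) P ++ l', ?_⟩ ?_ ⟨?_, ?_, ?_, hR⟩
    · have e1 : (WExp.cell 3 (WVar 7)).size + (WVar 5).size + 1 +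
        ((WExp.cell 4 (WVar 7)).size + (WVar 5).size + 1 +
        ((WExp.cell 2 (WVar 7)).size + (WVar 5).size + 1)) ≤ 18 := by decide
      have e2 : (2 * WVar 1 : WExp).size = 4 := rfl
      omega
    · rw [hl', hs₁]; simp
    · rw [hlen']; unfold recPos; ring
    · rw [hl']; exact hR₁.append _
    · rw [hl']; exact hR₂.append _
    · rw [hl']; exact hR₃.append _

theorem run_emitSketch (hB : WordBounds w n d e M P) {Q : ℕ → State → Prop} {c : ℕ}
    (h1 : s.word 0 1 = d) (h3 : s.word 0 3 = e) (h5 : s.word 0 5 = P) (h11 : s.word 0 11 = c)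
    (hc : c ≤ 12 * n) (ho : s.output = [])
    (hp : ∀ r < c, s.word 3 r < 2 ^ P) (hl : ∀ r < c, s.word 4 r < 2 ^ P)
    (hs : ∀ r < c, ∀ u < 2 * d, s.word 5 (r * (2 * d) + u) < 2 ^ (e + 5))
    (hQ : ∀ τ s', τ ≤ 1900 * n * d → HasHeader P d e s'.output →
      s'.output.length = recPos P d e c →
      (∀ r < c, HasRecord P d e s'.output r (s.word 3 r) (s.word 4 r) (s.word 2 r)
        (fun u => s.word 5 (r * (2 * d) + u))) → Q τ s') :
    Run p w emitSketch s Q := by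
  have hw := hB.hw
  have hn := hB.n_pos
  have hd := hB.d_pos
  have hcw : c < 2 ^ w := by
    have := hB.slots
    have : 12 * n ≤ 12 * n * (2 * d) := Nat.le_mul_of_pos_right _ (by omega)
    omega
  refine Run.seq (run_emitHeader hB h1 h3 h5 ho fun τ₁ s₁ hτ₁ hf₁ hH hlen₁ => ?_)
  refine Run.forTo (N := c) (fun r τ s' => τ ≤ 140 * d * r + 3 ∧ s'.word 0 7 = r ∧
    EmitFrame s s' ∧ HasHeader P d e s'.output ∧ s'.output.length = recPos P d e r ∧
    ∀ r' < r, HasRecord P d e s'.output r' (s.word 3 r') (s.word 4 r') (s.word 2 r')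
        (fun u => s.word 5 (r' * (2 * d) + u))) hw (by norm_num) hcw ?_ ?_ ?_ ?_
  · rintro r τ s' - ⟨-, h7, hf, -⟩
    exact ⟨h7, by rw [eval_WVar hw (by norm_num), hf.word0 _ (by omega) (by omega), h11]⟩
  · refine ⟨by omega, by simp, hf₁.setWord (by omega), hH, ?_, by simp⟩
    simp [hlen₁, recPos]
  · rintro r τ s' hr ⟨hτ, h7, hf, hH', hlen, hrec⟩
    have hw3 := hf.word 3 (by omega)
    have hw4 := hf.word 4 (by omega)
    have hw5 := hf.word 5 (by omega)
    refine run_emitRecord hB (by rw [hf.word0 _ (by omega) (by omega), h1])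
      (by rw [hf.word0 _ (by omega) (by omega), h3])
      (by rw [hf.word0 _ (by omega) (by omega), h5]) h7 (by omega) hlen
      (by rw [hw3]; exact hp r hr) (by rw [hw4]; exact hl r hr) (by rw [hw5]; exact hs r hr) ?_
    rintro τ' s'' hτ' hf' h7' ⟨l', hl'⟩ hlen' hrec'
    refine ⟨h7', ?_, by simp, ?_, ?_, hlen', ?_⟩
    · have : (WVar 11).size = 2 := rfl
      have e1 : 140 * d * (r + 1) = 140 * d * r + 140 * d := by ring
      omega
    · refine EmitFrame.setWord ⟨fun j h h' => ?_, fun a ha => ?_⟩ (by omega)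
      · rw [hf'.word0 j h h', hf.word0 j h h']
      · rw [hf'.word a ha, hf.word a ha]
    · rw [State.output_setWord, hl']; exact hH'.append _
    · intro r' hr'
      rcases Nat.lt_succ_iff_lt_or_eq.1 hr' with hr' | rfl
      · rw [State.output_setWord, hl']; exact (hrec r' hr').append _
      · rw [hw3, hw4, hf.word 2 (by omega), hw5] at hrec'
        exact hrec'
  · rintro τ s' ⟨hτ, -, hf, hH', hlen, hrec⟩
    refine hQ _ _ ?_ hH' hlen hrec
    have e1 : (WVar 11).size = 2 := rfl
    have e2 := Nat.mul_le_mul_left (140 * d) hc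
    have e3 : 140 * d * (12 * n) = 1680 * (n * d) := by ring
    have e4 : 1 ≤ n * d := Nat.mul_pos hn hd
    have e5 : 1900 * n * d = 1900 * (n * d) := by ring
    omega

end

/-! ### Computing a norm -/

open Classical in
/-- Updates the real cell `(4, 0)` with the next term. -/
noncomputable def normStep (p : ℝ≥0∞) (elem : RExp) : Prog :=
  if p = ⊤ then
    .rset 4 1 elem ⨾
    .ite (.rlt (.cell 4 1) (.ofWord 0)) (.rset 4 1 (.ofWord 0 - .cell 4 1)) .skip ⨾
    .ite (.rlt (.cell 4 0) (.cell 4 1)) (.rset 4 0 (.cell 4 1)) .skip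
  else .rset 4 0 (.cell 4 0 + .pow elem)

noncomputable def normProg (p : ℝ≥0∞) (bnd : WExp) (elem : RExp) : Prog :=
  .rset 4 0 (.ofWord 0) ⨾ forTo 12 bnd (normStep p elem)

open Classical in
noncomputable def normVal (p : ℝ≥0∞) : RExp := if p = ⊤ then .cell 4 0 else .root (.cell 4 0)

/-- The content of the accumulator after `t` terms. -/
def NormAcc (p : ℝ≥0∞) (f : ℕ → ℝ) (t : ℕ) (A : ℝ) : Prop :=
  if p = ⊤ then 0 ≤ A ∧ (∀ i < t, |f i| ≤ A) ∧ (A = 0 ∨ ∃ i < t, A = |f i|)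
  else A = ∑ i ∈ Finset.range t, |f i| ^ p.toReal

section norm
variable {p : ℝ≥0∞} {w : ℕ} {s : State}

theorem size_normVal_le : (normVal p).size ≤ 3 := by
  unfold normVal; split_ifs <;> decide

theorem eval_normVal [Fact (1 ≤ p)] {d : ℕ} {f : ℕ → ℝ} {A : ℝ} (hw : 64 ≤ 2 ^ w) (hd : 1 ≤ d)
    (h : NormAcc p f d A) (hA : s.real 4 0 = A) : (normVal p).eval p w s = lpn p d f := by
  have h0 : (0 : WExp).eval w s = 0 := WExp.eval_ofNat hw (by norm_num)
  unfold normVal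
  by_cases hp : p = ⊤
  · subst hp
    rw [if_pos rfl, RExp.eval_cell, h0, hA, lpn_top]
    simp only [NormAcc, if_true] at h
    obtain ⟨h1, h2, h3⟩ := h
    have : Nonempty (Fin d) := ⟨⟨0, hd⟩⟩
    have hb : BddAbove (Set.range fun t : Fin d => |f t|) := (Set.finite_range _).bddAbove
    refine le_antisymm ?_ (ciSup_le fun t : Fin d => h2 t t.2)
    rcases h3 with h3 | ⟨i, hi, h3⟩
    · rw [h3]
      exact (abs_nonneg _).trans (le_ciSup hb ⟨0, hd⟩)
    · rw [h3]
      exact le_ciSup hb ⟨i, hi⟩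
  · rw [if_neg hp, lpn_eq_sum p d f hp]
    simp only [NormAcc, if_neg hp] at h
    change |(RExp.cell 4 0).eval p w s| ^ (p.toReal)⁻¹ = _
    rw [RExp.eval_cell, h0, hA, h, abs_of_nonneg]
    exact Finset.sum_nonneg fun _ _ => by positivity

/-- The memory in the course of the computation of a norm. -/
def normState (s : State) (A v : ℝ) (t : ℕ) : State :=
  ((s.setReal 4 0 A).setReal 4 1 v).setWord 0 12 t

theorem run_normStep {elem : RExp} {f : ℕ → ℝ} {A v : ℝ} {t : ℕ} {Q : ℕ → State → Prop}
    (hw : 64 ≤ 2 ^ w) (hA : NormAcc p f t A)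
    (he : elem.eval p w (normState s A v t) = f t)
    (hQ : ∀ τ A' v', τ ≤ elem.size + 60 → NormAcc p f (t + 1) A' → Q τ (normState s A' v' t)) :
    Run p w (normStep p elem) (normState s A v t) Q := by
  have h0 : ∀ s : State, (0 : WExp).eval w s = 0 := fun s => WExp.eval_ofNat hw (by norm_num)
  have h1 : ∀ s : State, (1 : WExp).eval w s = 1 := fun s => WExp.eval_ofNat hw (by norm_num)
  have hset0 : ∀ A v x, (normState s A v t).setReal 4 0 x = normState s x v t := fun A v x => by
    apply State.ext' <;> intros <;> simp [normState, State.real_setReal, State.word_setWord]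
    grind
  have hset1 : ∀ A v x, (normState s A v t).setReal 4 1 x = normState s A x t := fun A v x => by
    apply State.ext' <;> intros <;> simp [normState, State.real_setReal, State.word_setWord]
    grind
  have hr0 : ∀ A v, (normState s A v t).real 4 0 = A := fun A v => by simp [normState]
  have hr1 : ∀ A v, (normState s A v t).real 4 1 = v := fun A v => by simp [normState]
  unfold normStep
  by_cases hp : p = ⊤
  · rw [if_pos hp]
    simp only [NormAcc, if_pos hp] at hA hQ
    have z0 : (0 : WExp).size = 1 := rfl
    have z1 : (1 : WExp).size = 1 := rfl
    have z2 : (BExp.rlt (.cell 4 1) (.ofWord 0)).size = 5 := rfl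
    have z3 : (BExp.rlt (.cell 4 0) (.cell 4 1)).size = 5 := rfl
    have z4 : (.ofWord 0 - .cell 4 1 : RExp).size = 5 := rfl
    have z5 : (RExp.cell 4 1).size = 2 := rfl
    -- Once the absolute value of the new term is in the cell (4, 1), updating the maximum is the
    -- same for both signs.
    have key : ∀ τ, τ ≤ elem.size + 30 →
        Run p w (.ite (.rlt (.cell 4 0) (.cell 4 1)) (.rset 4 0 (.cell 4 1)) .skip)
          (normState s A |f t| t) fun t' s' => Q (τ + t') s' := by
      intro τ hτ
      refine Run.ite (fun hb => ?_) (fun hb => ?_)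
      · refine Run.rset (h0 _) (by rw [RExp.eval_cell, h1, hr1]) ?_
        simp only [BExp.Holds, RExp.eval_cell, h0, h1, hr0, hr1] at hb
        rw [hset0]
        refine hQ _ _ _ (by omega) ⟨abs_nonneg _, fun i hi => ?_, Or.inr ⟨t, by omega, rfl⟩⟩
        rcases Nat.lt_succ_iff_lt_or_eq.1 hi with hi | rfl
        · exact (hA.2.1 i hi).trans hb.le
        · exact le_rfl
      · simp only [BExp.Holds, RExp.eval_cell, h0, h1, hr0, hr1, not_lt] at hb
        refine Run.skip (hQ _ _ _ (by omega) ⟨hA.1, fun i hi => ?_, ?_⟩)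
        · rcases Nat.lt_succ_iff_lt_or_eq.1 hi with hi | rfl
          · exact hA.2.1 i hi
          · exact hb
        · exact hA.2.2.imp_right fun ⟨i, hi, h⟩ => ⟨i, by omega, h⟩
    refine Run.seq (Run.rset (h1 _) he ?_)
    rw [hset1]
    refine Run.seq (Run.ite (fun hb => ?_) (fun hb => ?_))
    · simp only [BExp.Holds, RExp.eval_cell, RExp.eval_ofWord, h0, h1, hr1, Nat.cast_zero] at hb
      refine Run.rset (h1 _) (v := |f t|) ?_ ?_
      · rw [RExp.eval_sub, RExp.eval_cell, RExp.eval_ofWord, h0, h1, hr1, abs_of_neg hb]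
        simp
      · rw [hset1]
        exact (key ((1 : WExp).size + elem.size + 1 + (5 + (1 + 5 + 1) + 1)) (by omega)).mono
          fun t' s' h => by rwa [add_assoc] at h
    · simp only [BExp.Holds, RExp.eval_cell, RExp.eval_ofWord, h0, h1, hr1, Nat.cast_zero,
        not_lt] at hb
      refine Run.skip ?_
      have := key ((1 : WExp).size + elem.size + 1 + (5 + 1 + 1)) (by omega)
      rw [abs_of_nonneg hb] at this
      exact this.mono fun t' s' h => by rwa [add_assoc] at h
  · rw [if_neg hp]
    simp only [NormAcc, if_neg hp] at hA hQ
    refine Run.rset (h0 _) (v := A + |f t| ^ p.toReal) ?_ ?_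
    · rw [RExp.eval_add, RExp.eval_cell, h0, hr0]
      change _ + |elem.eval p w _| ^ _ = _
      rw [he]
    · rw [hset0]
      refine hQ _ _ _ ?_ ?_
      · have : (.cell 4 0 + .pow elem : RExp).size = elem.size + 4 := by
          change 2 + (elem.size + 1) + 1 = _; omega
        have : (0 : WExp).size = 1 := rfl
        omega
      · rw [hA, Finset.sum_range_succ]

theorem run_normProg {bnd : WExp} {elem : RExp} {f : ℕ → ℝ} {d : ℕ} {Q : ℕ → State → Prop}
    (hw : 64 ≤ 2 ^ w) (hd : d < 2 ^ w)
    (hb : ∀ A v t, bnd.eval w (normState s A v t) = d)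
    (he : ∀ A v, ∀ t < d, elem.eval p w (normState s A v t) = f t)
    (hQ : ∀ τ A v, τ ≤ (elem.size + bnd.size + 70) * d + bnd.size + 20 → NormAcc p f d A →
      Q τ (normState s A v d)) :
    Run p w (normProg p bnd elem) s Q := by
  have h0 : ∀ s : State, (0 : WExp).eval w s = 0 := fun s => WExp.eval_ofNat hw (by norm_num)
  refine Run.seq (Run.rset (h0 _) (v := 0) (by rw [RExp.eval_ofWord, h0]; simp) ?_)
  refine Run.forTo (N := d) (fun t τ s' => τ ≤ (elem.size + bnd.size + 70) * t + 3 ∧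
    ∃ A v, NormAcc p f t A ∧ s' = normState s A v t) hw (by norm_num) hd ?_ ?_ ?_ ?_
  · rintro t τ s' - ⟨-, A, v, -, rfl⟩
    exact ⟨by simp [normState], hb A v t⟩
  · refine ⟨by omega, 0, s.real 4 1, ?_, ?_⟩
    · unfold NormAcc; split_ifs <;> simp
    · apply State.ext' <;> intros <;> simp [normState, State.real_setReal, State.word_setWord]
      grind
  · rintro t τ s' ht ⟨hτ, A, v, hA, rfl⟩
    refine run_normStep hw hA (he A v t ht) fun τ' A' v' hτ' hA' => ⟨by simp [normState], ?_, A', v',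
      hA', ?_⟩
    · rw [Nat.mul_succ]; omega
    · apply State.ext' <;> intros <;> simp [normState, State.word_setWord]
      grind
  · rintro τ s' ⟨hτ, A, v, hA, rfl⟩
    refine hQ _ _ _ ?_ hA
    have : (0 : WExp).size + (RExp.ofWord 0).size = 3 := rfl
    omega

end norm

/-! ### The estimation program -/

/-- The position of the record with index `7`. -/
def recPosExp : WExp := 3 * WVar 3 + 1 + WVar 7 * WVar 6

def readHeader : Prog :=
  assign 3 (.bits 0 (WVar 2)) ⨾ assign 3 (.log2 (.op .xor (WVar 3) (WVar 3 - 1))) ⨾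
  assign 4 (.bits (WVar 3 + 1) (WVar 3)) ⨾ assign 5 (.bits (2 * WVar 3 + 1) (WVar 3)) ⨾
  assign 6 (3 * WVar 3 + 2 * WVar 4 * (WVar 5 + 5))

def slotExp : RExp := (.ofWord (WVar 14 / 2) - .ofWord (twoPow (WVar 5 + 2))) *
  .ofWord (twoPow (WVar 9))

def readSlot (o : ROp) : Prog :=
  assign 14 (.bits (WVar 8 + 3 * WVar 3 + WVar 13 * (WVar 5 + 5)) (WVar 5 + 5)) ⨾
  .rset 1 (WVar 12) (.op o (.cell 1 (WVar 12)) slotExp) ⨾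
  assign 12 (WVar 12 + WVar 14 % 2)

def readRecord (o : ROp) : Prog :=
  assign 8 recPosExp ⨾ assign 9 (.bits (WVar 8 + WVar 3) (WVar 3)) ⨾ assign 12 0 ⨾
  forTo 13 (2 * WVar 4) (readSlot o) ⨾ assign 7 (.bits (WVar 8) (WVar 3))

/-- Adds or subtracts the position of the point `i`, a scalar variable, to the real array `1`. -/
def walk (i : ℕ) (o : ROp) : Prog :=
  assign 7 (WVar i) ⨾ assign 7 (.bits (recPosExp + 2 * WVar 3) (WVar 3)) ⨾
  .loop (.not (.weq (WVar 7) 0)) (readRecord o)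

noncomputable def estimator (p : ℝ≥0∞) : Prog :=
  readHeader ⨾ walk 0 .add ⨾ walk 1 .sub ⨾ normProg p (WVar 4) (.cell 1 (WVar 12)) ⨾
  .rset 0 0 (normVal p / (.ofWord 16 * .ofWord (twoPow (WVar 5)) * .root (.ofWord (WVar 4))))

/-! ### Correctness of the estimation program -/

section
variable {p : ℝ≥0∞} {w n d e M P : ℕ} {s s' : State} {Q : ℕ → State → Prop}

/-- Subtracting 1 flips the lowest set bit and everything below it, so the exclusive or is 2^(P+1) -
1. This recovers P in a constant number of word operations. -/
theorem log_xor_pred {P q : ℕ} :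
    Nat.log 2 (2 ^ P * (2 * q + 1) ^^^ (2 ^ P * (2 * q + 1) - 1)) = P := by
  have hP : 0 < 2 ^ P := by positivity
  have h : 2 ^ P * (2 * q + 1) ^^^ (2 ^ P * (2 * q + 1) - 1) = 2 ^ (P + 1) - 1 := by
    have h1 : 2 ^ P * (2 * q + 1) - 1 = 2 ^ P * (2 * q) + (2 ^ P - 1) := by
      rw [mul_add, mul_one]; omega
    have h2 : 2 ^ P * (2 * q + 1) = 2 ^ P * (2 * q + 1) + 0 := rfl
    apply Nat.eq_of_testBit_eq
    intro i
    rw [Nat.testBit_xor, h1, h2, Nat.testBit_two_pow_mul_add _ hP,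
      Nat.testBit_two_pow_mul_add _ (by omega), Nat.testBit_two_pow_sub_one, Nat.testBit_two_pow_sub_one]
    rcases lt_trichotomy i P with h | rfl | h
    · simp [h, h.trans (Nat.lt_succ_self P)]
    · simp [Nat.testBit_zero]
    · obtain ⟨j, rfl⟩ : ∃ j, i = P + (j + 1) := ⟨i - P - 1, by omega⟩
      simp [Nat.testBit_succ, show (2 * q + 1) / 2 = q by omega]
  rw [h]
  refine Nat.log_eq_of_pow_le_of_lt_pow ?_ ?_
  · rw [pow_succ]; omega
  · rw [pow_succ]; omega

/-- The state of the estimation program after the header has been read. -/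
structure EstEnv (w d e P i j : ℕ) (l : List Bool) (s : State) : Prop where
  i_eq : s.word 0 0 = i
  j_eq : s.word 0 1 = j
  P_eq : s.word 0 3 = P
  d_eq : s.word 0 4 = d
  e_eq : s.word 0 5 = e
  R_eq : s.word 0 6 = 3 * P + 2 * d * (e + 5)
  input_eq : s.input = l

theorem EstEnv.setWord {i j : ℕ} {l : List Bool} (h : EstEnv w d e P i j l s) {k v : ℕ}
    (hk : 7 ≤ k) : EstEnv w d e P i j l (s.setWord 0 k v) := by
  obtain ⟨h1, h2, h3, h4, h5, h6, h7⟩ := h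
  constructor <;> first | (rw [State.word_setWord, if_neg (by omega)]; assumption) | assumption

theorem EstEnv.setReal {i j : ℕ} {l : List Bool} (h : EstEnv w d e P i j l s) {a k : ℕ} {v : ℝ} :
    EstEnv w d e P i j l (s.setReal a k v) :=
  ⟨h.1, h.2, h.3, h.4, h.5, h.6, h.7⟩

theorem eval_bits {pos len v : ℕ} {l : List Bool} {e f : WExp} (hs : s.input = l)
    (he : e.eval w s = pos) (hf : f.eval w s = len) (hlen : len ≤ w) (h : Reads l pos len v) :
    (WExp.bits e f).eval w s = v := by
  change readBits s.input (e.eval w s) (min (f.eval w s) w) = v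
  rw [hs, he, hf, min_eq_left hlen, h.2]

theorem run_readHeader (hB : WordBounds w n d e M P) {l : List Bool} {i j : ℕ}
    (h2 : s.word 0 2 = w) (h0 : s.word 0 0 = i) (h1 : s.word 0 1 = j)
    (hl : s.input = l) (hH : HasHeader P d e l)
    (hQ : ∀ τ s', τ ≤ 60 → EstEnv w d e P i j l s' → s'.real = s.real → Q τ s') :
    Run p w readHeader s Q := by
  have hw := hB.hw
  have hPw := hB.Pw
  have hout := hB.out
  have hP2 : P < 2 ^ w := lt_of_lt_of_le (by omega : P < w) Nat.lt_two_pow_self.le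
  have hV : ∀ {j : ℕ} {s : State}, j < 64 → (WVar j).eval w s = s.word 0 j := fun hj =>
    eval_WVar hw hj
  have hdw : 3 * P + 2 * d * (e + 5) < 2 ^ w := by
    have : 3 * P + 2 * d * (e + 5) ≤ 12 * n * (3 * P + 2 * d * (e + 5)) :=
      Nat.le_mul_of_pos_left _ (by have := hB.n_pos; omega)
    omega
  have hd2 : 2 * d ≤ 2 * d * (e + 5) := Nat.le_mul_of_pos_right _ (by omega)
  have he2 : e + 5 ≤ 2 * d * (e + 5) := Nat.le_mul_of_pos_left _ (by have := hB.d_pos; omega)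
  -- The first w bits begin with P zeros and a one; whatever follows only affects the odd factor.
  obtain ⟨q, hq⟩ : ∃ q, readBits l 0 w = 2 ^ P * (2 * q + 1) := by
    obtain ⟨b, rfl⟩ : ∃ b, w = P + 1 + b := ⟨w - (P + 1), by omega⟩
    refine ⟨readBits l (0 + (P + 1)) b, ?_⟩
    rw [readBits_add, hH.width.2, pow_succ]; ring
  have hqw : 2 ^ P * (2 * q + 1) < 2 ^ w := hq ▸ readBits_lt l 0 w
  refine Run.seq (Run.assign hw (by norm_num) (v := 2 ^ P * (2 * q + 1)) ?_ ?_)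
  · rw [← hq]
    change readBits s.input ((0 : WExp).eval w s) (min ((WVar 2).eval w s) w) = _
    rw [WExp.eval_ofNat hw (by norm_num), hV (by norm_num), h2, min_self, hl]
  refine Run.seq (Run.assign hw (by norm_num) (v := P) ?_ ?_)
  · have e1 : ∀ s : State, s.word 0 3 = 2 ^ P * (2 * q + 1) →
        (WExp.op .xor (WVar 3) (WVar 3 - 1)).eval w s =
          2 ^ P * (2 * q + 1) ^^^ (2 ^ P * (2 * q + 1) - 1) := by
      intro s hs
      change (WVar 3).eval w s ^^^ (WVar 3 - 1 : WExp).eval w s = _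
      rw [WExp.eval_sub_of (m := 2 ^ P * (2 * q + 1)) (n := 1) _
        (WExp.eval_ofNat hw (by norm_num)) (Nat.mul_pos (by positivity) (by omega)) hqw,
        hV (by norm_num), hs]
      rw [hV (by norm_num), hs]
    rw [WExp.eval_log2, e1 _ (by simp), log_xor_pred]
  refine Run.seq (Run.assign hw (by norm_num) (v := d) (eval_bits (by simpa using hl)
    (WExp.eval_add_of (m := P) (n := 1) ?_ (WExp.eval_ofNat hw (by norm_num)) (by omega)) ?_ (by omega)
    hH.dim) ?_)
  · rw [hV (by norm_num)]; simp
  · rw [hV (by norm_num)]; simp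
  refine Run.seq (Run.assign hw (by norm_num) (v := e) (eval_bits (by simpa using hl)
    (WExp.eval_madd_of (l := 2) (m := P) (n := 1) (WExp.eval_ofNat hw (by norm_num)) ?_
      (WExp.eval_ofNat hw (by norm_num)) (by omega)) ?_ (by omega) hH.prec) ?_)
  · rw [hV (by norm_num)]; simp
  · rw [hV (by norm_num)]; simp
  refine Run.assign hw (by norm_num) (v := 3 * P + 2 * d * (e + 5)) (WExp.eval_madd_of
    (WExp.eval_ofNat hw (by norm_num)) ?_ (WExp.eval_mul_of (WExp.eval_mul_of
    (WExp.eval_ofNat hw (by norm_num)) ?_ (by omega)) (WExp.eval_add_of ?_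
    (WExp.eval_ofNat hw (by norm_num)) (by omega)) (by omega)) (by omega)) ?_
  · rw [hV (by norm_num)]; simp
  · rw [hV (by norm_num)]; simp
  · rw [hV (by norm_num)]; simp
  · refine hQ _ _ (by decide) ?_ rfl
    constructor <;> simp [h0, h1, hl]

theorem size_readSlot (o : ROp) : (WExp.bits (WVar 8 + 3 * WVar 3 + WVar 13 * (WVar 5 + 5))
    (WVar 5 + 5)).size + 2 + ((WVar 12).size + (RExp.op o (.cell 1 (WVar 12)) slotExp).size + 1 +
    ((WVar 12 + WVar 14 % 2 : WExp).size + 2)) ≤ 70 := by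
  cases o <;> decide

variable {i j r rp rl lf c : ℕ} {l : List Bool} {sl : ℕ → ℕ} {o : ROp} {σ : ℝ}

theorem recPos_lt (hB : WordBounds w n d e M P) (hr : r < 12 * n) :
    recPos P d e r + (3 * P + 2 * d * (e + 5)) < 2 ^ w := by
  have h1 := hB.out
  have h2 := Nat.mul_le_mul_right (3 * P + 2 * d * (e + 5)) (show r + 1 ≤ 12 * n from hr)
  unfold recPos
  rw [Nat.succ_mul] at h2
  omega

theorem eval_recPosExp (hB : WordBounds w n d e M P) (hE : EstEnv w d e P i j l s)
    (h7 : s.word 0 7 = r) (hr : r < 12 * n) : recPosExp.eval w s = recPos P d e r := by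
  have hw := hB.hw
  have h := recPos_lt hB hr
  unfold recPos at h
  refine WExp.eval_add_of (m := 3 * P + 1) (WExp.eval_madd_of (n := 1)
    (WExp.eval_ofNat hw (by norm_num)) ?_ (WExp.eval_ofNat hw (by norm_num)) (by omega))
    (WExp.eval_mul_of ?_ ?_ (by omega)) (by omega)
  · rw [eval_WVar hw (by norm_num), hE.P_eq]
  · rw [eval_WVar hw (by norm_num), h7]
  · rw [eval_WVar hw (by norm_num), hE.R_eq]

theorem Reads.lt {pos len v : ℕ} (h : Reads l pos len v) : v < 2 ^ len :=
  h.2 ▸ readBits_lt l pos len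

theorem run_readRecord (hB : WordBounds w n d e M P) {f : ℕ → ℝ}
    (ho : ∀ x y, o.eval x y = x + σ * y) (hE : EstEnv w d e P i j l s) (h7 : s.word 0 7 = r)
    (hr : r < 12 * n) (hR : HasRecord P d e l r rp rl lf sl) (hrl : rl ≤ M)
    (hf : ∀ t, s.real 1 t = f t)
    (hQ : ∀ τ s', τ ≤ 230 * d → EstEnv w d e P i j l s' → s'.word 0 7 = rp →
      (∀ t, s'.real 1 t = f t + σ * (2 ^ rl * slotSum sl (2 ^ (e + 2)) (2 * d) t)) → Q τ s') :
    Run p w (readRecord o) s Q := by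
  have hw := hB.hw
  have hd := hB.d_pos
  have hPw := hB.Pw
  have hpos := recPos_lt hB hr
  have hdd := hB.slots
  have hV : ∀ {j : ℕ} {s : State}, j < 64 → (WVar j).eval w s = s.word 0 j := fun hj =>
    eval_WVar hw hj
  have hL : ∀ {k : ℕ} {s : State}, k < 64 → WExp.eval w s (OfNat.ofNat k) = k := fun hk =>
    WExp.eval_ofNat hw hk
  have hew : e + 5 < w := (Nat.pow_lt_pow_iff_right (by norm_num)).1 hB.powe
  have hew' : e + 5 < 2 ^ w := hew.trans Nat.lt_two_pow_self
  have hrlw : 2 ^ rl < 2 ^ w := lt_of_le_of_lt (Nat.pow_le_pow_right (by norm_num) (by omega)) hB.powM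
  have hbw : 2 ^ (e + 2) < 2 ^ w :=
    lt_of_le_of_lt (Nat.pow_le_pow_right (by norm_num) (by omega)) hB.powe
  refine Run.seq (Run.assign hw (by norm_num) (eval_recPosExp hB hE h7 hr) ?_)
  refine Run.seq (Run.assign hw (by norm_num) (v := rl) (eval_bits (by simp [hE.input_eq])
    (WExp.eval_add_of (m := recPos P d e r) (n := P) ?_ ?_ (by omega)) ?_ (by omega) hR.level) ?_)
  · rw [hV (by norm_num)]; simp
  · rw [hV (by norm_num)]; simp [hE.P_eq]
  · rw [hV (by norm_num)]; simp [hE.P_eq]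
  refine Run.seq (Run.assign hw (by norm_num) (v := 0) (hL (by norm_num)) ?_)
  refine Run.seq (Run.forTo (N := 2 * d) (fun u τ s' => τ ≤ 90 * u + 3 ∧ s'.word 0 13 = u ∧
    EstEnv w d e P i j l s' ∧ s'.word 0 8 = recPos P d e r ∧ s'.word 0 9 = rl ∧
    s'.word 0 12 = slotPos sl u ∧
    ∀ t, s'.real 1 t = f t + σ * (2 ^ rl * slotSum sl (2 ^ (e + 2)) u t)) hw (by norm_num)
    (by omega) ?_ ?_ ?_ ?_)
  · rintro u τ s' - ⟨-, h13, hE', -⟩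
    refine ⟨h13, WExp.eval_mul_of (hL (by norm_num)) ?_ (by omega)⟩
    rw [hV (by norm_num), hE'.d_eq]
  · refine ⟨le_rfl, by simp, (((hE.setWord (by omega)).setWord (by omega)).setWord
      (by omega)).setWord (by omega), by simp, by simp, by simp [slotPos], ?_⟩
    simp [slotSum, hf]
  · rintro u τ s' hu ⟨hτ, h13, hE', h8, h9, h12, hf'⟩
    have hu' : u * (e + 5) + (e + 5) ≤ 2 * d * (e + 5) := by
      rw [← Nat.succ_mul]; exact Nat.mul_le_mul_right _ hu
    have hslot : sl u < 2 ^ (e + 5) := (hR.slot u hu).lt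
    -- Keeps the coordinate counter within a word without any knowledge of how the slots were
    -- filled.
    have hpu : slotPos sl u ≤ u := by
      have : slotPos sl u ≤ ∑ v ∈ Finset.range u, 1 :=
        Finset.sum_le_sum fun v _ => Nat.le_of_lt_succ (Nat.mod_lt _ (by norm_num))
      simpa using this
    refine Run.seq (Run.assign hw (by norm_num) (v := sl u) (eval_bits hE'.input_eq
      (WExp.eval_add_of (m := recPos P d e r + 3 * P) (n := u * (e + 5)) (WExp.eval_add_of ?_
        (WExp.eval_mul_of (hL (by norm_num)) ?_ (by omega)) (by omega)) (WExp.eval_mul_of ?_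
        (WExp.eval_add_of ?_ (hL (by norm_num)) hew') (by omega)) (by omega))
      (WExp.eval_add_of ?_ (hL (by norm_num)) hew') hew.le (hR.slot u hu)) ?_)
    · rw [hV (by norm_num), h8]
    · rw [hV (by norm_num), hE'.P_eq]
    · rw [hV (by norm_num), h13]
    · rw [hV (by norm_num), hE'.e_eq]
    · rw [hV (by norm_num), hE'.e_eq]
    refine Run.seq (Run.rset (m := slotPos sl u)
      (v := f (slotPos sl u) + σ * (2 ^ rl * slotSum sl (2 ^ (e + 2)) u (slotPos sl u)) +
        σ * ((((sl u / 2 : ℕ) : ℝ) - (2 ^ (e + 2) : ℕ)) * (2 ^ rl : ℕ))) ?_ ?_ ?_)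
    · rw [hV (by norm_num)]; simp [h12]
    · change o.eval _ (slotExp.eval p w _) = _
      rw [ho]
      congr 1
      · rw [RExp.eval_cell, hV (by norm_num)]
        simp [h12, hf']
      · congr 1
        rw [slotExp, RExp.eval_mul, RExp.eval_sub, RExp.eval_ofWord, RExp.eval_ofWord,
          RExp.eval_ofWord, WExp.eval_div, hL (by norm_num), hV (by norm_num),
          eval_twoPow_of hw (m := e + 2) (WExp.eval_add_of ?_ (hL (by norm_num)) (by omega)) hbw,
          eval_twoPow_of hw (m := rl) ?_ hrlw]
        · simp
        · rw [hV (by norm_num)]; simp [h9]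
        · rw [hV (by norm_num)]; simp [hE'.e_eq]
    refine Run.assign hw (by norm_num) (v := slotPos sl (u + 1)) ?_ ?_
    · have : sl u % 2 < 2 := Nat.mod_lt _ (by norm_num)
      rw [slotPos_succ]
      refine WExp.eval_add_of ?_ ?_ (by omega)
      · rw [hV (by norm_num)]; simp [h12]
      · rw [WExp.eval_mod, hV (by norm_num), hL (by norm_num)]; simp
    · refine ⟨by simp [h13], ?_, by simp, (((hE'.setWord (by omega)).setReal).setWord
        (by omega)).setWord (by omega), by simp [h8], by simp [h9], by simp, fun t => ?_⟩
      · have e1 := size_readSlot o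
        have e2 : (2 * WVar 4 : WExp).size = 4 := rfl
        omega
      · rw [slotSum_succ]
        simp only [State.real_setWord, State.real_setReal_same, hf']
        split_ifs with h1 h2 h2
        · subst h1; push_cast; ring
        · exact absurd h1.symm h2
        · exact absurd h2.symm h1
        · ring
  · rintro τ s' ⟨hτ, -, hE', h8, -, -, hf'⟩
    refine Run.assign hw (by norm_num) (v := rp) (eval_bits hE'.input_eq ?_ ?_ (by omega)
      hR.parent) ?_
    · rw [hV (by norm_num), h8]
    · rw [hV (by norm_num), hE'.P_eq]
    refine hQ _ _ ?_ (hE'.setWord (by omega)) (by simp) (by simpa using hf')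
    have e1 : recPosExp.size + 2 + ((WExp.bits (WVar 8 + WVar 3) (WVar 3)).size + 2 +
      ((0 : WExp).size + 2 + ((2 * WVar 4 : WExp).size + 4 +
      ((WExp.bits (WVar 8) (WVar 3)).size + 2)))) ≤ 42 := by decide
    omega

/-- A step needs a parent with a smaller index, so the record 0 can only be the root; hence the
path, and with it the sum, is determined by its first record. -/
theorem Reach.eq_of {rp rl : ℕ → ℕ} {sl : ℕ → ℕ → ℕ} {B m m' : ℕ} {v v' : ℕ → ℝ}
    (h : Reach rp rl sl d B m r v) (h' : Reach rp rl sl d B m' r v') : ∀ t < d, v t = v' t := by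
  induction h generalizing m' v' with
  | root hv =>
    cases h' with
    | root hv' => exact fun t ht => by rw [hv t ht, hv' t ht]
    | step hr => omega
  | step hr _ hv ih =>
    cases h' with
    | root => omega
    | step _ h' hv' => exact fun t ht => by rw [hv t ht, hv' t ht, ih h' t ht]

/-- The invariant is that the accumulator plus σ times the sum over the rest of the path stays
constant. With σ = 1 and σ = -1 the same program adds one position and subtracts the other. -/
theorem run_walk (hB : WordBounds w n d e M P) {rp rl lf : ℕ → ℕ} {sl : ℕ → ℕ → ℕ} {f v : ℕ → ℝ}
    {x a m : ℕ} (hx : x < 2) (hxa : s.word 0 x = a) (ho : ∀ x y, o.eval x y = x + σ * y)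
    (hE : EstEnv w d e P i j l s) (hc : c ≤ 12 * n) (ha : a < c) (hlf : lf a < c)
    (hR : ∀ r < c, HasRecord P d e l r (rp r) (rl r) (lf r) (sl r)) (hrl : ∀ r < c, rl r ≤ M)
    (hv : Reach rp rl sl d (2 ^ (e + 2)) m (lf a) v)
    (hf : ∀ t, s.real 1 t = f t)
    (hQ : ∀ τ s', τ ≤ 240 * d * m + 40 → EstEnv w d e P i j l s' →
      (∀ t < d, s'.real 1 t = f t + σ * v t) → Q τ s') :
    Run p w (walk x o) s Q := by
  have hw := hB.hw
  have hd := hB.d_pos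
  have hPw := hB.Pw
  have hV : ∀ {j : ℕ} {s : State}, j < 64 → (WVar j).eval w s = s.word 0 j := fun hj =>
    eval_WVar hw hj
  have hL : ∀ {k : ℕ} {s : State}, k < 64 → WExp.eval w s (OfNat.ofNat k) = k := fun hk =>
    WExp.eval_ofNat hw hk
  have hpos := recPos_lt hB (show a < 12 * n by omega)
  -- For the index of a point the pointer is less than 12n < 2^P, so truncation to P bits loses
  -- nothing.
  have hlP : lf a % 2 ^ P = lf a := Nat.mod_eq_of_lt (by have := hB.nP; omega)
  have hleaf := (hR a ha).leaf
  rw [hlP] at hleaf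
  refine Run.seq (Run.assign hw (by norm_num) (v := a) (by rw [hV (by omega), hxa]) ?_)
  have hE1 : EstEnv w d e P i j l (s.setWord 0 7 a) := hE.setWord (by omega)
  refine Run.seq (Run.assign hw (by norm_num) (v := lf a) (eval_bits hE1.input_eq
    (WExp.eval_add_of (eval_recPosExp hB hE1 (r := a) (by simp) (by omega))
      (WExp.eval_mul_of (m := 2) (n := P) (hL (by norm_num)) ?_ (by omega)) (by omega)) ?_ (by omega) hleaf) ?_)
  · rw [hV (by norm_num), hE1.P_eq]
  · rw [hV (by norm_num), hE1.P_eq]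
  have hb : (BExp.not (.weq (WVar 7) 0)).size = 5 := rfl
  have hbH : ∀ s : State, (BExp.not (.weq (WVar 7) 0)).Holds p w s ↔ s.word 0 7 ≠ 0 := fun s => by
    change ¬ (WVar 7).eval w s = (0 : WExp).eval w s ↔ _
    rw [hV (by norm_num), hL (by norm_num)]
  refine Run.loop (fun k τ s' => k ≤ m ∧ τ ≤ 240 * d * (m - k) ∧ EstEnv w d e P i j l s' ∧
    ∃ r v', s'.word 0 7 = r ∧ r < c ∧ Reach rp rl sl d (2 ^ (e + 2)) k r v' ∧
      ∀ t < d, s'.real 1 t + σ * v' t = f t + σ * v t) m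
    ⟨le_rfl, by omega, hE1.setWord (by omega), lf a, v, by simp, hlf, hv, by simp [hf]⟩ ?_ ?_
  · rintro k τ s' ⟨hk, hτ, hE', r, v', h7, hr, hv', hS⟩
    cases hv' with
    | @step _ _ u _ hrp hu huv =>
      refine ⟨(hbH s').2 (by omega), run_readRecord hB ho hE' h7 (by omega) (hR r hr) (hrl r hr)
        (fun t => rfl) fun τ' s'' hτ' hE'' h7' hS' => ⟨by omega, ?_, hE'', rp r, u, h7', by omega,
          hu, fun t ht => ?_⟩⟩
      · have e1 : m - k = (m - (k + 1)) + 1 := by omega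
        rw [e1, Nat.mul_add]
        omega
      · rw [hS' t, ← hS t ht, huv t ht]; ring
  · rintro τ s' ⟨-, hτ, hE', r, v', h7, hr, hv', hS⟩
    cases hv' with
    | root hv0 =>
      refine ⟨fun h => (hbH s').1 h h7, hQ _ _ ?_ hE' fun t ht => ?_⟩
      · have e1 : (WVar x).size + 2 + ((WExp.bits (recPosExp + 2 * WVar 3) (WVar 3)).size + 2) ≤
          34 := by rw [size_WVar]; decide
        rw [Nat.sub_zero] at hτ
        omega
      · rw [← hS t ht, hv0 t ht]; ring

theorem run_estimator [Fact (1 ≤ p)] (hB : WordBounds w n d e M P) {rp rl lf : ℕ → ℕ}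
    {sl : ℕ → ℕ → ℕ} {v v' : ℕ → ℝ} {m m' : ℕ} (h0 : s.word 0 0 = i) (h1 : s.word 0 1 = j)
    (h2 : s.word 0 2 = w) (hl : s.input = l) (hreal : ∀ t, s.real 1 t = 0)
    (hc : c ≤ 12 * n) (hi : i < c) (hj : j < c) (hlf : ∀ a, a = i ∨ a = j → lf a < c)
    (hH : HasHeader P d e l)
    (hR : ∀ r < c, HasRecord P d e l r (rp r) (rl r) (lf r) (sl r)) (hrl : ∀ r < c, rl r ≤ M)
    (hv : Reach rp rl sl d (2 ^ (e + 2)) m (lf i) v)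
    (hv' : Reach rp rl sl d (2 ^ (e + 2)) m' (lf j) v')
    (hm : m ≤ M) (hm' : m' ≤ M)
    (hQ : ∀ τ s', τ ≤ 800 * d * M → s'.real 0 0 =
      lpn p d (fun t => v t - v' t) / (16 * 2 ^ e * (d : ℝ) ^ (p.toReal)⁻¹) → Q τ s') :
    Run p w (estimator p) s Q := by
  have hw := hB.hw
  have hd := hB.d_pos
  have hdw : d < 2 ^ w := by have := hB.slots; omega
  have hew : 2 ^ e < 2 ^ w :=
    lt_of_le_of_lt (Nat.pow_le_pow_right (by norm_num) (by omega)) hB.powe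
  have hV : ∀ {j : ℕ} {s : State}, j < 64 → (WVar j).eval w s = s.word 0 j := fun hj =>
    eval_WVar hw hj
  have hL : ∀ {k : ℕ} {s : State}, k < 64 → WExp.eval w s (OfNat.ofNat k) = k := fun hk =>
    WExp.eval_ofNat hw hk
  refine Run.seq (run_readHeader hB h2 h0 h1 hl hH fun τ₁ s₁ hτ₁ hE₁ hr₁ => ?_)
  refine Run.seq (run_walk (σ := 1) (f := fun _ => 0) hB (by norm_num) hE₁.i_eq
    (fun x y => by simp [ROp.eval]) hE₁ hc hi (hlf i (Or.inl rfl)) hR hrl hv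
    (fun t => by rw [hr₁, hreal]) fun τ₂ s₂ hτ₂ hE₂ hS₂ => ?_)
  refine Run.seq (run_walk (σ := -1) (f := s₂.real 1) hB (by norm_num) hE₂.j_eq
    (fun x y => by simp [ROp.eval, sub_eq_add_neg]) hE₂ hc hj (hlf j (Or.inr rfl)) hR hrl hv'
    (fun t => rfl) fun τ₃ s₃ hτ₃ hE₃ hS₃ => ?_)
  refine Run.seq (run_normProg (f := fun t => v t - v' t) (d := d) hw hdw ?_ ?_
    fun τ₄ A x hτ₄ hA => ?_)
  · intro A x t
    rw [hV (by norm_num)]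
    simp [normState, hE₃.d_eq]
  · intro A x t ht
    rw [RExp.eval_cell, hV (by norm_num)]
    simp only [normState, State.word_setWord_same, State.real_setWord, if_true]
    rw [State.real_setReal_ne _ _ _ _ _ (by norm_num), State.real_setReal_ne _ _ _ _ _ (by norm_num),
      hS₃ t ht, hS₂ t ht]
    ring
  refine Run.rset (hL (by norm_num)) (v := lpn p d (fun t => v t - v' t) /
    (16 * 2 ^ e * (d : ℝ) ^ (p.toReal)⁻¹)) ?_ (hQ _ _ ?_ (by simp))
  · rw [RExp.eval_div, eval_normVal (d := d) hw hd hA (by simp [normState])]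
    congr 1
    change (16 : WExp).eval w _ * ((twoPow (WVar 5)).eval w _ : ℝ) *
      |((WVar 4).eval w _ : ℝ)| ^ (p.toReal)⁻¹ = _
    rw [hL (by norm_num), hV (by norm_num), eval_twoPow_of hw (m := e) ?_ hew]
    · simp [normState, hE₃.d_eq]
    · rw [hV (by norm_num)]; simp [normState, hE₃.e_eq]
  · have e1 : (RExp.cell 1 (WVar 12)).size + (WVar 4).size + 70 = 75 := rfl
    have e2 : (WVar 4).size = 2 := rfl
    have e3 := size_normVal_le (p := p)
    have e4 : (normVal p / (.ofWord 16 * .ofWord (twoPow (WVar 5)) * .root (.ofWord (WVar 4))) :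
      RExp).size = (normVal p).size + 14 := rfl
    have e5 : (0 : WExp).size = 1 := rfl
    rw [e1, e2] at hτ₄
    rw [e4, e5]
    have e6 : 240 * d * m ≤ 240 * (d * M) := by
      rw [mul_assoc]; exact Nat.mul_le_mul_left _ (Nat.mul_le_mul_left _ hm)
    have e7 : 240 * d * m' ≤ 240 * (d * M) := by
      rw [mul_assoc]; exact Nat.mul_le_mul_left _ (Nat.mul_le_mul_left _ hm')
    have e8 : d * 6 ≤ d * M := Nat.mul_le_mul_left _ hB.M_pos
    rw [mul_assoc 800]
    omega

end

/-! ### The sketching program -/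

def sketcher : Prog := initParams ⨾ makeNet ⨾ makeRecords ⨾ emitSketch

/-- The memory before the sketching program starts; scratch cells with index above `2` in the array
of the scalar variables are arbitrary. -/
structure SketchInput (w n d : ℕ) (ε Φ : ℝ) (X D : ℕ → ℕ → ℝ) (s : State) : Prop where
  n_eq : s.word 0 0 = n
  d_eq : s.word 0 1 = d
  w_eq : s.word 0 2 = w
  word_eq : ∀ a i, 1 ≤ a → s.word a i = 0
  eps_eq : s.real 2 0 = ε
  Phi_eq : s.real 2 1 = Φ
  res_eq : ∀ i, s.real 3 i = 0
  output_eq : s.output = []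
  x_eq : ∀ a < n, ∀ t < d, s.real 0 (a * d + t) = X a t
  dist_eq : ∀ a < n, ∀ b < n, s.real 1 (a * n + b) = D a b

/-- `l` is a sketch of the points `X`: the points have leaf records whose positions agree with `X` up
to the scale `g` and an error that is proportional to the distances. -/
def IsSketch (n d e M P : ℕ) (g : ℝ) (X D : ℕ → ℕ → ℝ) (l : List Bool) : Prop :=
  ∃ (c : ℕ) (rp rl lf : ℕ → ℕ) (sl : ℕ → ℕ → ℕ) (S : ℕ → ℕ → ℝ),
    c ≤ 11 * n + 1 ∧ HasHeader P d e l ∧ l.length = recPos P d e c ∧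
    (∀ r < c, HasRecord P d e l r (rp r) (rl r) (lf r) (sl r)) ∧ (∀ r < c, rl r ≤ M) ∧
    (∀ a < n, lf a < c) ∧ (∀ a < n, ∃ m ≤ M, Reach rp rl sl d (2 ^ (e + 2)) m (lf a) (S a)) ∧
    ∀ a < n, ∀ b < n, a ≠ b → ∀ t < d, |S a t - S b t - g * (X a t - X b t)| ≤ 16 * D a b

section
variable {p : ℝ≥0∞} {w n d e M P : ℕ} {g ε Φ : ℝ} {X D : ℕ → ℕ → ℝ} {s : State}
  {Q : ℕ → State → Prop} {T : ℕ → ℕ} {O : ℕ → ℕ → ℝ}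

theorem run_initParams (hB : WordBounds w n d e M P) (hs : SketchInput w n d ε Φ X D s)
    (he : e = Nat.log 2 ⌊1 / ε⌋₊ + 1) (hM : M = Nat.log 2 ⌊Φ⌋₊ + 5)
    (hP : P = Nat.log 2 n + Nat.log 2 d + Nat.log 2 e + Nat.log 2 M + 5)
    (hg : g = 16 * 2 ^ e * (d : ℝ) ^ (p.toReal)⁻¹)
    (hQ : ∀ τ s', τ ≤ 100 → Env w n d e M P g X D (s'.word 1) s' →
      (∀ a, s'.word 1 a = if a = 0 then M else 0) → s'.word 0 11 = 1 →
      (∀ a i, 2 ≤ a → s'.word a i = 0) → s'.real 3 = s.real 3 → s'.output = [] → Q τ s') :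
    Run p w initParams s Q := by
  have hw := hB.hw
  have hV : ∀ {j : ℕ} {s : State}, j < 64 → (WVar j).eval w s = s.word 0 j := fun hj =>
    eval_WVar hw hj
  have hR : ∀ {j : ℕ} {s : State}, j < 64 → (RVar j).eval p w s = s.real 2 j := fun hj =>
    eval_RVar hw hj
  have hL : ∀ {k : ℕ} {s : State}, k < 64 → WExp.eval w s (OfNat.ofNat k) = k := fun hk =>
    WExp.eval_ofNat hw hk
  have hew : 2 ^ e < 2 ^ w :=
    lt_of_le_of_lt (Nat.pow_le_pow_right (by norm_num) (by omega)) hB.powe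
  have hMw : 2 ^ M < 2 ^ w :=
    lt_of_le_of_lt (Nat.pow_le_pow_right (by norm_num) (by omega)) hB.powM
  have hPw : P < 2 ^ w := by
    have := hB.Pw
    exact lt_of_lt_of_le (by omega : P < w) Nat.lt_two_pow_self.le
  have he1 : ⌊1 / ε⌋₊ < 2 ^ e := he ▸ Nat.lt_pow_succ_log_self (by norm_num) _
  have hM1 : ⌊Φ⌋₊ < 2 ^ M := by
    refine (Nat.lt_pow_succ_log_self (b := 2) (by norm_num) ⌊Φ⌋₊).trans_le ?_
    exact Nat.pow_le_pow_right (by norm_num) (by omega)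
  have hee : e < 2 ^ e := Nat.lt_two_pow_self
  have hMM : M < 2 ^ M := Nat.lt_two_pow_self
  refine Run.seq (Run.floor (m := 3) (v := 1 / ε) (hL (by norm_num)) ?_ (he1.trans hew) ?_)
  · rw [RExp.eval_div, RExp.eval_ofWord, hL (by norm_num), hR (by norm_num), hs.eps_eq]
    simp
  refine Run.seq (Run.assign hw (by norm_num) (v := e) ?_ ?_)
  · rw [he]
    refine WExp.eval_add_of (n := 1) ?_ (hL (by norm_num)) (by omega)
    rw [WExp.eval_log2, hV (by norm_num)]; simp
  refine Run.seq (Run.floor (m := 4) (v := Φ) (hL (by norm_num)) ?_ (hM1.trans hMw) ?_)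
  · rw [hR (by norm_num)]; simp [hs.Phi_eq]
  refine Run.seq (Run.assign hw (by norm_num) (v := M) ?_ ?_)
  · rw [hM]
    refine WExp.eval_add_of (n := 5) ?_ (hL (by norm_num)) (by omega)
    rw [WExp.eval_log2, hV (by norm_num)]; simp
  refine Run.seq (Run.assign hw (by norm_num) (v := P) ?_ ?_)
  · rw [hP]
    refine WExp.eval_add_of (WExp.eval_add_of (WExp.eval_add_of (WExp.eval_add_of ?_ ?_ ?_) ?_ ?_) ?_
      ?_) (hL (by norm_num)) (by omega)
    · rw [WExp.eval_log2, hV (by norm_num)]; simp [hs.n_eq]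
    · rw [WExp.eval_log2, hV (by norm_num)]; simp [hs.d_eq]
    · omega
    · rw [WExp.eval_log2, hV (by norm_num)]; simp
    · omega
    · rw [WExp.eval_log2, hV (by norm_num)]; simp
    · omega
  refine Run.seq (Run.rset (m := 2) (v := g) (hL (by norm_num)) ?_ ?_)
  · change (16 : WExp).eval w _ * ((twoPow (WVar 3)).eval w _ : ℝ) *
      |((WVar 1).eval w _ : ℝ)| ^ (p.toReal)⁻¹ = _
    rw [hL (by norm_num), hV (by norm_num), eval_twoPow_of hw (m := e) ?_ hew, hg]
    · simp [hs.d_eq]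
    · rw [hV (by norm_num)]; simp
  refine Run.seq (Run.assign hw (by norm_num) (v := 1) (hL (by norm_num)) ?_)
  refine Run.wset (m := 0) (v := M) (hL (by norm_num)) ?_ ?_
  · rw [hV (by norm_num)]; simp
  refine hQ _ _ (by decide) ?_ ?_ ?_ ?_ ?_ ?_
  · constructor
    · simp [hs.n_eq]
    · simp [hs.d_eq]
    · simp [hs.w_eq]
    · simp
    · simp
    · simp
    · simp
    · simpa using hs.x_eq
    · simpa using hs.dist_eq
    · simp
  · intro a
    simp [hs.word_eq 1 a le_rfl]
  · simp
  · intro a i ha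
    rw [State.word_setWord_ne _ _ _ _ _ (by omega)]
    simp [State.word_setWord, show a ≠ 0 by omega, hs.word_eq a i (by omega)]
  · simp
  · simp [hs.output_eq]

/-- At level 0 nearness would mean 2D ≤ 1, against the minimum distance 1. So all residuals vanish,
O a = g·X a - S a, and the discrepancy of the offsets is the error of the sketched displacements. -/
theorem LevelDone.isSketch (hn : 1 ≤ n) (hN : Net n d e M g X D T)
    (h : LevelDone w n d e M P g X D T 0 O s) {l : List Bool} (hH : HasHeader P d e l)
    (hlen : l.length = recPos P d e (s.word 0 11))
    (hR : ∀ r < s.word 0 11, HasRecord P d e l r (s.word 3 r) (s.word 4 r) (s.word 2 r)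
      (fun u => s.word 5 (r * (2 * d) + u))) : IsSketch n d e M P g X D l := by
  have hpt : ∀ a, ∃ S : ℕ → ℝ, a < n → (∃ m ≤ M, MReach d e s m (s.word 2 a) S) ∧
      s.word 2 a < s.word 0 11 ∧ ∀ t < d, O a t = g * X a t - S t := by
    intro a
    by_cases ha : a < n
    · obtain ⟨m, S, hm, hS, hlt, h'⟩ := h.point a ha (Nat.zero_le _)
      refine ⟨S, fun _ => ⟨⟨m, by omega, hS⟩, hlt, fun t ht => ?_⟩⟩
      obtain ⟨-, h1, h2⟩ := h' t ht
      rw [h2, h1, sub_zero]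
      rintro ⟨b, hb, hba, -, hD⟩
      have := hN.far a ha b hb hba.symm
      norm_num at hD
      linarith
    · exact ⟨0, fun h => absurd h ha⟩
  choose S hS using hpt
  refine ⟨s.word 0 11, s.word 3, s.word 4, s.word 2, fun r u => s.word 5 (r * (2 * d) + u), S,
    (h.book.lt hN hn).2, hH, hlen, hR, h.book.level, fun a ha => (hS a ha).2.1,
    fun a ha => (hS a ha).1, fun a ha b hb hab t ht => ?_⟩
  have h1 := h.frame a ha b hb (Nat.zero_le _) (Nat.zero_le _) hab t ht
  rw [(hS a ha).2.2 t ht, (hS b hb).2.2 t ht] at h1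
  have h2 := frameErr_zero_le (zero_le_one.trans (hN.far a ha b hb hab))
  rw [abs_sub_comm]
  calc _ = |g * X a t - S a t - (g * X b t - S b t)| := by ring_nf
    _ ≤ _ := h1.trans h2

theorem run_sketcher (hB : WordBounds w n d e M P) (hs : SketchInput w n d ε Φ X D s)
    (he : e = Nat.log 2 ⌊1 / ε⌋₊ + 1) (hM : M = Nat.log 2 ⌊Φ⌋₊ + 5)
    (hP : P = Nat.log 2 n + Nat.log 2 d + Nat.log 2 e + Nat.log 2 M + 5)
    (hg : g = 16 * 2 ^ e * (d : ℝ) ^ (p.toReal)⁻¹) (hD : IsDist D)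
    (hfar : ∀ a < n, ∀ b < n, a ≠ b → 1 ≤ D a b)
    (hdiam : ∀ a < n, ∀ b < n, 16 * D a b < 2 ^ M)
    (hsum : ∀ a < n, ∀ b < n,
      ∑ t ∈ Finset.range d, |g * (X a t - X b t)| ≤ 16 * 2 ^ e * (d * D a b))
    (hQ : ∀ τ s', τ ≤ 1200 * n * n * M + 10300 * n * d → IsSketch n d e M P g X D s'.output →
      Q τ s') :
    Run p w sketcher s Q := by
  have hn := hB.n_pos
  refine Run.seq (run_initParams hB hs he hM hP hg fun τ₁ s₁ hτ₁ hE₁ hT₁ hc₁ hz₁ hr₁ ho₁ => ?_)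
  refine Run.seq (run_makeNet hB hD hE₁ hT₁ hfar hdiam hsum fun τ₂ s₂ hτ₂ hE₂ hN hf => ?_)
  have hc₂ : s₂.word 0 11 = 1 := (hf.word0 _ (by norm_num)).trans hc₁
  have hz₂ : ∀ a i, 2 ≤ a → s₂.word a i = 0 := fun a i ha => by rw [hf.word a ha, hz₁ a i ha]
  have htop : ∀ a < n, M ≤ s₂.word 1 a → a = 0 := fun a ha hTa => by
    by_contra h0
    have := hN.top a ha h0
    omega
  -- At level M the net is the point 0 alone, with the empty path, position 0 and residual 0. Its
  -- offset is therefore g·X 0, and there are no pairs to compare.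
  have hLD : LevelDone w n d e M P g X D (s₂.word 1) M (fun _ t => g * X 0 t)
      (s₂.setWord 0 6 M) := by
    refine ⟨hE₂.setWord (by omega), by simp, by simp [hf.output, ho₁], ⟨⟨∅, by simp [hc₂], by simp⟩,
      ?_, ?_, ?_⟩, ?_, ?_⟩
    · simp [hz₂]
    · simp [hz₂]
    · simp [hz₂]
    · intro a ha hTa
      obtain rfl := htop a ha hTa
      refine ⟨0, fun _ => 0, by omega, ?_, by simp [hz₂, hc₂], fun t ht => ?_⟩
      · rw [State.word_setWord_ne _ _ _ _ _ (by norm_num), hz₂ 2 0 le_rfl]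
        exact .root fun _ _ => rfl
      · simp [hf.real, hr₁, hs.res_eq]
    · intro a ha b hb hTa hTb hab
      exact absurd ((htop a ha hTa).trans (htop b hb hTb).symm) hab
  refine Run.seq (run_makeRecords hB hN hLD hE₂.M_eq fun τ₃ s₃ O hτ₃ h₃ => ?_)
  have hc := h₃.book.lt hN hn
  refine run_emitSketch hB h₃.env.d_eq h₃.env.e_eq h₃.env.P_eq rfl (by omega) h₃.output ?_ ?_
    h₃.book.slot fun τ₄ s₄ hτ₄ hH hlen hR => hQ _ _ ?_ (h₃.isSketch hn hN hH hlen hR)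
  · intro r hr
    have := h₃.book.parent r hr
    have := hB.nP
    omega
  · intro r hr
    have := h₃.book.level r hr
    have := hB.MP
    omega
  · have e1 : 1 ≤ n * n * M := Nat.mul_pos (Nat.mul_pos hn hn) (by have := hB.M_pos; omega)
    have e2 : ∀ c, c * n * n * M = c * (n * n * M) := fun c => by ring
    have e3 : ∀ c, c * n * d = c * (n * d) := fun c => by ring
    rw [e2] at hτ₂ hτ₃ ⊢
    rw [e3] at hτ₃ hτ₄ ⊢
    omega

/-! ### The accuracy of the estimates -/

variable [Fact (1 ≤ p)]

theorem lpn_add_le (f h : ℕ → ℝ) : lpn p d (fun t => f t + h t) ≤ lpn p d f + lpn p d h :=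
  norm_add_le (WithLp.toLp p fun t : Fin d => f t : PiLp p fun _ : Fin d => ℝ)
    (WithLp.toLp p fun t : Fin d => h t)

theorem lpn_mul (c : ℝ) (f : ℕ → ℝ) : lpn p d (fun t => c * f t) = |c| * lpn p d f :=
  norm_smul c (WithLp.toLp p fun t : Fin d => f t : PiLp p fun _ : Fin d => ℝ)

theorem lpn_zero : lpn p d (fun _ => 0) = 0 := by
  simpa using lpn_mul (p := p) (d := d) 0 fun _ => 0

theorem lpn_sub_le {f h : ℕ → ℝ} {c : ℝ} (hd : 1 ≤ d) (H : ∀ t < d, |f t - h t| ≤ c) :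
    |lpn p d f - lpn p d h| ≤ c * (d : ℝ) ^ (p.toReal)⁻¹ := by
  have h1 := lpn_add_le (p := p) (d := d) h fun t => f t - h t
  have h2 := lpn_add_le (p := p) (d := d) f fun t => h t - f t
  have h3 := lpn_le p hd H
  have h4 := lpn_le p (f := fun t => h t - f t) hd fun t ht => (abs_sub_comm _ _).trans_le (H t ht)
  simp only [add_sub_cancel] at h1 h2
  rw [abs_le]
  constructor <;> linarith

/-- A coordinatewise error of 16D costs at most 16D·d^(1/p) in the norm, which is exactly g·D/2^e.
This fixes the choice of `g`. -/
theorem estimate_accuracy {f h : ℕ → ℝ} {D : ℝ} (hd : 1 ≤ d)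
    (hg : g = 16 * 2 ^ e * (d : ℝ) ^ (p.toReal)⁻¹) (hD : lpn p d h = D)
    (H : ∀ t < d, |f t - g * h t| ≤ 16 * D) : |lpn p d f / g - D| ≤ D / 2 ^ e := by
  have hd0 : (0 : ℝ) < d := by exact_mod_cast hd
  have hr : (0 : ℝ) < (d : ℝ) ^ (p.toReal)⁻¹ := Real.rpow_pos_of_pos hd0 _
  have hg0 : 0 < g := by rw [hg]; positivity
  have h1 := lpn_sub_le (p := p) hd H
  rw [lpn_mul, hD, abs_of_pos hg0] at h1
  have h2 : lpn p d f / g - D = (lpn p d f - g * D) / g := by field_simp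
  rw [h2, abs_div, abs_of_pos hg0, div_le_iff₀ hg0]
  refine h1.trans (le_of_eq ?_)
  rw [hg]; field_simp

theorem run_estimator_of_isSketch (hB : WordBounds w n d e M P) {l : List Bool}
    (hl : IsSketch n d e M P g X D l) (hg : g = 16 * 2 ^ e * (d : ℝ) ^ (p.toReal)⁻¹)
    (hD : ∀ a < n, ∀ b < n, D a b = lpn p d fun t => X a t - X b t)
    (hfar : ∀ a < n, ∀ b < n, a ≠ b → 1 ≤ D a b) {i j : ℕ} (hi : i < n) (hj : j < n)
    (hQ : ∀ τ s', τ ≤ 800 * d * M → |s'.real 0 0 - D i j| ≤ D i j / 2 ^ e → Q τ s') :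
    Run p w (estimator p) (queryInput w l i j) Q := by
  obtain ⟨c, rp, rl, lf, sl, S, hc, hH, -, hR, hrl, hlf, hreach, hS⟩ := hl
  have hd := hB.d_pos
  have hacc : ∀ a < n, ∀ b < n, a ≠ b →
      |lpn p d (fun t => S a t - S b t) / g - D a b| ≤ D a b / 2 ^ e := fun a ha b hb hab =>
    estimate_accuracy hd hg (hD a ha b hb).symm (hS a ha b hb hab)
  have hS0 : ∀ a b m m' v v', lf a = lf b → Reach rp rl sl d (2 ^ (e + 2)) m (lf a) v →
      Reach rp rl sl d (2 ^ (e + 2)) m' (lf b) v' → lpn p d (fun t => v t - v' t) = 0 := by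
    intro a b m m' v v' hab h1 h2
    rw [hab] at h1
    have := h1.eq_of h2
    rw [lpn_congr (g := fun _ => 0) fun t ht => by rw [this t ht, sub_self], lpn_zero]
  -- Needed because the pointer of the point `a` is read from the record `a`. If two points shared
  -- their last record, their estimated distance would be 0, which is not within D/2^e ≤ D/2 of D ≥
  -- 1; so the pointers are injective.
  have hnc : n ≤ c := by
    have h2e : (2 : ℝ) ≤ 2 ^ e := by
      simpa using pow_le_pow_right₀ (one_le_two : (1 : ℝ) ≤ 2) hB.e_pos
    have : (Finset.range n).card ≤ (Finset.range c).card := by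
      refine Finset.card_le_card_of_injOn lf (fun a ha => ?_) fun a ha b hb hab => ?_
      · simpa using hlf a (by simpa using ha)
      · have ha' : a < n := by simpa using ha
        have hb' : b < n := by simpa using hb
        by_contra hne
        have h1 := hacc a ha' b hb' hne
        obtain ⟨m, -, hm⟩ := hreach a ha'
        obtain ⟨m', -, hm'⟩ := hreach b hb'
        rw [hS0 a b m m' _ _ hab hm hm', zero_div, zero_sub, abs_neg] at h1
        have h2 := hfar a ha' b hb' hne
        rw [abs_of_pos (by linarith), le_div_iff₀ (by positivity)] at h1
        nlinarith
    simpa using this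
  obtain ⟨m, hmM, hm⟩ := hreach i hi
  obtain ⟨m', hmM', hm'⟩ := hreach j hj
  refine run_estimator hB (i := i) (j := j) (l := l) (c := c) rfl rfl rfl rfl (fun _ => rfl)
    (by have := hB.n_pos; omega) (by omega) (by omega) ?_ hH hR hrl hm hm' hmM hmM'
    fun τ s' hτ hs' => hQ _ _ hτ ?_
  · rintro a (rfl | rfl)
    · exact hlf _ hi
    · exact hlf _ hj
  · rw [hs', ← hg]
    rcases eq_or_ne i j with rfl | hij
    · have : D i i = 0 := by
        rw [hD i hi i hi]; simp only [sub_self]; exact lpn_zero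
      rw [hS0 i i m m' _ _ rfl hm hm', this]; simp
    · exact hacc i hi j hj hij

end

/-! ### Computing the distances from the coordinates -/

/-- The difference of the coordinates `12` of the points `6` and `7`. -/
def diffExp : RExp := .cell 0 (WVar 6 * WVar 1 + WVar 12) - .cell 0 (WVar 7 * WVar 1 + WVar 12)

noncomputable def storeDist (p : ℝ≥0∞) : Prog :=
  normProg p (WVar 1) diffExp ⨾ .rset 1 (WVar 6 * WVar 0 + WVar 7) (normVal p)

/-- Resets the scratch memory. -/
def clearScratch : Prog :=
  assign 6 0 ⨾ assign 7 0 ⨾ assign 12 0 ⨾ .rset 4 0 (.ofWord 0) ⨾ .rset 4 1 (.ofWord 0)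

/-- Stores all distances in the real array `1`. -/
noncomputable def storeDists (p : ℝ≥0∞) : Prog :=
  forTo 6 (WVar 0) (forTo 7 (WVar 0) (storeDist p)) ⨾ clearScratch

/-- `s'` arises from `s` by storing the first `N` terms of `F` in the real array `1`, and by changing
scratch memory. -/
structure DistsStored (F : ℕ → ℝ) (N : ℕ) (s s' : State) : Prop where
  word : ∀ a k, ¬ (a = 0 ∧ (k = 6 ∨ k = 7 ∨ k = 12)) → s'.word a k = s.word a k
  real : ∀ a k, a ≠ 1 → ¬ (a = 4 ∧ k ≤ 1) → s'.real a k = s.real a k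
  dist : ∀ k, s'.real 1 k = if k < N then F k else s.real 1 k
  input : s'.input = s.input
  output : s'.output = s.output

section
variable {p : ℝ≥0∞} {w n d e M P : ℕ} {X : ℕ → ℕ → ℝ} {F : ℕ → ℝ} {s s' : State}
  {Q : ℕ → State → Prop} {N : ℕ}

theorem DistsStored.refl (s : State) : DistsStored F 0 s s := by
  constructor <;> intros <;> simp

theorem DistsStored.setWord (h : DistsStored F N s s') {k v : ℕ} (hk : k = 6 ∨ k = 7 ∨ k = 12) :
    DistsStored F N s (s'.setWord 0 k v) :=
  ⟨fun a i ha => by rw [State.word_setWord, if_neg (by rintro ⟨rfl, rfl⟩; exact ha ⟨rfl, hk⟩),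
    h.word a i ha], h.real, h.dist, h.input, h.output⟩

theorem DistsStored.setReal (h : DistsStored F N s s') {k : ℕ} {v : ℝ} (hk : k ≤ 1) :
    DistsStored F N s (s'.setReal 4 k v) :=
  ⟨h.word, fun a i h1 ha => by
    rw [State.real_setReal, if_neg (by rintro ⟨rfl, rfl⟩; exact ha ⟨rfl, hk⟩), h.real a i h1 ha],
    fun k => by rw [State.real_setReal_ne _ _ _ _ _ (by norm_num), h.dist], h.input, h.output⟩

theorem DistsStored.next (h : DistsStored F N s s') {v : ℝ} (hv : v = F N) :
    DistsStored F (N + 1) s (s'.setReal 1 N v) :=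
  ⟨h.word, fun a i h1 ha => by rw [State.real_setReal_ne _ _ _ _ _ h1, h.real a i h1 ha],
    fun k => by
      rw [State.real_setReal_same, h.dist]
      rcases lt_trichotomy k N with hk | rfl | hk
      · rw [if_neg hk.ne, if_pos hk, if_pos (by omega)]
      · rw [if_pos rfl, if_pos (by omega), hv]
      · rw [if_neg hk.ne', if_neg (by omega), if_neg (by omega)], h.input, h.output⟩

theorem run_clearScratch (hw : 64 ≤ 2 ^ w) (hs : DistsStored F N s s') (h6 : s.word 0 6 = 0)
    (h7 : s.word 0 7 = 0) (h12 : s.word 0 12 = 0) (h0 : s.real 4 0 = 0) (h1 : s.real 4 1 = 0)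
    (hQ : ∀ τ s'', τ ≤ 20 → s''.word = s.word → (∀ a, a ≠ 1 → s''.real a = s.real a) →
      (∀ k, s''.real 1 k = if k < N then F k else s.real 1 k) → s''.input = s.input →
      s''.output = s.output → Q τ s'') :
    Run p w clearScratch s' Q := by
  have hL : ∀ {s : State}, (0 : WExp).eval w s = 0 := WExp.eval_ofNat hw (by norm_num)
  have hL1 : ∀ {s : State}, (1 : WExp).eval w s = 1 := WExp.eval_ofNat hw (by norm_num)
  have hR : ∀ {s : State}, (RExp.ofWord 0).eval p w s = 0 := by
    intro s; rw [RExp.eval_ofWord, hL, Nat.cast_zero]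
  refine Run.seq (Run.assign hw (by norm_num) hL ?_)
  refine Run.seq (Run.assign hw (by norm_num) hL ?_)
  refine Run.seq (Run.assign hw (by norm_num) hL ?_)
  refine Run.seq (Run.rset hL hR ?_)
  refine Run.rset hL1 hR (hQ _ _ (by decide) ?_ ?_ ?_ hs.input hs.output)
  · funext a k
    have := hs.word a k
    simp only [State.word_setReal, State.word_setWord]
    split_ifs <;> grind
  · intro a ha
    funext k
    have := hs.real a k ha
    simp only [State.real_setReal, State.real_setWord]
    split_ifs <;> grind
  · intro k
    simpa using hs.dist k

variable [Fact (1 ≤ p)]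

theorem run_storeDist (hB : WordBounds w n d e M P) (h0 : s.word 0 0 = n) (h1 : s.word 0 1 = d)
    (hx : ∀ a < n, ∀ t < d, s.real 0 (a * d + t) = X a t) {i j : ℕ} (hi : i < n) (hj : j < n)
    (hF : F (i * n + j) = lpn p d fun t => X i t - X j t) (hs : DistsStored F (i * n + j) s s')
    (h6 : s'.word 0 6 = i) (h7 : s'.word 0 7 = j)
    (hQ : ∀ τ s'', τ ≤ 130 * d → DistsStored F (i * n + j + 1) s s'' → s''.word 0 6 = i →
      s''.word 0 7 = j → Q τ s'') :
    Run p w (storeDist p) s' Q := by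
  have hw := hB.hw
  have hd := hB.d_pos
  have hdw : d < 2 ^ w := by have := hB.slots; omega
  have hV : ∀ {j : ℕ} {s : State}, j < 64 → (WVar j).eval w s = s.word 0 j := fun hj =>
    eval_WVar hw hj
  have h0' : s'.word 0 0 = n := by rw [hs.word _ _ (by omega), h0]
  have h1' : s'.word 0 1 = d := by rw [hs.word _ _ (by omega), h1]
  have hst : ∀ A v t, DistsStored F (i * n + j) s (normState s' A v t) := fun A v t =>
    ((hs.setReal (by norm_num)).setReal (by norm_num)).setWord (by norm_num)
  refine Run.seq (run_normProg (f := fun t => X i t - X j t) (d := d) hw hdw ?_ ?_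
    fun τ A v hτ hA => ?_)
  · intro A v t
    rw [hV (by norm_num)]; simp [normState, h1']
  · intro A v t ht
    rw [diffExp, RExp.eval_sub, RExp.eval_cell, RExp.eval_cell,
      eval_idx hw hB.nd hi ht.le (by norm_num) (by norm_num) (by norm_num),
      eval_idx hw hB.nd hj ht.le (by norm_num) (by norm_num) (by norm_num),
      (hst A v t).real _ _ (by norm_num) (by norm_num),
      (hst A v t).real _ _ (by norm_num) (by norm_num), hx i hi t ht, hx j hj t ht] <;>
      simp [normState, h1', h6, h7]
  · refine Run.rset (m := i * n + j) (v := F (i * n + j)) ?_ ?_ (hQ _ _ ?_ ((hst A v d).next rfl) ?_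
      ?_)
    · refine eval_idx hw hB.nn hi hj.le (by norm_num) (by norm_num) (by norm_num) ?_ ?_ ?_ <;>
        simp [normState, h0', h6, h7]
    · rw [eval_normVal (d := d) hw hd hA (by simp [normState]), hF]
    · have e1 : diffExp.size + (WVar 1).size + 70 = 91 := rfl
      have e2 : (WVar 1).size = 2 := rfl
      have e3 : (WVar 6 * WVar 0 + WVar 7 : WExp).size = 8 := rfl
      have e4 := size_normVal_le (p := p)
      rw [e1, e2] at hτ
      omega
    · simp [normState, h6]
    · simp [normState, h7]

theorem run_storeDists (hB : WordBounds w n d e M P) (h0 : s.word 0 0 = n) (h1 : s.word 0 1 = d)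
    (hx : ∀ a < n, ∀ t < d, s.real 0 (a * d + t) = X a t)
    (hF : ∀ i < n, ∀ j < n, F (i * n + j) = lpn p d fun t => X i t - X j t)
    (h6 : s.word 0 6 = 0) (h7 : s.word 0 7 = 0) (h12 : s.word 0 12 = 0) (hr0 : s.real 4 0 = 0)
    (hr1 : s.real 4 1 = 0)
    (hQ : ∀ τ s', τ ≤ 250 * n * n * d → s'.word = s.word → (∀ a, a ≠ 1 → s'.real a = s.real a) →
      (∀ k, s'.real 1 k = if k < n * n then F k else s.real 1 k) → s'.input = s.input →
      s'.output = s.output → Q τ s') :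
    Run p w (storeDists p) s Q := by
  have hw := hB.hw
  have hn := hB.n_pos
  have hd := hB.d_pos
  have hnw : n < 2 ^ w := by have := hB.nn; omega
  have e0 : (WVar 0).size = 2 := rfl
  have hV : ∀ {j : ℕ} {s : State}, j < 64 → (WVar j).eval w s = s.word 0 j := fun hj =>
    eval_WVar hw hj
  have hn0 : ∀ {N s'}, DistsStored F N s s' → (WVar 0).eval w s' = n := fun h => by
    rw [hV (by norm_num), h.word _ _ (by omega), h0]
  refine Run.seq (Run.forTo (N := n) (fun i τ s' => τ ≤ 190 * (n * d) * i + 3 ∧ s'.word 0 6 = i ∧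
    DistsStored F (i * n) s s') hw (by norm_num) hnw ?_ ?_ ?_ ?_)
  · rintro i τ s' - ⟨-, h, h'⟩
    exact ⟨h, hn0 h'⟩
  · exact ⟨le_rfl, by simp, by simpa using (DistsStored.refl s).setWord (by norm_num)⟩
  · rintro i τ s' hi ⟨hτ, h6', hs⟩
    refine Run.forTo (N := n) (fun j τ' s'' => τ' ≤ 145 * d * j + 3 ∧ s''.word 0 6 = i ∧
      s''.word 0 7 = j ∧ DistsStored F (i * n + j) s s'') hw (by norm_num) hnw ?_ ?_ ?_ ?_
    · rintro j τ' s'' - ⟨-, -, h, h'⟩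
      exact ⟨h, hn0 h'⟩
    · exact ⟨le_rfl, by simp [h6'], by simp, by simpa using hs.setWord (by norm_num)⟩
    · rintro j τ' s'' hj ⟨hτ', h6'', h7'', hs'⟩
      refine run_storeDist hB h0 h1 hx hi hj (hF i hi j hj) hs' h6'' h7''
        fun τ₁ s₁ hτ₁ hs₁ h6₁ h7₁ => ⟨h7₁, ?_, by simp [h6₁], by simp, hs₁.setWord (by norm_num)⟩
      rw [Nat.mul_succ]; omega
    · rintro τ' s'' ⟨hτ', h6'', -, hs'⟩
      refine ⟨h6'', ?_, by simp, ?_⟩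
      · have e1 : 145 * d * n = 145 * (n * d) := by ring
        have e2 : 1 ≤ n * d := Nat.mul_pos hn hd
        rw [e1] at hτ'
        rw [Nat.mul_succ]; omega
      · rw [Nat.succ_mul]; exact hs'.setWord (by norm_num)
  · rintro τ s' ⟨hτ, -, hs⟩
    refine run_clearScratch hw hs h6 h7 h12 hr0 hr1 fun τ' s'' hτ' h1 h2 h3 h4 h5 =>
      hQ _ _ ?_ h1 h2 h3 h4 h5
    have e1 : 190 * (n * d) * n = 190 * (n * n * d) := by ring
    have e2 : 250 * n * n * d = 250 * (n * n * d) := by ring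
    have e3 : 1 ≤ n * n * d := Nat.mul_pos (Nat.mul_pos hn hn) hd
    omega

end

/-! ### Sufficient word size -/

/-- Every number that occurs is at most q^7 for q = n·d·2^e·2^M ≥ 64, the length of the sketch being
the largest; small constant factors are absorbed by q ≥ 64. -/
theorem wordBounds_of {w n d e M P : ℕ} (hn : 1 ≤ n) (hd : 1 ≤ d) (he : 1 ≤ e) (hM : 6 ≤ M)
    (hP : P = Nat.log 2 n + Nat.log 2 d + Nat.log 2 e + Nat.log 2 M + 5)
    (h : (n * d * 2 ^ e * 2 ^ M) ^ 8 ≤ 2 ^ w) : WordBounds w n d e M P := by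
  set E := 2 ^ e with hE
  set F := 2 ^ M with hF
  set q := n * d * E * F with hq
  have hE2 : 2 ≤ E := by
    have := Nat.pow_le_pow_right (n := 2) (by norm_num) he
    omega
  have hF64 : 64 ≤ F := by
    have := Nat.pow_le_pow_right (n := 2) (by norm_num) hM
    omega
  have heE : e < E := Nat.lt_two_pow_self
  have hMF : M < F := Nat.lt_two_pow_self
  have hnd1 : 1 ≤ n * d := Nat.mul_pos hn hd
  have hnde : n * d ≤ n * d * E := Nat.le_mul_of_pos_right _ (by omega)
  have h1 : n * d * E ≤ q := Nat.le_mul_of_pos_right _ (by omega)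
  have hEq : E ≤ n * d * E := Nat.le_mul_of_pos_left _ hnd1
  have hFq : F ≤ q := Nat.le_mul_of_pos_left _ (by omega)
  have hnq : n ≤ n * d := Nat.le_mul_of_pos_right _ hd
  have hdq : d ≤ n * d := Nat.le_mul_of_pos_left _ hn
  have hdE : d * E ≤ n * d * E := by rw [mul_assoc]; exact Nat.le_mul_of_pos_left _ hn
  have hq64 : 64 ≤ q := hF64.trans hFq
  have hqq : 64 * q ≤ q ^ 2 := by rw [sq]; exact Nat.mul_le_mul_right q hq64
  have hq2 : q ^ 2 < q ^ 8 := Nat.pow_lt_pow_right (by omega) (by norm_num)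
  have hq7 : q ^ 7 < q ^ 8 := Nat.pow_lt_pow_right (by omega) (by norm_num)
  have hlog : ∀ m, 1 ≤ m → 2 ^ Nat.log 2 m ≤ m ∧ m < 2 ^ (Nat.log 2 m + 1) := fun m hm =>
    ⟨Nat.pow_log_le_self 2 (by omega), Nat.lt_pow_succ_log_self (by norm_num) m⟩
  -- The summands of P are rounded-down logarithms, so 2^P ≤ 32·n·d·e·M ≤ 32q.
  have hPq : 2 ^ P ≤ q ^ 2 := by
    have : 2 ^ P = 2 ^ Nat.log 2 n * 2 ^ Nat.log 2 d * 2 ^ Nat.log 2 e * 2 ^ Nat.log 2 M * 32 := by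
      rw [hP]; simp only [pow_add]; norm_num
    rw [this]
    calc _ ≤ n * d * E * F * 32 := by
          refine Nat.mul_le_mul_right _ (Nat.mul_le_mul (Nat.mul_le_mul (Nat.mul_le_mul ?_ ?_) ?_) ?_)
          · exact (hlog n hn).1
          · exact (hlog d hd).1
          · exact ((hlog e he).1).trans heE.le
          · exact ((hlog M (by omega)).1).trans hMF.le
      _ ≤ _ := by rw [← hq]; omega
  have hPP : P < 2 ^ P := Nat.lt_two_pow_self
  have hmono : ∀ {a}, a + 1 ≤ P → 2 ^ (a + 1) ≤ 2 ^ P := fun ha =>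
    Nat.pow_le_pow_right (by norm_num) ha
  have hQ : ∀ {y}, y ≤ q ^ 2 → y < 2 ^ w := fun hy => hy.trans_lt (hq2.trans_le h)
  clear_value q E F
  have hnn : n * n + n ≤ q ^ 2 := by
    have h2 : 2 * (n * d) ≤ q := by
      rw [mul_comm]
      exact (Nat.mul_le_mul_left _ hE2).trans h1
    calc n * n + n ≤ n * n + n * n := Nat.add_le_add_left (Nat.le_mul_of_pos_left _ hn) _
      _ = n * (2 * n) := by ring
      _ ≤ q * q := Nat.mul_le_mul (by omega) (by omega)
      _ = q ^ 2 := by ring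
  have hnq2 : 128 * n ≤ q := by
    have : n * 2 * 64 ≤ n * d * E * F :=
      Nat.mul_le_mul (Nat.mul_le_mul hnq hE2) hF64
    omega
  have hout : 3 * P + 1 + 12 * n * (3 * P + 2 * d * (e + 5)) ≤ q ^ 7 := by
    have e1 : 2 * d * (e + 5) ≤ 12 * (d * E) := by
      calc 2 * d * (e + 5) ≤ 2 * d * (6 * E) := Nat.mul_le_mul_left _ (by omega)
        _ = _ := by ring
    have e2 : 12 * n * (3 * P + 2 * d * (e + 5)) ≤ q * (4 * q ^ 2) :=
      Nat.mul_le_mul (by omega) (by omega)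
    have e3 : q ^ 7 = q ^ 4 * q ^ 3 := by ring
    have e4 : q * (4 * q ^ 2) = 4 * q ^ 3 := by ring
    have e5 : 64 * q ^ 3 ≤ q ^ 4 * q ^ 3 :=
      Nat.mul_le_mul_right _ (hq64.trans (Nat.le_self_pow (by norm_num) q))
    have e6 : q ^ 2 ≤ q ^ 3 := Nat.pow_le_pow_right (by omega) (by norm_num)
    omega
  refine ⟨?_, hn, hd, he, hM, hQ hnn, hQ ?_, hQ ?_, ?_, ?_, hout.trans_lt (hq7.trans_le h), ?_, ?_,
    ?_, ?_, ?_⟩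
  · exact (hQ (y := 64) (by omega)).le
  · omega
  · have : 12 * n * (2 * d) = 24 * (n * d) := by ring
    omega
  · rw [pow_succ, ← hF]; exact hQ (by omega)
  · rw [pow_add, ← hE]; exact hQ (by omega)
  · have h4 := (hlog n hn).2
    have h5 := hmono (a := Nat.log 2 n + 4) (by omega)
    rw [pow_succ, pow_add] at h5
    rw [pow_succ] at h4
    omega
  · exact (hlog d hd).2.trans_le (hmono (by omega))
  · exact (hlog e he).2.trans_le (hmono (by omega))
  · exact (hlog M (by omega)).2.trans_le (hmono (by omega))
  · exact (Nat.pow_lt_pow_iff_right (by norm_num)).1 (hQ hPq)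

/-! ### The parameters of the sketch -/

theorem log_floor_le {y : ℝ} (hy : 1 ≤ y) : (Nat.log 2 ⌊y⌋₊ : ℝ) ≤ Real.logb 2 y := by
  have h1 : 1 ≤ ⌊y⌋₊ := Nat.one_le_floor_iff y |>.2 hy
  rw [Real.le_logb_iff_rpow_le one_lt_two (by linarith), Real.rpow_natCast]
  calc (2 : ℝ) ^ Nat.log 2 ⌊y⌋₊ ≤ (⌊y⌋₊ : ℝ) := by
        exact_mod_cast Nat.pow_log_le_self 2 (by omega)
    _ ≤ y := Nat.floor_le (by linarith)

theorem lt_pow_log_floor (y : ℝ) : y < 2 ^ (Nat.log 2 ⌊y⌋₊ + 1) := by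
  have := Nat.lt_of_floor_lt (Nat.lt_pow_succ_log_self (b := 2) (by norm_num) ⌊y⌋₊)
  exact_mod_cast this

theorem pow_log_floor_le {y : ℝ} (hy : 1 ≤ y) : (2 : ℝ) ^ Nat.log 2 ⌊y⌋₊ ≤ y := by
  have h1 : 1 ≤ ⌊y⌋₊ := Nat.one_le_floor_iff y |>.2 hy
  calc (2 : ℝ) ^ Nat.log 2 ⌊y⌋₊ ≤ (⌊y⌋₊ : ℝ) := by
        exact_mod_cast Nat.pow_log_le_self 2 (by omega)
    _ ≤ y := Nat.floor_le (by linarith)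

theorem natLog_le_logb {m : ℕ} (hm : 1 ≤ m) : (Nat.log 2 m : ℝ) ≤ Real.logb 2 m := by
  simpa using log_floor_le (y := (m : ℝ)) (by exact_mod_cast hm)

theorem one_le_logb {y : ℝ} (hy : 2 ≤ y) : 1 ≤ Real.logb 2 y := by
  rw [Real.le_logb_iff_rpow_le one_lt_two (by linarith)]; simpa using hy

/-- The exponent of the precision. -/
noncomputable def precExp (ε : ℝ) : ℕ := Nat.log 2 ⌊1 / ε⌋₊ + 1

/-- The number of levels. -/
noncomputable def numLevels (Φ : ℝ) : ℕ := Nat.log 2 ⌊Φ⌋₊ + 5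

/-- The width of the fields of the sketch. -/
noncomputable def fieldWidth (n d e M : ℕ) : ℕ :=
  Nat.log 2 n + Nat.log 2 d + Nat.log 2 e + Nat.log 2 M + 5

section
variable {p : ℝ≥0∞} {w n d : ℕ} {ε Φ : ℝ}

theorem two_le_inv (hε : 0 < ε) (hε2 : ε ≤ 1 / 2) : 2 ≤ 1 / ε := by
  rw [le_div_iff₀ hε]; linarith

theorem precExp_le (hε : 0 < ε) (hε2 : ε ≤ 1 / 2) : (precExp ε : ℝ) ≤ 2 * Real.logb 2 (1 / ε) := by
  have h2 := two_le_inv hε hε2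
  have h3 := one_le_logb h2
  have h4 := log_floor_le (y := 1 / ε) (by linarith)
  unfold precExp
  push_cast
  linarith

theorem numLevels_le (hΦ : 2 ≤ Φ) : (numLevels Φ : ℝ) ≤ 6 * Real.logb 2 Φ := by
  have h3 := one_le_logb hΦ
  have h4 := log_floor_le (y := Φ) (by linarith)
  unfold numLevels
  push_cast
  linarith

theorem six_le_numLevels (hΦ : 2 ≤ Φ) : 6 ≤ numLevels Φ := by
  have h1 : 2 ≤ ⌊Φ⌋₊ := Nat.le_floor (by exact_mod_cast hΦ)
  have : 1 ≤ Nat.log 2 ⌊Φ⌋₊ := Nat.log_pos (by norm_num) h1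
  unfold numLevels
  omega

/-- With Y = n·d·Φ/ε ≥ 4, the product n·d·2^e·2^M is at most 2·32·Y = 4³·Y ≤ Y⁴; its eighth power is
at most Y^32, whence the factor 32. -/
theorem wordBounds (hn : 1 ≤ n) (hd : 1 ≤ d) (hε : 0 < ε) (hε2 : ε ≤ 1 / 2) (hΦ : 2 ≤ Φ)
    (hw : 32 * Real.logb 2 (n * d * Φ / ε) ≤ w) :
    WordBounds w n d (precExp ε) (numLevels Φ)
      (fieldWidth n d (precExp ε) (numLevels Φ)) := by
  refine wordBounds_of hn hd (Nat.succ_pos _) (six_le_numLevels hΦ) rfl ?_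
  have hn' : (1 : ℝ) ≤ n := by exact_mod_cast hn
  have hd' : (1 : ℝ) ≤ d := by exact_mod_cast hd
  have h2 := two_le_inv hε hε2
  have hnd : (1 : ℝ) ≤ n * d := one_le_mul_of_one_le_of_one_le hn' hd'
  set Y := (n : ℝ) * d * Φ / ε with hY
  have hY' : Y = n * d * (Φ * (1 / ε)) := by rw [hY]; ring
  have h4 : 4 ≤ Φ * (1 / ε) := by nlinarith
  have hY4 : 4 ≤ Y := by rw [hY']; nlinarith
  have h5 : Y ^ 32 ≤ 2 ^ w := by
    have h6 : Real.logb 2 (Y ^ 32) ≤ w := by rw [Real.logb_pow]; exact_mod_cast hw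
    rw [Real.logb_le_iff_le_rpow one_lt_two (by positivity), Real.rpow_natCast] at h6
    exact h6
  have h6 : ((n * d * 2 ^ precExp ε * 2 ^ numLevels Φ : ℕ) : ℝ) ≤ Y ^ 4 := by
    have h7 := pow_log_floor_le (y := 1 / ε) (by linarith)
    have h8 := pow_log_floor_le (y := Φ) (by linarith)
    unfold precExp numLevels
    push_cast
    rw [pow_add, pow_add]
    calc _ ≤ (n : ℝ) * d * (1 / ε * 2 ^ 1) * (Φ * 2 ^ 5) := by gcongr
      _ = 4 ^ 3 * Y := by rw [hY']; ring
      _ ≤ Y ^ 3 * Y := by gcongr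
      _ = Y ^ 4 := by ring
  have h7 : (((n * d * 2 ^ precExp ε * 2 ^ numLevels Φ) ^ 8 : ℕ) : ℝ) ≤ 2 ^ w := by
    rw [Nat.cast_pow]
    calc _ ≤ (Y ^ 4) ^ 8 := by gcongr
      _ = Y ^ 32 := by ring
      _ ≤ _ := h5
  exact_mod_cast h7

/-- The slots of a record take O(d·log(1/ε)) bits, so log d and log e in the field width may be
bounded by d and e. The level field costs log M ≤ 3 + log log Φ since M ≤ 6·log Φ. -/
theorem recPos_le {c e : ℕ} (hn : 1 ≤ n) (hd : 1 ≤ d) (hε : 0 < ε) (hε2 : ε ≤ 1 / 2) (hΦ : 2 ≤ Φ)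
    (he : e = precExp ε) (hc : c ≤ 11 * n + 1) :
    (recPos (fieldWidth n d e (numLevels Φ)) d e c : ℝ) ≤
      1000 * (n * (d + Real.logb 2 n) * Real.logb 2 (1 / ε)
        + n * Real.logb 2 (Real.logb 2 Φ)) := by
  have hn' : (1 : ℝ) ≤ n := by exact_mod_cast hn
  have hd' : (1 : ℝ) ≤ d := by exact_mod_cast hd
  have hc' : (c : ℝ) ≤ 12 * n := by
    have : c ≤ 12 * n := by omega
    exact_mod_cast this
  have hL := one_le_logb (two_le_inv hε hε2)
  have hΛ := one_le_logb hΦ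
  have heL : (e : ℝ) ≤ 2 * Real.logb 2 (1 / ε) := he ▸ precExp_le hε hε2
  have hln : 0 ≤ Real.logb 2 n := Real.logb_nonneg one_lt_two hn'
  have hll : 0 ≤ Real.logb 2 (Real.logb 2 Φ) := Real.logb_nonneg one_lt_two hΛ
  have hM6 := six_le_numLevels hΦ
  have hM : (Nat.log 2 (numLevels Φ) : ℝ) ≤ 3 + Real.logb 2 (Real.logb 2 Φ) := by
    refine (natLog_le_logb (by omega)).trans ?_
    have : (3 : ℝ) = Real.logb 2 8 := by
      rw [show (8 : ℝ) = 2 ^ (3 : ℝ) by norm_num, Real.logb_rpow (by norm_num) (by norm_num)]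
    rw [this, ← Real.logb_mul (by norm_num) (by positivity)]
    refine Real.logb_le_logb_of_le one_lt_two (by exact_mod_cast (by omega : 0 < numLevels Φ)) ?_
    linarith [numLevels_le hΦ]
  have hP : (fieldWidth n d e (numLevels Φ) : ℝ) ≤
      Real.logb 2 n + d + e + Real.logb 2 (Real.logb 2 Φ) + 8 := by
    have h1 := natLog_le_logb hn
    have h2 : (Nat.log 2 d : ℝ) ≤ d := by exact_mod_cast Nat.log_le_self 2 d
    have h3 : (Nat.log 2 e : ℝ) ≤ e := by exact_mod_cast Nat.log_le_self 2 e
    unfold fieldWidth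
    push_cast
    linarith
  set L := Real.logb 2 (1 / ε)
  set ln := Real.logb 2 (n : ℝ)
  set ll := Real.logb 2 (Real.logb 2 Φ)
  set P : ℝ := (fieldWidth n d e (numLevels Φ) : ℝ) with hPdef
  have hP0 : 0 ≤ P := Nat.cast_nonneg _
  have hdL : (d : ℝ) ≤ d * L := le_mul_of_one_le_right (by linarith) hL
  have hLdL : L ≤ d * L := le_mul_of_one_le_left (by linarith) hd'
  have hlnL : ln ≤ ln * L := le_mul_of_one_le_right hln hL
  have hP1 : P ≤ 11 * (d * L) + ln * L + ll := by linarith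
  have hde : (d : ℝ) * (e + 5) ≤ 7 * (d * L) := by nlinarith
  have hrec : 3 * P + 2 * d * (e + 5) ≤ 47 * (d * L) + 3 * (ln * L) + 3 * ll := by nlinarith
  have hlen : (recPos (fieldWidth n d e (numLevels Φ)) d e c : ℝ) =
      3 * P + 1 + c * (3 * P + 2 * d * (e + 5)) := by
    unfold recPos; push_cast; rfl
  rw [hlen]
  have h1 : (c : ℝ) * (3 * P + 2 * d * (e + 5)) ≤
      12 * n * (47 * (d * L) + 3 * (ln * L) + 3 * ll) := by
    gcongr
  have h2 : 3 * P + 1 ≤ n * (34 * (d * L) + 3 * (ln * L) + 3 * ll) := by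
    refine le_trans ?_ (le_mul_of_one_le_left (by positivity) hn')
    linarith
  have h3 : 0 ≤ n * (d * L) := by positivity
  have h4 : 0 ≤ n * (ln * L) := by positivity
  have h5 : 0 ≤ n * ll := by positivity
  nlinarith

/-! ### Inputs -/

variable {x : Fin n → PiLp p (fun _ : Fin d => ℝ)}

/-- The coordinates of the points as a function of natural numbers. -/
def coord (x : Fin n → PiLp p (fun _ : Fin d => ℝ)) (a t : ℕ) : ℝ :=
  if h : a < n then if h' : t < d then x ⟨a, h⟩ ⟨t, h'⟩ else 0 else 0

noncomputable def coordDist (x : Fin n → PiLp p (fun _ : Fin d => ℝ)) (a b : ℕ) : ℝ :=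
  lpn p d fun t => coord x a t - coord x b t

theorem coordDist_eq (i j : Fin n) : coordDist x i j = ‖x i - x j‖ := by
  unfold coordDist lpn
  congr 1
  ext t
  simp [coord]

theorem finProdFinEquiv_symm_mk {m a t : ℕ} (ha : a < n) (ht : t < m) (h : a * m + t < n * m) :
    finProdFinEquiv.symm ⟨a * m + t, h⟩ = ((⟨a, ha⟩ : Fin n), (⟨t, ht⟩ : Fin m)) := by
  rw [Equiv.symm_apply_eq]
  ext
  simp only [finProdFinEquiv_apply_val]
  ring

theorem pointsInput_coord (a : ℕ) (ha : a < n) (t : ℕ) (ht : t < d) :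
    (pointsInput w ε Φ x).real 0 (a * d + t) = coord x a t := by
  have h := idx_lt ha ht
  change (if h : a * d + t < n * d then _ else _) = _
  rw [dif_pos h, finProdFinEquiv_symm_mk ha ht, coord, dif_pos ha, dif_pos ht]

variable [Fact (1 ≤ p)]

theorem coordDist_isDist : IsDist (coordDist x) where
  self a := by simp only [coordDist, sub_self]; exact lpn_zero
  comm a b := by
    have := lpn_mul (p := p) (d := d) (-1) fun t => coord x b t - coord x a t
    simp only [neg_mul, one_mul, neg_sub, abs_neg, abs_one] at this
    exact this
  tri a b c := by
    have := lpn_add_le (p := p) (d := d) (fun t => coord x a t - coord x b t)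
      fun t => coord x b t - coord x c t
    simp only [sub_add_sub_cancel] at this
    exact this

theorem metricInput_dist (a : ℕ) (ha : a < n) (b : ℕ) (hb : b < n) :
    (metricInput w ε Φ x).real 1 (a * n + b) = coordDist x a b := by
  have h := idx_lt ha hb
  change (if h : a * n + b < n * n then _ else _) = _
  rw [dif_pos h, finProdFinEquiv_symm_mk ha hb]
  exact (coordDist_eq ⟨a, ha⟩ ⟨b, hb⟩).symm

theorem sketchInput_metricInput :
    SketchInput w n d ε Φ (coord x) (coordDist x) (metricInput w ε Φ x) where
  n_eq := rfl
  d_eq := rfl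
  w_eq := rfl
  word_eq a i ha := by
    obtain ⟨a, rfl⟩ : ∃ b, a = b + 1 := ⟨a - 1, by omega⟩
    rfl
  eps_eq := rfl
  Phi_eq := rfl
  res_eq _ := rfl
  output_eq := rfl
  x_eq := pointsInput_coord (w := w) (ε := ε) (Φ := Φ)
  dist_eq := metricInput_dist

theorem sum_scaled_le {e : ℕ} {g : ℝ} (hd : 1 ≤ d)
    (hg : g = 16 * 2 ^ e * (d : ℝ) ^ (p.toReal)⁻¹) (a b : ℕ) :
    ∑ t ∈ Finset.range d, |g * (coord x a t - coord x b t)| ≤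
      16 * 2 ^ e * (d * coordDist x a b) := by
  have h1 := sum_abs_le_lpn p (f := fun t => coord x a t - coord x b t) hd
  have hg0 : 0 ≤ g := by rw [hg]; positivity
  simp only [abs_mul, abs_of_nonneg hg0, ← Finset.mul_sum]
  rw [hg, mul_assoc]
  exact mul_le_mul_of_nonneg_left h1 (by positivity)

end
end RealRAM

/-! ### The main theorem -/

open RealRAM in
theorem theorem1p3 :
    ∃ C κ : ℝ, 0 < C ∧ 0 < κ ∧
      ∀ (p : ℝ≥0∞) [Fact (1 ≤ p)],
      ∃ sketcher sketcher₀ estimator : RealRAM.Prog,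
      ∀ (n d : ℕ) (ε Φ : ℝ), 1 ≤ n → 1 ≤ d → 0 < ε → ε ≤ 1 / 2 → 2 ≤ Φ →
      ∀ w : ℕ, κ * Real.logb 2 (n * d * Φ / ε) ≤ w →
      ∀ x : Fin n → PiLp p (fun _ : Fin d => ℝ),
        (∀ i j, i ≠ j → 1 ≤ ‖x i - x j‖ ∧ ‖x i - x j‖ ≤ Φ) →
        ∃ sketch : List Bool,
          (sketch.length : ℝ) ≤
            C * (n * (d + Real.logb 2 n) * Real.logb 2 (1 / ε)
              + n * Real.logb 2 (Real.logb 2 Φ)) ∧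
          RealRAM.HaltsWithin p w sketcher (RealRAM.metricInput w ε Φ x)
            (C * ((n : ℝ) ^ 2 * Real.logb 2 Φ + n * d * Real.logb 2 (1 / ε)))
            (fun s => s.output = sketch) ∧
          RealRAM.HaltsWithin p w sketcher₀ (RealRAM.pointsInput w ε Φ x)
            (C * ((n : ℝ) ^ 2 * (d + Real.logb 2 Φ) + n * d * Real.logb 2 (1 / ε)))
            (fun s => s.output = sketch) ∧
          ∀ i j : Fin n,
            RealRAM.HaltsWithin p w estimator (RealRAM.queryInput w sketch i j)
              (C * (if p = ⊤ then d * Real.logb 2 Φ else d * Real.logb 2 (d * Φ)))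
              (fun s => (1 - ε) * ‖x i - x j‖ ≤ s.real 0 0 ∧
                s.real 0 0 ≤ (1 + ε) * ‖x i - x j‖) := by
  -- 32 comes from `wordBounds`. 20000 exceeds the constants 1000 of the size, 1200·6 and 10300 of
  -- the sketching time, 250 of the distance computation and 800·6 of the estimation, where 6
  -- relates the number of levels to log Φ.
  refine ⟨20000, 32, by norm_num, by norm_num, fun p _ => ⟨RealRAM.sketcher,
    .seq (storeDists p) RealRAM.sketcher, RealRAM.estimator p, ?_⟩⟩
  intro n d ε Φ hn hd hε hε2 hΦ w hw x hx
  have hn' : (1 : ℝ) ≤ n := by exact_mod_cast hn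
  have hd' : (1 : ℝ) ≤ d := by exact_mod_cast hd
  have hB := wordBounds hn hd hε hε2 hΦ hw
  have hL := one_le_logb (two_le_inv hε hε2)
  have hΛ := one_le_logb hΦ
  have hM := numLevels_le hΦ
  obtain ⟨g, hg⟩ : ∃ g : ℝ, g = 16 * 2 ^ precExp ε * (d : ℝ) ^ (p.toReal)⁻¹ := ⟨_, rfl⟩
  have hfar : ∀ a < n, ∀ b < n, a ≠ b → 1 ≤ coordDist x a b := fun a ha b hb hab => by
    have := (hx ⟨a, ha⟩ ⟨b, hb⟩ (by simpa using hab)).1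
    rwa [← coordDist_eq] at this
  -- Of the 5 in `numLevels`, one makes up for rounding the logarithm down, and four for the factor
  -- 16.
  have hdiam : ∀ a < n, ∀ b < n, 16 * coordDist x a b < 2 ^ numLevels Φ := fun a ha b hb => by
    have h1 : coordDist x a b ≤ Φ := by
      by_cases hab : a = b
      · rw [hab, coordDist_isDist.self]; linarith
      · have := (hx ⟨a, ha⟩ ⟨b, hb⟩ (by simpa using hab)).2
        rwa [← coordDist_eq] at this
    have h2 := lt_pow_log_floor Φ
    rw [numLevels, show Nat.log 2 ⌊Φ⌋₊ + 5 = Nat.log 2 ⌊Φ⌋₊ + 1 + 4 by omega, pow_add _ _ 4]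
    linarith
  obtain ⟨t, s', hs', ht, hsk⟩ := run_sketcher (p := p) hB
    (sketchInput_metricInput (w := w) (ε := ε) (Φ := Φ) (x := x)) rfl rfl rfl hg coordDist_isDist hfar
    hdiam (fun a _ b _ => sum_scaled_le hd hg a b)
    (Q := fun t s' => t ≤ 1200 * n * n * numLevels Φ + 10300 * n * d ∧
      IsSketch n d (precExp ε) (numLevels Φ) (fieldWidth n d (precExp ε) (numLevels Φ)) g (coord x)
        (coordDist x) s'.output) fun τ s' h1 h2 => ⟨h1, h2⟩
  have hnd : (n : ℝ) * d ≤ n * d * Real.logb 2 (1 / ε) := le_mul_of_one_le_right (by positivity) hL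
  have hnM : (n : ℝ) ^ 2 * numLevels Φ ≤ 6 * ((n : ℝ) ^ 2 * Real.logb 2 Φ) := by
    have := mul_le_mul_of_nonneg_left hM (sq_nonneg (n : ℝ))
    linarith
  have hnL : 0 ≤ (n : ℝ) ^ 2 * Real.logb 2 Φ := by positivity
  have ht' : (t : ℝ) ≤ 1200 * ((n : ℝ) ^ 2 * numLevels Φ) + 10300 * (n * d) := by
    have : (t : ℝ) ≤ ((1200 * n * n * numLevels Φ + 10300 * n * d : ℕ) : ℝ) := by exact_mod_cast ht
    push_cast at this
    linarith
  refine ⟨s'.output, ?_, ⟨t, s', hs', by linarith, rfl⟩, ?_, fun i j => ?_⟩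
  · obtain ⟨c, _, _, _, _, _, hc, -, hlen, -⟩ := hsk
    rw [hlen]
    refine (recPos_le hn hd hε hε2 hΦ rfl hc).trans ?_
    have h1 : 0 ≤ Real.logb 2 (n : ℝ) := Real.logb_nonneg one_lt_two hn'
    have h2 : 0 ≤ Real.logb 2 (Real.logb 2 Φ) := Real.logb_nonneg one_lt_two hΛ
    gcongr
    norm_num
  -- The first phase ends in a state equal to `metricInput`, so the execution already obtained for
  -- `sketcher` can be appended verbatim.
  · obtain ⟨t₀, s₀, hs₀, ht₀, rfl⟩ : Run p w (storeDists p) (pointsInput w ε Φ x) fun t s =>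
        t ≤ 250 * n * n * d ∧ s = metricInput w ε Φ x := by
      refine run_storeDists hB (F := (metricInput w ε Φ x).real 1) rfl rfl pointsInput_coord
        (fun i hi j hj => metricInput_dist i hi j hj) rfl rfl rfl rfl rfl ?_
      intro τ s hτ h1 h2 h3 h4 h5
      refine ⟨hτ, State.ext' (fun a k => by rw [h1]; rfl) (fun a k => ?_) h4 h5⟩
      rcases eq_or_ne a 1 with rfl | ha
      · rw [h3]
        split_ifs with hk
        · rfl
        · change 0 = if h : k < n * n then _ else _
          rw [dif_neg hk]
      · rw [h2 a ha]
        rcases a with _ | _ | _ | a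
        · rfl
        · exact absurd rfl ha
        · rcases k with _ | _ | k <;> rfl
        · rfl
    refine ⟨t₀ + t, s', .seq hs₀ hs', ?_, rfl⟩
    have h0 : (t₀ : ℝ) ≤ 250 * ((n : ℝ) ^ 2 * d) := by
      have : (t₀ : ℝ) ≤ ((250 * n * n * d : ℕ) : ℝ) := by exact_mod_cast ht₀
      push_cast at this
      linarith
    have h1 : 0 ≤ (n : ℝ) ^ 2 * d := by positivity
    push_cast
    linarith
  · obtain ⟨t₁, s₁, hs₁, ht₁, hacc⟩ := run_estimator_of_isSketch hB hsk hg (fun a _ b _ => rfl) hfar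
      i.2 j.2 (Q := fun t s => t ≤ 800 * d * numLevels Φ ∧
        |s.real 0 0 - coordDist x i j| ≤ coordDist x i j / 2 ^ precExp ε)
      fun τ s' h1 h2 => ⟨h1, h2⟩
    refine ⟨t₁, s₁, hs₁, ?_, ?_⟩
    · have h1 : (t₁ : ℝ) ≤ 800 * (d * numLevels Φ) := by
        have : (t₁ : ℝ) ≤ ((800 * d * numLevels Φ : ℕ) : ℝ) := by exact_mod_cast ht₁
        push_cast at this
        linarith
      have h2 : (d : ℝ) * numLevels Φ ≤ d * (6 * Real.logb 2 Φ) := by gcongr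
      have h3 : 0 ≤ d * Real.logb 2 Φ := by positivity
      split_ifs
      · linarith
      · have h4 : Real.logb 2 Φ ≤ Real.logb 2 (d * Φ) :=
          Real.logb_le_logb_of_le one_lt_two (by linarith) (le_mul_of_one_le_left (by linarith) hd')
        have h5 : d * Real.logb 2 Φ ≤ d * Real.logb 2 (d * Φ) := by gcongr
        linarith
    · rw [coordDist_eq] at hacc
      have h1 : ‖x i - x j‖ / 2 ^ precExp ε ≤ ε * ‖x i - x j‖ := by
        have h2 : 1 / ε < 2 ^ precExp ε := lt_pow_log_floor (1 / ε)
        rw [div_lt_iff₀ hε] at h2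
        rw [div_le_iff₀ (by positivity)]
        nlinarith [norm_nonneg (x i - x j)]
      have h3 := abs_le.1 (hacc.trans h1)
      constructor <;> linarith [h3.1, h3.2]
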